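/- Let $L\ge 1$ be a fixed integer, $\sigma^2>0$, and let $K=K(N)$ be positive integers with $K/N\to c>0$ as $N\to\infty$. For each $N$ let $s_{ik}=s_{ik}(N)$, $1\le i\le N$, $1\le k\le K$, be i.i.d. complex random variables whose common law does not depend on $N$, with $\mathbf E s_{11}=0$ and $\mathbf E|s_{11}|^2=1$, and suppose that one of the following holds: (a) the $s_{ik}(N)=s_{ik}$ are, for all $N$, the entries of a single doubly infinite array $\{s_{ik}: i,k=1,2,\dots\}$ of i.i.d. random variables, and $\mathbf E|s_{11}|^4<\infty$; or (b) no assumption is made on the dependence between the arrays for different $N$, and $\mathbf E|s_{11}|^6<\infty$. Put $\mathbf s_k=(s_{1k},\dots,s_{Nk})^T$. For each $N$ let $\gamma_k(\ell)=\gamma_k^N(\ell)\in\mathbb C$ and $T_k=T_k^N\ge 0$, $1\le k\le K$, $1\le \ell\le L$, be random variables that are jointly independent of $(\mathbf s_1,\dots,\mathbf s_K)$, put $\boldsymbol\alpha_k=\sqrt{T_k}\,(\gamma_k(1),\dots,\gamma_k(L))^T$, and assume that almost surely the empirical distribution $\frac1K\sum_{k=1}^K\delta_{\boldsymbol\alpha_k}$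 converges weakly, as $N\to\infty$, to a nonrandom probability distribution $H$ on $\mathbb C^L$. Let $\boldsymbol\beta_k=\sqrt{T_k}\,(\gamma_k(1)\mathbf s_k^T,\dots,\gamma_k(L)\mathbf s_k^T)^T\in\mathbb C^{NL}$ and $$C_k=\frac1N\Big(\sum_{j=1}^K\boldsymbol\beta_j\boldsymbol\beta_j^*-\boldsymbol\beta_k\boldsymbol\beta_k^*\Big),\qquad 1\le k\le K.$$ Let $I$ be the $NL\times NL$ identity matrix, and write $(C_k+\sigma^2I)^{-1}_{\ell\ell'}$ for the $\ell,\ell'$ block, of size $N\times N$, of $(C_k+\sigma^2 I)^{-1}$. Then there is exactly one Hermitian positive definite $L\times L$ matrix $A=(a_{\ell\ell'})$ satisfying $$A=\Big(c\,\mathbf E\,\frac{\boldsymbol\alpha\boldsymbol\alpha^*}{1+\boldsymbol\alpha^*A\boldsymbol\alpha}+\sigma^2I_L\Big)^{-1},$$ where $\boldsymbol\alpha\in\mathbb C^L$ has distribution $H$, and for all $\ell,\ell'\in\{1,\dots,L\}$, $$\max_{k\le K}\big|N^{-1}\mathbf s_k^*(C_k+\sigma^2I)^{-1}_{\ell\ell'}\mathbf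 s_k-a_{\ell\ell'}\big|\to0\quad\text{almost surely as }N\to\infty.$$ -/

import Mathlib

/-!
Write `R_k = (C_k + σ² I)⁻¹` and `R = (N⁻¹ ∑ⱼ βⱼ βⱼ* + σ² I)⁻¹`.

The column `s_k` is independent of `R_k`. Truncating and recentring its entries and applying an
exponential concentration inequality to the quadratic form, one finds that, uniformly in `k` and
almost surely, `N⁻¹ s_k* (R_k)_{l l'} s_k` is close to `N⁻¹ tr (R_k)_{l l'}`, which is within
`(N σ²)⁻¹` of `N⁻¹ tr R_{l l'}` because `C_k` differs from the full sum by a rank one matrix. The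
moment conditions (a) and (b) serve to make all entries of the arrays `o(√N)`; the tail of a column
beyond a fixed threshold is then a sum of bounded variables, to which a Chernoff bound applies.

The Sherman–Morrison formula turns the block trace of `R (N⁻¹ ∑ⱼ βⱼ βⱼ* + σ² I) = I` into an exact
identity that becomes the fixed point equation for every limit point of the `L × L` matrices
`(N⁻¹ tr R_{l l'})`. These stay bounded, and by tightness of the empirical distributions uniformly
positive definite, so it remains to see that the equation has only one positive definite solution:
if `B ≤ t A` with `t > 1` minimal, then inserting this in the equation gives `B ≤ u A` for some
`u < t`, a contradiction.
-/

open MeasureTheory ProbabilityTheory Filter Topology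
open scoped ComplexOrder Matrix BoundedContinuousFunction ENNReal

namespace CDMA

noncomputable section

/-- A standardized law on `ℂ`: `E X = 0` and `E |X|² = 1`. -/
structure IsStandardized (ν : Measure ℂ) : Prop where
  isProbabilityMeasure : IsProbabilityMeasure ν
  memLp_two : MemLp (fun z : ℂ => z) 2 ν
  mean_zero : ∫ z, z ∂ν = 0
  second_moment : ∫ z, ‖z‖ ^ 2 ∂ν = 1

/-- The family `X` of complex random variables is i.i.d. with common law `ν`. -/
structure IsIID {Ω : Type*} [MeasurableSpace Ω] {ι : Type*} (X : ι → Ω → ℂ) (ν : Measure ℂ)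
    (P : Measure Ω) : Prop where
  measurable : ∀ i, Measurable (X i)
  indep : iIndepFun X P
  law : ∀ i, P.map (X i) = ν

/-- For every `N` the `N × K(N)` array `s N` is the upper left corner of one and the same doubly
infinite array of i.i.d. random variables with law `ν`. -/
def FromDoubleArray {Ω : Type*} [MeasurableSpace Ω] {K : ℕ → ℕ}
    (s : (N : ℕ) → Fin N → Fin (K N) → Ω → ℂ) (ν : Measure ℂ) (P : Measure Ω) : Prop :=
  ∃ x : ℕ → ℕ → Ω → ℂ, IsIID (fun p : ℕ × ℕ => x p.1 p.2) ν P ∧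
    ∀ (N : ℕ) (i : Fin N) (k : Fin (K N)), s N i k = x i k

/-- For every `N` separately, the entries of the `N × K(N)` array `s N` are i.i.d. with law `ν`
(the same law for all `N`); nothing is assumed on the joint law of the arrays for different
`N`. -/
def RowwiseIID {Ω : Type*} [MeasurableSpace Ω] {K : ℕ → ℕ}
    (s : (N : ℕ) → Fin N → Fin (K N) → Ω → ℂ) (ν : Measure ℂ) (P : Measure Ω) : Prop :=
  ∀ N : ℕ, IsIID (fun p : Fin N × Fin (K N) => s N p.1 p.2) ν P

/-- The empirical distribution `n⁻¹ ∑ₖ δ_{xₖ}` of `x₁, …, xₙ` (the zero measure if `n = 0`). -/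
def empiricalMeasure {E : Type*} [MeasurableSpace E] {n : ℕ} (x : Fin n → E) : Measure E :=
  (n : ℝ≥0∞)⁻¹ • ∑ k, Measure.dirac (x k)

/-- Weak convergence of a sequence of measures, tested on bounded continuous functions. -/
def WeaklyConverges {E : Type*} [TopologicalSpace E] [MeasurableSpace E]
    (μ : ℕ → Measure E) (H : Measure E) : Prop :=
  ∀ f : E →ᵇ ℝ, Tendsto (fun n => ∫ z, f z ∂(μ n)) atTop (𝓝 (∫ z, f z ∂H))

variable {L N K : ℕ}

/-- `α = √t (g(1), …, g(L))ᵀ`: transmit power `t`, fading gains `g`. -/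
def gain (t : ℝ) (g : Fin L → ℂ) : Fin L → ℂ := fun l => ((√t : ℝ) : ℂ) * g l

/-- The stacked vector `β = (a(1) vᵀ, …, a(L) vᵀ)ᵀ ∈ ℂ^{NL}`; the index `(l, i)` is the `i`-th
entry of the `l`-th block. -/
def stack (a : Fin L → ℂ) (v : Fin N → ℂ) : Fin L × Fin N → ℂ := fun p => a p.1 * v p.2

/-- `C_k = N⁻¹ (∑ⱼ βⱼ βⱼ* - β_k β_k*)`, where `βⱼ` is built from `a j` and from the `j`-th
column of `s`. -/
def interference (a : Fin K → Fin L → ℂ) (s : Fin N → Fin K → ℂ) (k : Fin K) :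
    Matrix (Fin L × Fin N) (Fin L × Fin N) ℂ :=
  (N : ℂ)⁻¹ •
    ((∑ j, Matrix.vecMulVec (stack (a j) (fun i => s i j)) (star (stack (a j) (fun i => s i j))))
      - Matrix.vecMulVec (stack (a k) (fun i => s i k)) (star (stack (a k) (fun i => s i k))))

/-- The `N × N` block of an `NL × NL` matrix at position `l, l'`. -/
def block (M : Matrix (Fin L × Fin N) (Fin L × Fin N) ℂ) (l l' : Fin L) :
    Matrix (Fin N) (Fin N) ℂ :=
  Matrix.of fun i j => M (l, i) (l', j)

/-- `N⁻¹ s_k* (C_k + σ² I)⁻¹_{l l'} s_k`. -/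
def userForm (σ : ℝ) (a : Fin K → Fin L → ℂ) (s : Fin N → Fin K → ℂ) (k : Fin K)
    (l l' : Fin L) : ℂ :=
  (N : ℂ)⁻¹ * (star (fun i => s i k) ⬝ᵥ
    (block (interference a s k + ((σ : ℂ) ^ 2) • 1)⁻¹ l l' *ᵥ fun i => s i k))

/-- The matrix `E [α α* / (1 + α* A α)]`, entry by entry, where `α` has law `H`. -/
def expectedMatrix (H : Measure (Fin L → ℂ)) (A : Matrix (Fin L) (Fin L) ℂ) :
    Matrix (Fin L) (Fin L) ℂ :=
  Matrix.of fun l l' => ∫ z, z l * star (z l') / (1 + star z ⬝ᵥ (A *ᵥ z)) ∂H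

/-- The equation `A = (c E [α α* / (1 + α* A α)] + σ² I_L)⁻¹`, where `α` has law `H`. -/
def FixedPoint (c σ : ℝ) (H : Measure (Fin L → ℂ)) (A : Matrix (Fin L) (Fin L) ℂ) : Prop :=
  A = ((c : ℂ) • expectedMatrix H A + ((σ : ℂ) ^ 2) • 1)⁻¹

end

end CDMA

namespace CDMA

section QuadraticForm

variable {ι : Type*} [Fintype ι]

/-- The squared Euclidean norm of a complex vector; the norm of the function type `ι → ℂ` is the
sup norm. -/
noncomputable def sqNorm (x : ι → ℂ) : ℝ := ∑ i, ‖x i‖ ^ 2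

/-- The quadratic form `x* M x` of a Hermitian matrix `M`, as a real number; for other matrices it
is the form of the Hermitian part. -/
noncomputable def quadForm (M : Matrix ι ι ℂ) (x : ι → ℂ) : ℝ := (star x ⬝ᵥ (M *ᵥ x)).re

lemma sqNorm_nonneg (x : ι → ℂ) : 0 ≤ sqNorm x := Finset.sum_nonneg fun _ _ => by positivity

lemma sq_norm_apply_le_sqNorm (x : ι → ℂ) (i : ι) : ‖x i‖ ^ 2 ≤ sqNorm x :=
  Finset.single_le_sum (f := fun i => ‖x i‖ ^ 2) (fun _ _ => by positivity) (Finset.mem_univ i)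

lemma sqNorm_eq_norm_sq (x : ι → ℂ) : sqNorm x = ‖WithLp.toLp 2 x‖ ^ 2 := by
  rw [EuclideanSpace.norm_sq_eq]; rfl

lemma sqrt_sqNorm (x : ι → ℂ) : √(sqNorm x) = ‖WithLp.toLp 2 x‖ := by
  rw [sqNorm_eq_norm_sq, Real.sqrt_sq (norm_nonneg _)]

lemma sqNorm_pos {x : ι → ℂ} (hx : x ≠ 0) : 0 < sqNorm x := by
  rw [sqNorm_eq_norm_sq]
  exact pow_pos (norm_pos_iff.2 fun h => hx ((WithLp.toLp_eq_zero 2).1 h)) 2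

lemma star_dotProduct_self (x : ι → ℂ) : star x ⬝ᵥ x = (sqNorm x : ℂ) := by
  simp [dotProduct, sqNorm, Complex.conj_mul']

lemma norm_star_dotProduct_le (x y : ι → ℂ) :
    ‖star x ⬝ᵥ y‖ ≤ √(sqNorm x) * √(sqNorm y) := by
  rw [sqrt_sqNorm, sqrt_sqNorm, dotProduct_comm]
  exact norm_inner_le_norm (𝕜 := ℂ) (WithLp.toLp 2 x : EuclideanSpace ℂ ι) (WithLp.toLp 2 y)

lemma norm_star_dotProduct_sq_le (x y : ι → ℂ) :
    ‖star x ⬝ᵥ y‖ ^ 2 ≤ sqNorm x * sqNorm y := by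
  refine (pow_le_pow_left₀ (norm_nonneg _) (norm_star_dotProduct_le x y) 2).trans_eq ?_
  rw [mul_pow, Real.sq_sqrt (sqNorm_nonneg x), Real.sq_sqrt (sqNorm_nonneg y)]

lemma star_dotProduct_mulVec_comm {M : Matrix ι ι ℂ} (hM : M.IsHermitian) (x y : ι → ℂ) :
    star x ⬝ᵥ (M *ᵥ y) = star (star y ⬝ᵥ (M *ᵥ x)) := by
  rw [Matrix.star_dotProduct, Matrix.star_mulVec, hM.eq, ← Matrix.dotProduct_mulVec]

lemma ofReal_quadForm {M : Matrix ι ι ℂ} (hM : M.IsHermitian) (x : ι → ℂ) :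
    (quadForm M x : ℂ) = star x ⬝ᵥ (M *ᵥ x) :=
  Complex.conj_eq_iff_re.1 (star_dotProduct_mulVec_comm hM x x).symm

lemma quadForm_nonneg {M : Matrix ι ι ℂ} (hM : M.PosSemidef) (x : ι → ℂ) : 0 ≤ quadForm M x :=
  hM.re_dotProduct_nonneg x

lemma quadForm_add (M M' : Matrix ι ι ℂ) (x : ι → ℂ) :
    quadForm (M + M') x = quadForm M x + quadForm M' x := by
  simp [quadForm, Matrix.add_mulVec]

lemma quadForm_ofReal_smul (t : ℝ) (M : Matrix ι ι ℂ) (x : ι → ℂ) :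
    quadForm ((t : ℂ) • M) x = t * quadForm M x := by
  simp [quadForm, Matrix.smul_mulVec]

lemma quadForm_sum {κ : Type*} (S : Finset κ) (M : κ → Matrix ι ι ℂ) (x : ι → ℂ) :
    quadForm (∑ k ∈ S, M k) x = ∑ k ∈ S, quadForm (M k) x := by
  simp [quadForm, Matrix.sum_mulVec, dotProduct_sum]

lemma posSemidef_of_quadForm {M : Matrix ι ι ℂ} (hM : M.IsHermitian)
    (h : ∀ x, 0 ≤ quadForm M x) : M.PosSemidef :=
  .of_dotProduct_mulVec_nonneg hM fun x => by
    rw [← ofReal_quadForm hM]; exact_mod_cast h x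

lemma posDef_of_quadForm {M : Matrix ι ι ℂ} (hM : M.IsHermitian)
    (h : ∀ x, x ≠ 0 → 0 < quadForm M x) : M.PosDef :=
  .of_dotProduct_mulVec_pos hM fun x hx => by
    rw [← ofReal_quadForm hM]; exact_mod_cast h x hx

lemma quadForm_sub_smul {M : Matrix ι ι ℂ} (hM : M.IsHermitian) (x y : ι → ℂ) (s : ℝ) :
    quadForm M (x - (s : ℂ) • y)
      = quadForm M x - 2 * s * (star x ⬝ᵥ (M *ᵥ y)).re + s ^ 2 * quadForm M y := by
  have h := congrArg Complex.re (star_dotProduct_mulVec_comm hM x y)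
  simp only [RCLike.star_def, Complex.conj_re] at h
  simp only [quadForm, Matrix.mulVec_sub, Matrix.mulVec_smul, star_sub, star_smul,
    sub_dotProduct, dotProduct_sub, smul_dotProduct, dotProduct_smul, smul_eq_mul,
    RCLike.star_def, Complex.conj_ofReal, Complex.sub_re, Complex.re_ofReal_mul]
  rw [← h]; ring

lemma quadForm_vecMulVec_star (b x : ι → ℂ) :
    quadForm (Matrix.vecMulVec b (star b)) x = ‖star b ⬝ᵥ x‖ ^ 2 := by
  rw [quadForm, Matrix.vecMulVec_mulVec, op_smul_eq_smul, dotProduct_smul,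
    Matrix.star_dotProduct x b, smul_eq_mul, RCLike.star_def, Complex.mul_conj',
    ← Complex.ofReal_pow, Complex.ofReal_re]

open scoped MatrixOrder in
/-- Bessel's inequality for the rows of `B`, where `M = B* B`. -/
lemma sum_quadForm_le_trace {κ : Type*} [Fintype κ] {M : Matrix ι ι ℂ}
    (hM : M.PosSemidef) {y : κ → EuclideanSpace ℂ ι} (hy : Orthonormal ℂ y) :
    ∑ i, quadForm M (y i) ≤ M.trace.re := by
  classical
  obtain ⟨B, rfl⟩ := CStarAlgebra.nonneg_iff_eq_star_mul_self.mp hM.nonneg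
  rw [Matrix.star_eq_conjTranspose]
  let row : ι → EuclideanSpace ℂ ι := fun j => WithLp.toLp 2 (star (B j))
  have hform : ∀ i, quadForm (Bᴴ * B) (y i) = ∑ j, ‖inner ℂ (y i) (row j)‖ ^ 2 := by
    intro i
    rw [quadForm, ← Matrix.mulVec_mulVec, Matrix.dotProduct_mulVec, ← Matrix.star_mulVec,
      star_dotProduct_self, Complex.ofReal_re, sqNorm]
    refine Finset.sum_congr rfl fun j _ => ?_
    rw [EuclideanSpace.inner_eq_star_dotProduct, Matrix.mulVec, Matrix.star_dotProduct_star,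
      norm_star, dotProduct_comm]
  have htrace : (Bᴴ * B).trace.re = ∑ j, ‖row j‖ ^ 2 := by
    rw [Matrix.trace_mul_comm, Matrix.trace, Complex.re_sum]
    refine Finset.sum_congr rfl fun j _ => ?_
    simp [row, EuclideanSpace.norm_sq_eq, Matrix.mul_apply, Complex.mul_conj', ← Complex.ofReal_pow]
  rw [htrace, Finset.sum_congr rfl fun i _ => hform i, Finset.sum_comm]
  exact Finset.sum_le_sum fun j _ => hy.sum_inner_products_le _

lemma exists_orthonormal_inner_eq_zero {κ : Type*} (v : κ → EuclideanSpace ℂ ι) (S : Finset κ) :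
    ∃ y : Fin (Fintype.card ι - S.card) → EuclideanSpace ℂ ι,
      Orthonormal ℂ y ∧ ∀ k ∈ S, ∀ i, inner ℂ (v k) (y i) = 0 := by
  classical
  let U : Submodule ℂ (EuclideanSpace ℂ ι) := Submodule.span ℂ (S.image v : Finset _)
  have hdim : Fintype.card ι - S.card ≤ Module.finrank ℂ Uᗮ := by
    have h := U.finrank_add_finrank_orthogonal
    rw [finrank_euclideanSpace] at h
    have hU : Module.finrank ℂ U ≤ S.card :=
      (finrank_span_finset_le_card _).trans Finset.card_image_le
    omega
  let e := stdOrthonormalBasis ℂ Uᗮ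
  refine ⟨fun i => (e (Fin.castLE hdim i) : EuclideanSpace ℂ ι),
    (e.orthonormal.comp_linearIsometry Uᗮ.subtypeₗᵢ).comp _ (Fin.castLE_injective hdim),
    fun k hk i => Submodule.inner_right_of_mem_orthogonal (Submodule.subset_span ?_)
      (e (Fin.castLE hdim i)).2⟩
  exact Finset.mem_coe.2 (Finset.mem_image_of_mem v hk)

end QuadraticForm

section OperatorNorm

open scoped Matrix.Norms.L2Operator

variable {ι : Type*} [Fintype ι] [DecidableEq ι]

lemma sqrt_sqNorm_mulVec_le (M : Matrix ι ι ℂ) (x : ι → ℂ) :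
    √(sqNorm (M *ᵥ x)) ≤ ‖M‖ * √(sqNorm x) := by
  rw [sqrt_sqNorm, sqrt_sqNorm]
  exact Matrix.l2_opNorm_mulVec M (WithLp.toLp 2 x)

lemma l2_opNorm_le {M : Matrix ι ι ℂ} {d : ℝ} (hd : 0 ≤ d)
    (h : ∀ x, √(sqNorm (M *ᵥ x)) ≤ d * √(sqNorm x)) : ‖M‖ ≤ d := by
  rw [Matrix.l2_opNorm_def]
  refine ContinuousLinearMap.opNorm_le_bound _ hd fun x => ?_
  have hx := h x.ofLp
  rwa [sqrt_sqNorm, sqrt_sqNorm] at hx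

lemma sqNorm_mulVec_le (M : Matrix ι ι ℂ) (x : ι → ℂ) :
    sqNorm (M *ᵥ x) ≤ ‖M‖ ^ 2 * sqNorm x := by
  have h := pow_le_pow_left₀ (Real.sqrt_nonneg _) (sqrt_sqNorm_mulVec_le M x) 2
  rwa [mul_pow, Real.sq_sqrt (sqNorm_nonneg _), Real.sq_sqrt (sqNorm_nonneg _)] at h

lemma norm_star_dotProduct_mulVec_le (M : Matrix ι ι ℂ) (x y : ι → ℂ) :
    ‖star x ⬝ᵥ (M *ᵥ y)‖ ≤ ‖M‖ * (√(sqNorm x) * √(sqNorm y)) := by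
  refine (norm_star_dotProduct_le x (M *ᵥ y)).trans ?_
  rw [mul_left_comm]
  exact mul_le_mul_of_nonneg_left (sqrt_sqNorm_mulVec_le M y) (Real.sqrt_nonneg _)

lemma norm_star_dotProduct_mulVec_self_le (M : Matrix ι ι ℂ) (x : ι → ℂ) :
    ‖star x ⬝ᵥ (M *ᵥ x)‖ ≤ ‖M‖ * sqNorm x := by
  simpa only [Real.mul_self_sqrt (sqNorm_nonneg x)] using norm_star_dotProduct_mulVec_le M x x

lemma quadForm_le (M : Matrix ι ι ℂ) (x : ι → ℂ) : quadForm M x ≤ ‖M‖ * sqNorm x :=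
  (Complex.re_le_norm _).trans (norm_star_dotProduct_mulVec_self_le M x)

lemma sqNorm_single_one (i : ι) : sqNorm (Pi.single i 1 : ι → ℂ) = 1 := by
  simp [sqNorm, Pi.single_apply, apply_ite]

lemma norm_apply_le_l2_opNorm (M : Matrix ι ι ℂ) (i j : ι) : ‖M i j‖ ≤ ‖M‖ := by
  have h := (sq_norm_apply_le_sqNorm _ i).trans (sqNorm_mulVec_le M (Pi.single j 1))
  rw [sqNorm_single_one, mul_one, Matrix.mulVec_single_one] at h
  exact le_of_sq_le_sq h (norm_nonneg _)

lemma l2_opNorm_le_of_norm_apply_le {M : Matrix ι ι ℂ} {ε : ℝ} (hε : 0 ≤ ε)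
    (h : ∀ i j, ‖M i j‖ ≤ ε) : ‖M‖ ≤ Fintype.card ι * ε := by
  refine l2_opNorm_le (by positivity) fun x => ?_
  have hrow : ∀ i, sqNorm (star (M i)) ≤ Fintype.card ι * ε ^ 2 := fun i => by
    calc sqNorm (star (M i)) ≤ ∑ _j : ι, ε ^ 2 := Finset.sum_le_sum fun j _ => by
          rw [Pi.star_apply, norm_star]; gcongr; exact h i j
      _ = _ := by simp
  have hcoord : ∀ i, ‖(M *ᵥ x) i‖ ^ 2 ≤ Fintype.card ι * ε ^ 2 * sqNorm x := fun i => by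
    have hi := norm_star_dotProduct_sq_le (star (M i)) x
    rw [star_star] at hi
    exact hi.trans (mul_le_mul_of_nonneg_right (hrow i) (sqNorm_nonneg x))
  have hsum : sqNorm (M *ᵥ x) ≤ (Fintype.card ι * ε * √(sqNorm x)) ^ 2 := by
    calc sqNorm (M *ᵥ x) ≤ ∑ _i : ι, Fintype.card ι * ε ^ 2 * sqNorm x :=
          Finset.sum_le_sum fun i _ => hcoord i
      _ = _ := by
          rw [mul_pow, Real.sq_sqrt (sqNorm_nonneg x), Finset.sum_const, Finset.card_univ,
            nsmul_eq_mul]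
          ring
  exact (Real.sqrt_le_left (by positivity)).2 hsum

lemma norm_trace_le (M : Matrix ι ι ℂ) : ‖M.trace‖ ≤ Fintype.card ι * ‖M‖ := by
  refine (norm_sum_le _ _).trans ((Finset.sum_le_sum fun i _ =>
    norm_apply_le_l2_opNorm M i i).trans ?_)
  simp

lemma norm_vecMulVec_star_le (z : ι → ℂ) : ‖Matrix.vecMulVec z (star z)‖ ≤ sqNorm z := by
  refine l2_opNorm_le (sqNorm_nonneg z) fun x => ?_
  have hmul : Matrix.vecMulVec z (star z) *ᵥ x = (star z ⬝ᵥ x) • z := by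
    rw [Matrix.vecMulVec_mulVec, op_smul_eq_smul]
  rw [hmul, sqrt_sqNorm, WithLp.toLp_smul, norm_smul, ← sqrt_sqNorm]
  calc ‖star z ⬝ᵥ x‖ * √(sqNorm z) ≤ √(sqNorm z) * √(sqNorm x) * √(sqNorm z) := by
        gcongr; exact norm_star_dotProduct_le z x
    _ = √(sqNorm z) * √(sqNorm z) * √(sqNorm x) := by ring
    _ = sqNorm z * √(sqNorm x) := by rw [Real.mul_self_sqrt (sqNorm_nonneg z)]

end OperatorNorm

section Inverse

lemma posDef_add_smul_vecMulVec {ι : Type*} [Finite ι] {Q : Matrix ι ι ℂ} (hQ : Q.PosDef)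
    {t : ℝ} (ht : 0 ≤ t) (b : ι → ℂ) : (Q + (t : ℂ) • Matrix.vecMulVec b (star b)).PosDef :=
  hQ.add_posSemidef ((Matrix.posSemidef_vecMulVec_self_star b).smul (by exact_mod_cast ht))

variable {ι : Type*} [Fintype ι] [DecidableEq ι]

lemma inv_mulVec_mulVec {Q : Matrix ι ι ℂ} (hQ : Q.PosDef) (x : ι → ℂ) :
    Q⁻¹ *ᵥ (Q *ᵥ x) = x := by
  rw [Matrix.mulVec_mulVec, Matrix.nonsing_inv_mul _ ((Matrix.isUnit_iff_isUnit_det _).1 hQ.isUnit),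
    Matrix.one_mulVec]

lemma mulVec_inv_mulVec {Q : Matrix ι ι ℂ} (hQ : Q.PosDef) (x : ι → ℂ) :
    Q *ᵥ (Q⁻¹ *ᵥ x) = x := by
  rw [Matrix.mulVec_mulVec, Matrix.mul_nonsing_inv _ ((Matrix.isUnit_iff_isUnit_det _).1 hQ.isUnit),
    Matrix.one_mulVec]

lemma quadForm_inv {Q : Matrix ι ι ℂ} (hQ : Q.PosDef) (x : ι → ℂ) :
    quadForm Q (Q⁻¹ *ᵥ x) = quadForm Q⁻¹ x := by
  rw [quadForm, mulVec_inv_mulVec hQ, quadForm, Matrix.star_dotProduct]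
  simp

lemma quadForm_inv_sub_smul {Q : Matrix ι ι ℂ} (hQ : Q.PosDef) (x y : ι → ℂ) (t : ℝ) :
    quadForm Q (Q⁻¹ *ᵥ x - (t : ℂ) • y)
      = quadForm Q⁻¹ x - 2 * t * (star x ⬝ᵥ y).re + t ^ 2 * quadForm Q y := by
  rw [quadForm_sub_smul hQ.isHermitian, quadForm_inv hQ,
    star_dotProduct_mulVec_comm hQ.isHermitian, mulVec_inv_mulVec hQ, ← Matrix.star_dotProduct]

lemma le_quadForm_inv {Q : Matrix ι ι ℂ} (hQ : Q.PosDef) (x : ι → ℂ) (t : ℝ) :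
    2 * t * sqNorm x - t ^ 2 * quadForm Q x ≤ quadForm Q⁻¹ x := by
  have h := quadForm_nonneg hQ.posSemidef (Q⁻¹ *ᵥ x - (t : ℂ) • x)
  rw [quadForm_inv_sub_smul hQ, star_dotProduct_self, Complex.ofReal_re] at h
  linarith

lemma quadForm_inv_le {F G : Matrix ι ι ℂ} (hF : F.PosDef) (hG : G.PosDef) {s : ℝ} (hs : 0 ≤ s)
    (h : ∀ x, s * quadForm F x ≤ quadForm G x) (x : ι → ℂ) :
    s * quadForm G⁻¹ x ≤ quadForm F⁻¹ x := by
  have hF0 := quadForm_nonneg hF.posSemidef (F⁻¹ *ᵥ x - (s : ℂ) • (G⁻¹ *ᵥ x))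
  rw [quadForm_inv_sub_smul hF] at hF0
  have hG0 := mul_le_mul_of_nonneg_left (h (G⁻¹ *ᵥ x)) hs
  rw [quadForm_inv hG] at hG0
  change 0 ≤ quadForm F⁻¹ x - 2 * s * quadForm G⁻¹ x + _ at hF0
  linarith

open scoped Matrix.Norms.L2Operator in
lemma exists_le_quadForm {κ : Type*} [Fintype κ] {A : Matrix κ κ ℂ} (hA : A.PosDef) :
    ∃ δ > 0, ∀ x, δ * sqNorm x ≤ quadForm A x := by
  classical
  refine ⟨(‖A⁻¹‖ + 1)⁻¹, by positivity, fun x => ?_⟩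
  have hx := sqNorm_nonneg x
  have hlower := le_quadForm_inv hA.inv x (‖A⁻¹‖ + 1)⁻¹
  rw [Matrix.nonsing_inv_nonsing_inv _ ((Matrix.isUnit_iff_isUnit_det _).1 hA.isUnit)] at hlower
  have hupper : (‖A⁻¹‖ + 1)⁻¹ ^ 2 * quadForm A⁻¹ x ≤ (‖A⁻¹‖ + 1)⁻¹ * sqNorm x := by
    calc (‖A⁻¹‖ + 1)⁻¹ ^ 2 * quadForm A⁻¹ x
        ≤ (‖A⁻¹‖ + 1)⁻¹ ^ 2 * ((‖A⁻¹‖ + 1) * sqNorm x) := by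
          gcongr
          exact (quadForm_le _ x).trans (by gcongr; linarith)
      _ = (‖A⁻¹‖ + 1)⁻¹ * sqNorm x := by field_simp
  linarith

/-- The Sherman–Morrison formula, applied to the perturbing vector. -/
lemma inv_add_smul_vecMulVec_mulVec {Q : Matrix ι ι ℂ} (hQ : Q.PosDef) {t : ℝ} (ht : 0 ≤ t)
    (b : ι → ℂ) :
    (Q + (t : ℂ) • Matrix.vecMulVec b (star b))⁻¹ *ᵥ b
      = ((1 + t * quadForm Q⁻¹ b : ℝ) : ℂ)⁻¹ • (Q⁻¹ *ᵥ b) := by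
  have hQ' := posDef_add_smul_vecMulVec hQ ht b
  set Q' := Q + (t : ℂ) • Matrix.vecMulVec b (star b) with hQ'_def
  have hpos : 0 < 1 + t * quadForm Q⁻¹ b :=
    add_pos_of_pos_of_nonneg one_pos (mul_nonneg ht (quadForm_nonneg hQ.inv.posSemidef b))
  have hmul : Q' *ᵥ (Q⁻¹ *ᵥ b) = ((1 + t * quadForm Q⁻¹ b : ℝ) : ℂ) • b := by
    rw [hQ'_def, Matrix.add_mulVec, mulVec_inv_mulVec hQ, Matrix.smul_mulVec,
      Matrix.vecMulVec_mulVec, op_smul_eq_smul, ← ofReal_quadForm hQ.inv.isHermitian, smul_smul]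
    push_cast
    rw [add_smul, one_smul]
  have hinv : Q⁻¹ *ᵥ b = ((1 + t * quadForm Q⁻¹ b : ℝ) : ℂ) • (Q'⁻¹ *ᵥ b) := by
    rw [← Matrix.mulVec_smul, ← hmul, inv_mulVec_mulVec hQ']
  rw [hinv, smul_smul, inv_mul_cancel₀ (by exact_mod_cast hpos.ne'), one_smul]

lemma inv_sub_inv_add_smul_vecMulVec {Q : Matrix ι ι ℂ} (hQ : Q.PosDef) {t : ℝ} (ht : 0 ≤ t)
    (b : ι → ℂ) :
    Q⁻¹ - (Q + (t : ℂ) • Matrix.vecMulVec b (star b))⁻¹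
      = ((t / (1 + t * quadForm Q⁻¹ b) : ℝ) : ℂ) •
        Matrix.vecMulVec (Q⁻¹ *ᵥ b) (star (Q⁻¹ *ᵥ b)) := by
  have hQ' := posDef_add_smul_vecMulVec hQ ht b
  rw [← neg_sub, Matrix.inv_sub_inv (iff_of_true hQ'.isUnit hQ.isUnit), ← neg_mul, ← mul_neg,
    neg_sub, add_sub_cancel_left, Matrix.mul_smul, Matrix.smul_mul, Matrix.mul_vecMulVec,
    Matrix.vecMulVec_mul, inv_add_smul_vecMulVec_mulVec hQ ht, Matrix.smul_vecMulVec, smul_smul,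
    Matrix.star_mulVec, hQ.inv.isHermitian.eq, div_eq_mul_inv, Complex.ofReal_mul,
    Complex.ofReal_inv]

end Inverse

section RegInv

lemma posDef_add_sq_smul_one {ι : Type*} [DecidableEq ι] {C : Matrix ι ι ℂ}
    (hC : C.PosSemidef) {σ : ℝ} (hσ : 0 < σ) : (C + ((σ : ℂ) ^ 2) • 1).PosDef :=
  .posSemidef_add hC (Matrix.PosDef.one.smul (by exact_mod_cast pow_pos hσ 2))

variable {ι : Type*} [Fintype ι] [DecidableEq ι] {C : Matrix ι ι ℂ} {σ : ℝ}

/-- The regularized inverse `(C + σ² I)⁻¹`, that is, the resolvent of `C` at `-σ²`. -/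
noncomputable def regInv (σ : ℝ) (C : Matrix ι ι ℂ) : Matrix ι ι ℂ := (C + ((σ : ℂ) ^ 2) • 1)⁻¹

lemma regInv_posDef (hC : C.PosSemidef) (hσ : 0 < σ) : (regInv σ C).PosDef :=
  (posDef_add_sq_smul_one hC hσ).inv

lemma quadForm_add_sq_smul_one (C : Matrix ι ι ℂ) (σ : ℝ) (x : ι → ℂ) :
    quadForm (C + ((σ : ℂ) ^ 2) • 1) x = quadForm C x + σ ^ 2 * sqNorm x := by
  rw [quadForm_add, ← Complex.ofReal_pow, quadForm_ofReal_smul]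
  congr 2
  rw [quadForm, Matrix.one_mulVec, star_dotProduct_self, Complex.ofReal_re]

lemma sq_mul_sqNorm_regInv_mulVec_le (hC : C.PosSemidef) (hσ : 0 < σ) (x : ι → ℂ) :
    σ ^ 2 * sqNorm (regInv σ C *ᵥ x) ≤ quadForm (regInv σ C) x := by
  rw [regInv, ← quadForm_inv (posDef_add_sq_smul_one hC hσ), quadForm_add_sq_smul_one]
  linarith [quadForm_nonneg hC ((C + ((σ : ℂ) ^ 2) • 1)⁻¹ *ᵥ x)]

open scoped Matrix.Norms.L2Operator in
lemma norm_regInv_le (hC : C.PosSemidef) (hσ : 0 < σ) : ‖regInv σ C‖ ≤ (σ ^ 2)⁻¹ := by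
  refine l2_opNorm_le (by positivity) fun x => ?_
  have h : σ ^ 2 * √(sqNorm (regInv σ C *ᵥ x)) ^ 2
      ≤ √(sqNorm x) * √(sqNorm (regInv σ C *ᵥ x)) := by
    rw [Real.sq_sqrt (sqNorm_nonneg _)]
    exact (sq_mul_sqNorm_regInv_mulVec_le hC hσ x).trans
      ((Complex.re_le_norm _).trans (norm_star_dotProduct_le x _))
  rw [inv_mul_eq_div, le_div_iff₀' (by positivity)]
  rcases (Real.sqrt_nonneg (sqNorm (regInv σ C *ᵥ x))).eq_or_lt with h0 | h0
  · rw [← h0, mul_zero]; exact Real.sqrt_nonneg _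
  · nlinarith

end RegInv

section Blocks

open scoped Matrix.Norms.L2Operator

variable {L N : ℕ}

/-- The `L × L` matrix of the normalized traces `N⁻¹ tr M_{l l'}` of the `N × N` blocks of `M`. -/
noncomputable def blockTrace :
    Matrix (Fin L × Fin N) (Fin L × Fin N) ℂ →ₗ[ℂ] Matrix (Fin L) (Fin L) ℂ where
  toFun M := Matrix.of fun l l' => (N : ℂ)⁻¹ * (block M l l').trace
  map_add' M M' := by
    ext l l'; simp [block, Matrix.trace, Finset.sum_add_distrib, mul_add]
  map_smul' t M := by
    ext l l'; simp [block, Matrix.trace, Finset.mul_sum, mul_left_comm]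

/-- The `L × L` matrix of the normalized forms `N⁻¹ v* M_{l l'} v` of the `N × N` blocks of `M`. -/
noncomputable def blockForm (M : Matrix (Fin L × Fin N) (Fin L × Fin N) ℂ) (v : Fin N → ℂ) :
    Matrix (Fin L) (Fin L) ℂ :=
  Matrix.of fun l l' => (N : ℂ)⁻¹ * (star v ⬝ᵥ (block M l l' *ᵥ v))

lemma blockTrace_apply (M : Matrix (Fin L × Fin N) (Fin L × Fin N) ℂ) (l l' : Fin L) :
    blockTrace M l l' = (N : ℂ)⁻¹ * (block M l l').trace := rfl

lemma blockTrace_one (hN : 0 < N) :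
    blockTrace (1 : Matrix (Fin L × Fin N) (Fin L × Fin N) ℂ) = 1 := by
  ext l l'
  have hN' : (N : ℂ) ≠ 0 := by exact_mod_cast hN.ne'
  by_cases h : l = l' <;> simp [blockTrace_apply, block, Matrix.trace, Matrix.one_apply, h, hN']

lemma star_stack_dotProduct_stack (a x : Fin L → ℂ) (v y : Fin N → ℂ) :
    star (stack a v) ⬝ᵥ stack x y = (star a ⬝ᵥ x) * (star v ⬝ᵥ y) := by
  simp only [dotProduct, stack, Pi.star_apply, Fintype.sum_prod_type, Finset.sum_mul_sum,
    star_mul', mul_mul_mul_comm]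

lemma sqNorm_stack (x : Fin L → ℂ) (y : Fin N → ℂ) :
    sqNorm (stack x y) = sqNorm x * sqNorm y := by
  simp only [sqNorm, stack, Fintype.sum_prod_type, Finset.sum_mul_sum, norm_mul, mul_pow]

lemma sqNorm_apply_le_sqNorm (w : Fin L × Fin N → ℂ) (l : Fin L) :
    sqNorm (fun i => w (l, i)) ≤ sqNorm w := by
  rw [sqNorm, sqNorm, Fintype.sum_prod_type]
  exact Finset.single_le_sum (f := fun l => ∑ i, ‖w (l, i)‖ ^ 2) (fun _ _ => by positivity)
    (Finset.mem_univ l)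

lemma mulVec_stack_apply (M : Matrix (Fin L × Fin N) (Fin L × Fin N) ℂ) (x : Fin L → ℂ)
    (v : Fin N → ℂ) (l : Fin L) (i : Fin N) :
    (M *ᵥ stack x v) (l, i) = ∑ l', x l' * (block M l l' *ᵥ v) i := by
  simp only [Matrix.mulVec, dotProduct, stack, block, Matrix.of_apply, Fintype.sum_prod_type,
    Finset.mul_sum, mul_left_comm]

lemma norm_block_le (M : Matrix (Fin L × Fin N) (Fin L × Fin N) ℂ) (l l' : Fin L) :
    ‖block M l l'‖ ≤ ‖M‖ := by
  refine l2_opNorm_le (norm_nonneg M) fun x => ?_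
  have hslice : block M l l' *ᵥ x = fun i => (M *ᵥ stack (Pi.single l' 1) x) (l, i) := by
    ext i
    simp [mulVec_stack_apply, Pi.single_apply]
  have h := sqrt_sqNorm_mulVec_le M (stack (Pi.single l' 1) x)
  rw [sqNorm_stack, sqNorm_single_one, one_mul] at h
  rw [hslice]
  exact (Real.sqrt_le_sqrt (sqNorm_apply_le_sqNorm _ l)).trans h

lemma norm_blockTrace_apply_le (M : Matrix (Fin L × Fin N) (Fin L × Fin N) ℂ) (l l' : Fin L) :
    ‖blockTrace M l l'‖ ≤ ‖M‖ := by
  rw [blockTrace_apply, norm_mul, norm_inv, Complex.norm_natCast]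
  calc (N : ℝ)⁻¹ * ‖(block M l l').trace‖ ≤ (N : ℝ)⁻¹ * (N * ‖M‖) := by
        have h := norm_trace_le (block M l l')
        rw [Fintype.card_fin] at h
        gcongr
        exact h.trans (by gcongr; exact norm_block_le M l l')
    _ = (N : ℝ)⁻¹ * N * ‖M‖ := by ring
    _ ≤ ‖M‖ := mul_le_of_le_one_left (norm_nonneg M) inv_mul_le_one

lemma norm_blockTrace_vecMulVec_apply_le (w : Fin L × Fin N → ℂ) (l l' : Fin L) :
    ‖blockTrace (Matrix.vecMulVec w (star w)) l l'‖ ≤ (N : ℝ)⁻¹ * sqNorm w := by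
  have htrace : (block (Matrix.vecMulVec w (star w)) l l').trace
      = star (fun i => w (l', i)) ⬝ᵥ fun i => w (l, i) := by
    simp [block, Matrix.trace, dotProduct, Matrix.vecMulVec_apply, mul_comm]
  rw [blockTrace_apply, htrace, norm_mul, norm_inv, Complex.norm_natCast]
  gcongr
  refine (norm_star_dotProduct_le _ _).trans ?_
  rw [← Real.mul_self_sqrt (sqNorm_nonneg w)]
  gcongr <;> exact sqNorm_apply_le_sqNorm w _

lemma star_dotProduct_blockForm_mulVec (M : Matrix (Fin L × Fin N) (Fin L × Fin N) ℂ)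
    (x z : Fin L → ℂ) (v : Fin N → ℂ) :
    star x ⬝ᵥ (blockForm M v *ᵥ z) = (N : ℂ)⁻¹ * (star (stack x v) ⬝ᵥ (M *ᵥ stack z v)) := by
  simp only [dotProduct, Fintype.sum_prod_type, mulVec_stack_apply]
  simp only [Matrix.mulVec, blockForm, dotProduct, stack, Matrix.of_apply, Pi.star_apply, star_mul',
    Finset.mul_sum, Finset.sum_mul]
  refine Finset.sum_congr rfl fun l _ => ?_
  rw [Finset.sum_comm]
  exact Finset.sum_congr rfl fun i _ => Finset.sum_congr rfl fun l' _ =>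
    Finset.sum_congr rfl fun j _ => by ring

lemma blockTrace_vecMulVec_mulVec_stack (M : Matrix (Fin L × Fin N) (Fin L × Fin N) ℂ)
    (x y : Fin L → ℂ) (v : Fin N → ℂ) :
    blockTrace (Matrix.vecMulVec (M *ᵥ stack x v) (star (stack y v)))
      = Matrix.vecMulVec (blockForm M v *ᵥ x) (star y) := by
  ext l l'
  simp only [blockTrace_apply, block, Matrix.trace, Matrix.diag_apply, Matrix.of_apply,
    Matrix.vecMulVec_apply, mulVec_stack_apply]
  simp only [Matrix.mulVec, blockForm, dotProduct, stack, block, Matrix.of_apply, Pi.star_apply,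
    star_mul', Finset.mul_sum, Finset.sum_mul]
  rw [Finset.sum_comm]
  exact Finset.sum_congr rfl fun l' _ => Finset.sum_congr rfl fun i _ =>
    Finset.sum_congr rfl fun j _ => by ring

/-- The matrix of the map `y ↦ stack x y`; it compresses `NL × NL` matrices to `N × N` ones. -/
def stackMatrix (N : ℕ) (x : Fin L → ℂ) : Matrix (Fin L × Fin N) (Fin N) ℂ :=
  Matrix.of fun p j => if p.2 = j then x p.1 else 0

lemma stackMatrix_mulVec (x : Fin L → ℂ) (y : Fin N → ℂ) :
    stackMatrix N x *ᵥ y = stack x y := by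
  ext p; simp [stackMatrix, Matrix.mulVec, dotProduct, stack]

lemma quadForm_conjTranspose_stackMatrix_mul (M : Matrix (Fin L × Fin N) (Fin L × Fin N) ℂ)
    (x : Fin L → ℂ) (y : Fin N → ℂ) :
    quadForm ((stackMatrix N x)ᴴ * M * stackMatrix N x) y = quadForm M (stack x y) := by
  rw [quadForm, quadForm, ← stackMatrix_mulVec, ← Matrix.mulVec_mulVec, ← Matrix.mulVec_mulVec,
    Matrix.dotProduct_mulVec, Matrix.star_mulVec]

lemma conjTranspose_stackMatrix_mul_eq_sum (M : Matrix (Fin L × Fin N) (Fin L × Fin N) ℂ)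
    (x : Fin L → ℂ) :
    (stackMatrix N x)ᴴ * M * stackMatrix N x
      = ∑ l, ∑ l', (star (x l) * x l') • block M l l' := by
  ext i j
  simp only [Matrix.mul_apply, stackMatrix, Matrix.conjTranspose_apply, Matrix.of_apply,
    Fintype.sum_prod_type, apply_ite star, star_zero, ite_mul, zero_mul, mul_ite, mul_zero,
    Finset.sum_ite_eq', Finset.mem_univ, if_true, Finset.sum_mul, Matrix.sum_apply,
    Matrix.smul_apply, block, smul_eq_mul]
  rw [Finset.sum_comm]
  exact Finset.sum_congr rfl fun l _ => Finset.sum_congr rfl fun l' _ => by ring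

lemma trace_conjTranspose_stackMatrix_mul (hN : 0 < N)
    (M : Matrix (Fin L × Fin N) (Fin L × Fin N) ℂ) (x : Fin L → ℂ) :
    ((stackMatrix N x)ᴴ * M * stackMatrix N x).trace
      = N * (star x ⬝ᵥ (blockTrace M *ᵥ x)) := by
  have hN' : (N : ℂ) ≠ 0 := by exact_mod_cast hN.ne'
  simp only [conjTranspose_stackMatrix_mul_eq_sum, Matrix.trace_sum, Matrix.trace_smul,
    dotProduct, Matrix.mulVec, blockTrace_apply, Pi.star_apply, Finset.mul_sum, smul_eq_mul]
  refine Finset.sum_congr rfl fun l _ => Finset.sum_congr rfl fun l' _ => ?_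
  field_simp

lemma blockTrace_isHermitian {M : Matrix (Fin L × Fin N) (Fin L × Fin N) ℂ}
    (hM : M.IsHermitian) : (blockTrace M).IsHermitian := by
  ext l l'
  have h : ∀ p q, star (M p q) = M q p := fun p q => hM.apply q p
  simp [Matrix.conjTranspose_apply, blockTrace_apply, block, Matrix.trace, star_sum, h]

/-- Each form `y ↦ Q⁻¹[stack x y]` is bounded below by `2 t x* x - t² Q[stack x y]`, and over
orthonormal `y` these forms sum to at most the trace of the compression of `Q⁻¹`. -/
lemma sum_sub_le_quadForm_blockTrace_inv (hN : 0 < N)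
    {Q : Matrix (Fin L × Fin N) (Fin L × Fin N) ℂ} (hQ : Q.PosDef) {κ : Type*} [Fintype κ]
    {y : κ → EuclideanSpace ℂ (Fin N)} (hy : Orthonormal ℂ y) (x : Fin L → ℂ) (t : ℝ) :
    ∑ i, (2 * t * sqNorm x - t ^ 2 * quadForm Q (stack x (y i)))
      ≤ N * quadForm (blockTrace Q⁻¹) x := by
  have htrace := sum_quadForm_le_trace
    (hQ.inv.posSemidef.conjTranspose_mul_mul_same (stackMatrix N x)) hy
  rw [trace_conjTranspose_stackMatrix_mul hN, ← Complex.ofReal_natCast,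
    Complex.re_ofReal_mul] at htrace
  simp only [quadForm_conjTranspose_stackMatrix_mul] at htrace
  refine (Finset.sum_le_sum fun i _ => ?_).trans htrace
  have h := le_quadForm_inv hQ (stack x (y i)) t
  rwa [sqNorm_stack, sqNorm_eq_norm_sq (y i).ofLp, WithLp.toLp_ofLp, hy.1 i, one_pow, mul_one] at h

end Blocks

section Model

variable {L N K : ℕ} {σ : ℝ}

/-- The matrix `z z* / (1 + z* M z)`, whose entries are the integrands of `expectedMatrix`. -/
noncomputable def gainKernel (M : Matrix (Fin L) (Fin L) ℂ) (z : Fin L → ℂ) :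
    Matrix (Fin L) (Fin L) ℂ :=
  (1 + star z ⬝ᵥ (M *ᵥ z))⁻¹ • Matrix.vecMulVec z (star z)

/-- The vector `β_k` of the `k`-th user. -/
def userVector (a : Fin K → Fin L → ℂ) (s : Fin N → Fin K → ℂ) (k : Fin K) : Fin L × Fin N → ℂ :=
  stack (a k) fun i => s i k

/-- `N⁻¹ ∑ⱼ βⱼ βⱼ*`, the matrix `C_k` without the removal of the `k`-th user. -/
noncomputable def totalMatrix (a : Fin K → Fin L → ℂ) (s : Fin N → Fin K → ℂ) :
    Matrix (Fin L × Fin N) (Fin L × Fin N) ℂ :=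
  (N : ℂ)⁻¹ • ∑ j, Matrix.vecMulVec (userVector a s j) (star (userVector a s j))

/-- The `L × L` matrix of the normalized block traces of `(N⁻¹ ∑ⱼ βⱼ βⱼ* + σ² I)⁻¹`, the random
matrix that converges to `A`. -/
noncomputable def traceMatrix (σ : ℝ) (a : Fin K → Fin L → ℂ) (s : Fin N → Fin K → ℂ) :
    Matrix (Fin L) (Fin L) ℂ :=
  blockTrace (regInv σ (totalMatrix a s))

/-- The `L × L` matrix with entries `userForm σ a s k l l'`. -/
noncomputable def userMatrix (σ : ℝ) (a : Fin K → Fin L → ℂ) (s : Fin N → Fin K → ℂ) (k : Fin K) :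
    Matrix (Fin L) (Fin L) ℂ :=
  blockForm (regInv σ (interference a s k)) fun i => s i k

lemma posSemidef_smul_sum_vecMulVec {ι κ : Type*} [Finite ι] (S : Finset κ) (b : κ → ι → ℂ)
    (N : ℕ) :
    ((N : ℂ)⁻¹ • ∑ j ∈ S, Matrix.vecMulVec (b j) (star (b j))).PosSemidef :=
  (Matrix.posSemidef_sum S fun j _ => Matrix.posSemidef_vecMulVec_self_star (b j)).smul
    (by simp)

lemma interference_eq_sum_erase (a : Fin K → Fin L → ℂ) (s : Fin N → Fin K → ℂ) (k : Fin K) :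
    interference a s k = (N : ℂ)⁻¹ • ∑ j ∈ Finset.univ.erase k,
      Matrix.vecMulVec (userVector a s j) (star (userVector a s j)) := by
  rw [Finset.sum_erase_eq_sub (Finset.mem_univ k)]
  rfl

lemma interference_posSemidef (a : Fin K → Fin L → ℂ) (s : Fin N → Fin K → ℂ) (k : Fin K) :
    (interference a s k).PosSemidef := by
  rw [interference_eq_sum_erase]
  exact posSemidef_smul_sum_vecMulVec _ _ _

lemma totalMatrix_posSemidef (a : Fin K → Fin L → ℂ) (s : Fin N → Fin K → ℂ) :
    (totalMatrix a s).PosSemidef :=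
  posSemidef_smul_sum_vecMulVec _ _ _

lemma totalMatrix_eq_interference_add (a : Fin K → Fin L → ℂ) (s : Fin N → Fin K → ℂ)
    (k : Fin K) :
    totalMatrix a s = interference a s k +
      (((N : ℝ)⁻¹ : ℝ) : ℂ) • Matrix.vecMulVec (userVector a s k) (star (userVector a s k)) := by
  rw [totalMatrix, interference_eq_sum_erase, Complex.ofReal_inv, Complex.ofReal_natCast,
    ← smul_add, Finset.sum_erase_add _ _ (Finset.mem_univ k)]

/-- A positive perturbation of rank one changes the normalized block traces of the resolvent by
`O(1/N)`, whatever its size. -/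
lemma norm_blockTrace_regInv_sub_le (hσ : 0 < σ)
    {C : Matrix (Fin L × Fin N) (Fin L × Fin N) ℂ} (hC : C.PosSemidef) {t : ℝ} (ht : 0 ≤ t)
    (b : Fin L × Fin N → ℂ) (l l' : Fin L) :
    ‖(blockTrace (regInv σ C)
      - blockTrace (regInv σ (C + (t : ℂ) • Matrix.vecMulVec b (star b)))) l l'‖
      ≤ (σ ^ 2)⁻¹ / N := by
  have hq := quadForm_nonneg (regInv_posDef hC hσ).posSemidef b
  have hw := sq_mul_sqNorm_regInv_mulVec_le hC hσ b
  rw [← map_sub, regInv, regInv, add_right_comm,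
    inv_sub_inv_add_smul_vecMulVec (posDef_add_sq_smul_one hC hσ) ht, ← regInv, map_smul,
    Matrix.smul_apply, norm_smul, Complex.norm_real, Real.norm_of_nonneg (by positivity)]
  set q := quadForm (regInv σ C) b
  set w := regInv σ C *ᵥ b
  calc t / (1 + t * q) * ‖blockTrace (Matrix.vecMulVec w (star w)) l l'‖
      ≤ t / (1 + t * q) * ((N : ℝ)⁻¹ * (q / σ ^ 2)) := by
        gcongr
        refine (norm_blockTrace_vecMulVec_apply_le w l l').trans ?_
        gcongr
        rwa [le_div_iff₀' (by positivity)]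
    _ = t * q / (1 + t * q) * ((σ ^ 2)⁻¹ / N) := by ring
    _ ≤ (σ ^ 2)⁻¹ / N :=
        mul_le_of_le_one_left (by positivity) ((div_le_one (by positivity)).2 (by linarith))

lemma norm_blockTrace_sub_traceMatrix_le (hσ : 0 < σ) (a : Fin K → Fin L → ℂ)
    (s : Fin N → Fin K → ℂ) (k : Fin K) (l l' : Fin L) :
    ‖(blockTrace (regInv σ (interference a s k)) - traceMatrix σ a s) l l'‖ ≤ (σ ^ 2)⁻¹ / N := by
  rw [traceMatrix, totalMatrix_eq_interference_add a s k]
  exact norm_blockTrace_regInv_sub_le hσ (interference_posSemidef a s k) (by positivity) _ l l'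

lemma regInv_totalMatrix_mulVec_userVector (hσ : 0 < σ) (a : Fin K → Fin L → ℂ)
    (s : Fin N → Fin K → ℂ) (k : Fin K) :
    regInv σ (totalMatrix a s) *ᵥ userVector a s k
      = (1 + star (a k) ⬝ᵥ (userMatrix σ a s k *ᵥ a k))⁻¹ •
        (regInv σ (interference a s k) *ᵥ userVector a s k) := by
  have hC := interference_posSemidef a s k
  rw [totalMatrix_eq_interference_add a s k, regInv, add_right_comm,
    inv_add_smul_vecMulVec_mulVec (posDef_add_sq_smul_one hC hσ) (by positivity), ← regInv,
    userMatrix, star_dotProduct_blockForm_mulVec, Complex.ofReal_add, Complex.ofReal_mul,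
    ofReal_quadForm (regInv_posDef hC hσ).isHermitian, Complex.ofReal_one, Complex.ofReal_inv,
    Complex.ofReal_natCast]
  rfl

/-- The block traces of `(N⁻¹ ∑ⱼ βⱼ βⱼ* + σ² I)⁻¹ (N⁻¹ ∑ⱼ βⱼ βⱼ* + σ² I) = I`. Up to the replacement
of the `userMatrix` by the `traceMatrix` this is the fixed-point equation. -/
lemma traceMatrix_add_sum_userMatrix_mul_gainKernel (hσ : 0 < σ) (hN : 0 < N)
    (a : Fin K → Fin L → ℂ) (s : Fin N → Fin K → ℂ) :
    (σ : ℂ) ^ 2 • traceMatrix σ a s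
      + (N : ℂ)⁻¹ • ∑ k, userMatrix σ a s k * gainKernel (userMatrix σ a s k) (a k) = 1 := by
  have huser : ∀ k, blockTrace (Matrix.vecMulVec (regInv σ (totalMatrix a s) *ᵥ userVector a s k)
      (star (userVector a s k))) = userMatrix σ a s k * gainKernel (userMatrix σ a s k) (a k) :=
    fun k => by
      rw [regInv_totalMatrix_mulVec_userVector hσ, Matrix.smul_vecMulVec, map_smul, userVector,
        blockTrace_vecMulVec_mulVec_stack, gainKernel, Matrix.mul_smul, Matrix.mul_vecMulVec]
      rfl
  have hinv : regInv σ (totalMatrix a s) * (totalMatrix a s + ((σ : ℂ) ^ 2) • 1) = 1 :=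
    Matrix.nonsing_inv_mul _ ((Matrix.isUnit_iff_isUnit_det _).1
      (posDef_add_sq_smul_one (totalMatrix_posSemidef a s) hσ).isUnit)
  have htrace := congrArg blockTrace hinv
  rw [blockTrace_one hN, mul_add, map_add, Matrix.mul_smul, mul_one, map_smul, add_comm] at htrace
  rw [← htrace, traceMatrix]
  congr 1
  simp only [← huser, ← Matrix.mul_vecMulVec]
  rw [← map_sum, ← Finset.mul_sum, ← map_smul, ← Matrix.mul_smul]
  rfl

open scoped Matrix.Norms.L2Operator in
lemma norm_traceMatrix_apply_le (hσ : 0 < σ) (a : Fin K → Fin L → ℂ) (s : Fin N → Fin K → ℂ)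
    (l l' : Fin L) : ‖traceMatrix σ a s l l'‖ ≤ (σ ^ 2)⁻¹ :=
  (norm_blockTrace_apply_le _ l l').trans (norm_regInv_le (totalMatrix_posSemidef a s) hσ)

lemma quadForm_totalMatrix_stack (a : Fin K → Fin L → ℂ) (s : Fin N → Fin K → ℂ)
    (x : Fin L → ℂ) (y : Fin N → ℂ) :
    quadForm (totalMatrix a s) (stack x y)
      = (N : ℝ)⁻¹ * ∑ k, ‖star (a k) ⬝ᵥ x‖ ^ 2 * ‖star (fun i => s i k) ⬝ᵥ y‖ ^ 2 := by
  rw [totalMatrix, ← Complex.ofReal_natCast, ← Complex.ofReal_inv, quadForm_ofReal_smul,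
    quadForm_sum]
  simp only [quadForm_vecMulVec_star, userVector, star_stack_dotProduct_stack, norm_mul, mul_pow]

lemma sum_norm_star_dotProduct_sq_le {ι κ : Type*} [Fintype ι] [Fintype κ]
    {y : κ → EuclideanSpace ℂ ι} (hy : Orthonormal ℂ y) (v : ι → ℂ) :
    ∑ i, ‖star v ⬝ᵥ (y i).ofLp‖ ^ 2 ≤ sqNorm v := by
  have hdot : ∀ i, ‖star v ⬝ᵥ (y i).ofLp‖ = ‖inner ℂ (y i) (WithLp.toLp 2 v)‖ := fun i => by
    rw [norm_inner_symm, EuclideanSpace.inner_eq_star_dotProduct, dotProduct_comm]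
  simp only [hdot]
  rw [sqNorm_eq_norm_sq]
  exact hy.sum_inner_products_le (WithLp.toLp 2 v)

/-- Users with a large gain vector do not contribute if the `y i` are orthogonal to their columns;
the others are controlled by Bessel's inequality. -/
lemma sum_quadForm_totalMatrix_stack_le {B m : ℝ} (hB : 0 ≤ B) (hm : 0 ≤ m)
    (a : Fin K → Fin L → ℂ) (s : Fin N → Fin K → ℂ) (hs : ∀ k, sqNorm (fun i => s i k) ≤ B * N)
    {κ : Type*} [Fintype κ] {y : κ → EuclideanSpace ℂ (Fin N)} (hy : Orthonormal ℂ y)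
    (hort : ∀ k, m < sqNorm (a k) → ∀ i, star (fun j => s j k) ⬝ᵥ (y i).ofLp = 0)
    (x : Fin L → ℂ) :
    ∑ i, quadForm (totalMatrix a s) (stack x (y i)) ≤ m * B * K * sqNorm x := by
  have hx := sqNorm_nonneg x
  have huser : ∀ k, ‖star (a k) ⬝ᵥ x‖ ^ 2 *
      ∑ i, ‖star (fun j => s j k) ⬝ᵥ (y i).ofLp‖ ^ 2 ≤ m * sqNorm x * (B * N) := fun k => by
    rcases lt_or_ge m (sqNorm (a k)) with hk | hk
    · rw [Finset.sum_eq_zero fun i _ => by rw [hort k hk i, norm_zero, zero_pow two_ne_zero],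
        mul_zero]
      positivity
    · refine mul_le_mul ((norm_star_dotProduct_sq_le _ _).trans ?_)
        ((sum_norm_star_dotProduct_sq_le hy _).trans (hs k)) (by positivity) (by positivity)
      gcongr
  simp only [quadForm_totalMatrix_stack, ← Finset.mul_sum]
  rw [Finset.sum_comm]
  simp only [← Finset.mul_sum]
  calc (N : ℝ)⁻¹ * ∑ k, ‖star (a k) ⬝ᵥ x‖ ^ 2 * ∑ i, ‖star (fun j => s j k) ⬝ᵥ (y i).ofLp‖ ^ 2
      ≤ (N : ℝ)⁻¹ * ∑ _k : Fin K, m * sqNorm x * (B * N) :=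
        mul_le_mul_of_nonneg_left (Finset.sum_le_sum fun k _ => huser k) (by positivity)
    _ = (N : ℝ)⁻¹ * N * (m * B * K * sqNorm x) := by
        rw [Finset.sum_const, Finset.card_univ, Fintype.card_fin, nsmul_eq_mul]; ring
    _ ≤ m * B * K * sqNorm x := mul_le_of_le_one_left (by positivity) inv_mul_le_one

lemma exists_orthonormal_dotProduct_eq_zero (s : Fin N → Fin K → ℂ) {S : Finset (Fin K)}
    (hS : 2 * S.card ≤ N) :
    ∃ r : ℕ, N ≤ 2 * r ∧ ∃ y : Fin r → EuclideanSpace ℂ (Fin N),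
      Orthonormal ℂ y ∧ ∀ k ∈ S, ∀ i, star (fun j => s j k) ⬝ᵥ (y i).ofLp = 0 := by
  obtain ⟨y, hy, hort⟩ := exists_orthonormal_inner_eq_zero (fun k => WithLp.toLp 2 fun j => s j k) S
  refine ⟨_, ?_, y, hy, fun k hk i => ?_⟩
  · rw [Fintype.card_fin]; omega
  · rw [dotProduct_comm]; exact hort k hk i

/-- At least `N/2` dimensions are orthogonal to all columns with a large gain vector, and in these
directions `N⁻¹ ∑ⱼ βⱼ βⱼ*` is bounded on average. -/
lemma sqNorm_div_le_quadForm_traceMatrix {B m p : ℝ} (hσ : 0 < σ) (hB : 0 ≤ B) (hm : 0 ≤ m)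
    (hN : 0 < N) (hp : m * B * K ≤ p * N) (a : Fin K → Fin L → ℂ) (s : Fin N → Fin K → ℂ)
    (hs : ∀ k, sqNorm (fun i => s i k) ≤ B * N)
    (ha : 2 * (Finset.univ.filter fun k => m < sqNorm (a k)).card ≤ N) (x : Fin L → ℂ) :
    sqNorm x / (2 * (σ ^ 2 + 2 * p)) ≤ quadForm (traceMatrix σ a s) x := by
  obtain ⟨r, hr, y, hy, hort⟩ := exists_orthonormal_dotProduct_eq_zero s ha
  have hr2 : (N : ℝ) ≤ 2 * r := by exact_mod_cast hr
  have hN' : (0 : ℝ) < N := by exact_mod_cast hN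
  have hp0 : 0 ≤ p := nonneg_of_mul_nonneg_left (le_trans (by positivity) hp) hN'
  have hx := sqNorm_nonneg x
  set t := (σ ^ 2 + 2 * p)⁻¹ with ht
  have ht0 : 0 < t := by positivity
  have htσ : t * σ ^ 2 + 2 * (t * p) = 1 := by rw [ht]; field_simp
  have hlower := sum_sub_le_quadForm_blockTrace_inv hN
    (posDef_add_sq_smul_one (totalMatrix_posSemidef a s) hσ) hy x t
  have hy1 : ∀ i, sqNorm (y i).ofLp = 1 := fun i => by
    rw [sqNorm_eq_norm_sq, WithLp.toLp_ofLp, hy.1, one_pow]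
  simp only [quadForm_add_sq_smul_one, sqNorm_stack, hy1, mul_one] at hlower
  rw [Finset.sum_sub_distrib, ← Finset.mul_sum, ← Finset.mul_sum, Finset.sum_add_distrib] at hlower
  simp only [Finset.sum_const, Finset.card_univ, Fintype.card_fin, nsmul_eq_mul] at hlower
  have hupper := sum_quadForm_totalMatrix_stack_le hB hm a s hs hy
    (fun k hk => hort k (Finset.mem_filter.2 ⟨Finset.mem_univ k, hk⟩)) x
  replace hupper := hupper.trans (mul_le_mul_of_nonneg_right hp hx)
  refine le_of_mul_le_mul_left ?_ hN'
  calc N * (sqNorm x / (2 * (σ ^ 2 + 2 * p)))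
      = sqNorm x * t * (N * (1 - t * σ ^ 2 / 2) - N * (t * p)) := by
        rw [show 1 - t * σ ^ 2 / 2 = 1 / 2 + t * p by linarith, ht]; field_simp; ring
    _ ≤ sqNorm x * t * (2 * r * (1 - t * σ ^ 2 / 2) - N * (t * p)) := by
        gcongr
        linarith [mul_nonneg ht0.le hp0]
    _ = 2 * t * (r * sqNorm x) - t ^ 2 * (p * N * sqNorm x + r * (σ ^ 2 * sqNorm x)) := by ring
    _ ≤ _ := (by gcongr : _ ≤ _ - t ^ 2 * (_ + _)).trans hlower

end Model

section FixedPointEquation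

open scoped Matrix.Norms.L2Operator

variable {L : ℕ} {A B : Matrix (Fin L) (Fin L) ℂ} {H : Measure (Fin L → ℂ)}

lemma expectedMatrix_apply (H : Measure (Fin L → ℂ)) (A : Matrix (Fin L) (Fin L) ℂ)
    (l l' : Fin L) : expectedMatrix H A l l' = ∫ z, gainKernel A z l l' ∂H := by
  simp only [expectedMatrix, gainKernel, Matrix.of_apply, Matrix.smul_apply,
    Matrix.vecMulVec_apply, Pi.star_apply, smul_eq_mul, div_eq_inv_mul]

lemma gainKernel_eq_ofReal_smul (hA : A.IsHermitian) (z : Fin L → ℂ) :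
    gainKernel A z = (((1 + quadForm A z)⁻¹ : ℝ) : ℂ) • Matrix.vecMulVec z (star z) := by
  rw [gainKernel, ← ofReal_quadForm hA]
  push_cast
  rfl

lemma one_add_quadForm_pos (hA : A.PosSemidef) (z : Fin L → ℂ) : 0 < 1 + quadForm A z :=
  add_pos_of_pos_of_nonneg one_pos (quadForm_nonneg hA z)

lemma continuous_gainKernel (hA : A.PosSemidef) : Continuous (gainKernel A) := by
  have hne : ∀ z, 1 + star z ⬝ᵥ (A *ᵥ z) ≠ 0 := fun z => by
    rw [← ofReal_quadForm hA.isHermitian]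
    exact_mod_cast (one_add_quadForm_pos hA z).ne'
  have hden : Continuous fun z => 1 + star z ⬝ᵥ (A *ᵥ z) := by
    simp only [dotProduct, Matrix.mulVec, Pi.star_apply]
    fun_prop
  exact (hden.inv₀ hne).smul (by fun_prop)

lemma one_add_mul_sqNorm_le_norm {M : Matrix (Fin L) (Fin L) ℂ} {δ : ℝ} {z : Fin L → ℂ}
    (h : δ * sqNorm z ≤ quadForm M z) : 1 + δ * sqNorm z ≤ ‖1 + star z ⬝ᵥ (M *ᵥ z)‖ :=
  calc 1 + δ * sqNorm z ≤ (1 + star z ⬝ᵥ (M *ᵥ z)).re := by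
        rw [Complex.add_re, Complex.one_re]; exact add_le_add_right h 1
    _ ≤ ‖1 + star z ⬝ᵥ (M *ᵥ z)‖ := Complex.re_le_norm _

lemma norm_gainKernel_le {M : Matrix (Fin L) (Fin L) ℂ} {δ : ℝ} {z : Fin L → ℂ} (hδ : 0 < δ)
    (h : δ * sqNorm z ≤ quadForm M z) : ‖gainKernel M z‖ ≤ δ⁻¹ := by
  have hz := sqNorm_nonneg z
  have hden := one_add_mul_sqNorm_le_norm h
  rw [gainKernel, norm_smul, norm_inv, inv_mul_le_iff₀ (lt_of_lt_of_le (by positivity) hden),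
    ← div_eq_mul_inv, le_div_iff₀' hδ]
  calc δ * ‖Matrix.vecMulVec z (star z)‖ ≤ δ * sqNorm z := by
        gcongr; exact norm_vecMulVec_star_le z
    _ ≤ ‖1 + star z ⬝ᵥ (M *ᵥ z)‖ := by linarith

lemma integrable_gainKernel [IsFiniteMeasure H] (hA : A.PosDef) (l l' : Fin L) :
    Integrable (fun z => gainKernel A z l l') H := by
  obtain ⟨δ, hδ, h⟩ := exists_le_quadForm hA
  exact Integrable.of_bound
    ((continuous_gainKernel hA.posSemidef).matrix_elem l l').aestronglyMeasurable δ⁻¹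
    (ae_of_all _ fun z => (norm_apply_le_l2_opNorm _ l l').trans
      (norm_gainKernel_le hδ (h z)))

lemma quadForm_gainKernel (hA : A.IsHermitian) (z x : Fin L → ℂ) :
    quadForm (gainKernel A z) x = ‖star z ⬝ᵥ x‖ ^ 2 / (1 + quadForm A z) := by
  rw [gainKernel_eq_ofReal_smul hA, quadForm_ofReal_smul, quadForm_vecMulVec_star, inv_mul_eq_div]

lemma quadForm_eq_sum (M : Matrix (Fin L) (Fin L) ℂ) (x : Fin L → ℂ) :
    quadForm M x = ∑ l, ∑ l', (star (x l) * M l l' * x l').re := by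
  simp only [quadForm, dotProduct, Matrix.mulVec, Pi.star_apply, Finset.mul_sum, Complex.re_sum,
    mul_assoc]

lemma integrable_quadForm_gainKernel [IsFiniteMeasure H] (hA : A.PosDef) (x : Fin L → ℂ) :
    Integrable (fun z => quadForm (gainKernel A z) x) H := by
  simp only [quadForm_eq_sum]
  exact integrable_finsetSum _ fun l _ => integrable_finsetSum _ fun l' _ =>
    (((integrable_gainKernel hA l l').const_mul _).mul_const _).re

lemma quadForm_expectedMatrix [IsFiniteMeasure H] (hA : A.PosDef) (x : Fin L → ℂ) :
    quadForm (expectedMatrix H A) x = ∫ z, quadForm (gainKernel A z) x ∂H := by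
  have hint : ∀ l l', Integrable (fun z => star (x l) * gainKernel A z l l' * x l') H :=
    fun l l' => ((integrable_gainKernel hA l l').const_mul _).mul_const _
  have hre : ∀ l l', Integrable (fun z => (star (x l) * gainKernel A z l l' * x l').re) H :=
    fun l l' => (hint l l').re
  simp only [quadForm_eq_sum, expectedMatrix_apply]
  rw [integral_finsetSum _ fun l _ => integrable_finsetSum _ fun l' _ => hre l l']
  refine Finset.sum_congr rfl fun l _ => ?_
  rw [integral_finsetSum _ fun l' _ => hre l l']
  refine Finset.sum_congr rfl fun l' _ => ?_
  rw [← integral_const_mul, ← integral_mul_const]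
  exact (integral_re (hint l l')).symm

lemma expectedMatrix_posSemidef [IsFiniteMeasure H] (hA : A.PosDef) :
    (expectedMatrix H A).PosSemidef := by
  refine posSemidef_of_quadForm ?_ fun x => ?_
  · ext l l'
    rw [Matrix.conjTranspose_apply, expectedMatrix_apply, expectedMatrix_apply, RCLike.star_def,
      ← integral_conj]
    refine integral_congr_ae (ae_of_all _ fun z => ?_)
    simp only [gainKernel_eq_ofReal_smul hA.isHermitian, Matrix.smul_apply,
      Matrix.vecMulVec_apply, Pi.star_apply, smul_eq_mul, map_mul, Complex.conj_ofReal,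
      RCLike.star_def, Complex.conj_conj, mul_comm (z l)]
  · simp only [quadForm_expectedMatrix hA, quadForm_gainKernel hA.isHermitian]
    exact integral_nonneg fun z => div_nonneg (by positivity)
      (one_add_quadForm_pos hA.posSemidef z).le

variable {c σ : ℝ}

lemma smul_expectedMatrix_posSemidef [IsFiniteMeasure H] (hc : 0 ≤ c) (hA : A.PosDef) :
    ((c : ℂ) • expectedMatrix H A).PosSemidef :=
  (expectedMatrix_posSemidef hA).smul (by exact_mod_cast hc)

lemma inv_mul_quadForm_expectedMatrix_le [IsFiniteMeasure H] (hA : A.PosDef) (hB : B.PosDef)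
    {t : ℝ} (ht : 1 ≤ t) (hBA : ∀ x, quadForm B x ≤ t * quadForm A x) (x : Fin L → ℂ) :
    t⁻¹ * quadForm (expectedMatrix H A) x ≤ quadForm (expectedMatrix H B) x := by
  rw [quadForm_expectedMatrix hA, quadForm_expectedMatrix hB, ← integral_const_mul]
  refine integral_mono ((integrable_quadForm_gainKernel hA x).const_mul _)
    (integrable_quadForm_gainKernel hB x) fun z => ?_
  have hdenB := one_add_quadForm_pos hB.posSemidef z
  simp only [quadForm_gainKernel hA.isHermitian, quadForm_gainKernel hB.isHermitian]
  rw [inv_mul_eq_div, div_div, mul_comm _ t]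
  exact div_le_div_of_nonneg_left (by positivity) hdenB (by linarith [hBA z])

/-- The equation turns `B ≤ t A` into `c E_B + σ² ≥ t⁻¹ (c E_A + σ²) + (1 - t⁻¹) σ²`; the last term
is a strict gain. -/
lemma exists_lt_forall_quadForm_le [IsFiniteMeasure H] (hc : 0 ≤ c) (hσ : 0 < σ)
    (hA : A.PosDef) (hB : B.PosDef) (hfA : FixedPoint c σ H A) (hfB : FixedPoint c σ H B)
    {t : ℝ} (ht : 1 < t) (hBA : ∀ x, quadForm B x ≤ t * quadForm A x) :
    ∃ u, 0 ≤ u ∧ u < t ∧ ∀ x, quadForm B x ≤ u * quadForm A x := by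
  have hF := posDef_add_sq_smul_one (smul_expectedMatrix_posSemidef (H := H) hc hA) hσ
  have hG := posDef_add_sq_smul_one (smul_expectedMatrix_posSemidef (H := H) hc hB) hσ
  set F := (c : ℂ) • expectedMatrix H A + ((σ : ℂ) ^ 2) • 1 with hF_def
  set G := (c : ℂ) • expectedMatrix H B + ((σ : ℂ) ^ 2) • 1 with hG_def
  have ht1 : 0 < t - 1 := sub_pos.2 ht
  set κ := (t - 1) * σ ^ 2 / (‖F‖ + 1) with hκ
  have hκ0 : 0 < κ := by positivity
  have hgain : ∀ x, κ * quadForm F x ≤ (t - 1) * (σ ^ 2 * sqNorm x) := fun x => by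
    have hx := sqNorm_nonneg x
    calc κ * quadForm F x ≤ κ * ((‖F‖ + 1) * sqNorm x) := by
          gcongr
          exact (quadForm_le F x).trans (by gcongr; linarith)
      _ = (t - 1) * (σ ^ 2 * sqNorm x) := by rw [hκ]; field_simp
  have hGF : ∀ x, (1 + κ) / t * quadForm F x ≤ quadForm G x := fun x => by
    have hE := mul_le_mul_of_nonneg_left
      (inv_mul_quadForm_expectedMatrix_le (H := H) hA hB ht.le hBA x) hc
    rw [inv_mul_eq_div, mul_div_assoc', div_le_iff₀ (by linarith)] at hE
    have hFx : quadForm F x = c * quadForm (expectedMatrix H A) x + σ ^ 2 * sqNorm x := by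
      rw [hF_def, quadForm_add_sq_smul_one, quadForm_ofReal_smul]
    have hGx : quadForm G x = c * quadForm (expectedMatrix H B) x + σ ^ 2 * sqNorm x := by
      rw [hG_def, quadForm_add_sq_smul_one, quadForm_ofReal_smul]
    rw [div_mul_eq_mul_div, div_le_iff₀ (by linarith), hGx]
    linarith [hgain x]
  refine ⟨t / (1 + κ), by positivity, div_lt_self (by linarith) (by linarith), fun x => ?_⟩
  have hinv := quadForm_inv_le hF hG (by positivity) hGF x
  rw [← show A = F⁻¹ from hfA, ← show B = G⁻¹ from hfB, div_mul_eq_mul_div,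
    div_le_iff₀ (by linarith)] at hinv
  rw [div_mul_eq_mul_div, le_div_iff₀ (by linarith)]
  linarith

lemma exists_isLeast_quadForm_le (hA : A.PosDef) (B : Matrix (Fin L) (Fin L) ℂ) :
    ∃ t, IsLeast {t : ℝ | 0 ≤ t ∧ ∀ x, quadForm B x ≤ t * quadForm A x} t := by
  obtain ⟨δ, hδ, hδA⟩ := exists_le_quadForm hA
  refine ⟨_, IsClosed.isLeast_csInf ?_ ⟨‖B‖ / δ, by positivity, fun x => ?_⟩ ⟨0, fun t ht => ht.1⟩⟩
  · simp only [Set.ofPred_and, Set.ofPred_forall]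
    exact isClosed_Ici.inter (isClosed_iInter fun x => isClosed_le continuous_const (by fun_prop))
  · calc quadForm B x ≤ ‖B‖ * sqNorm x := quadForm_le B x
      _ = ‖B‖ / δ * (δ * sqNorm x) := by field_simp
      _ ≤ ‖B‖ / δ * quadForm A x := by gcongr; exact hδA x

lemma quadForm_le_of_fixedPoint [IsFiniteMeasure H] (hc : 0 ≤ c) (hσ : 0 < σ) (hA : A.PosDef)
    (hB : B.PosDef) (hfA : FixedPoint c σ H A) (hfB : FixedPoint c σ H B) (x : Fin L → ℂ) :
    quadForm B x ≤ quadForm A x := by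
  obtain ⟨t, ⟨-, hBA⟩, hmin⟩ := exists_isLeast_quadForm_le hA B
  have ht : t ≤ 1 := by
    by_contra! h
    obtain ⟨u, hu0, hut, hBA'⟩ := exists_lt_forall_quadForm_le hc hσ hA hB hfA hfB h hBA
    exact (hmin ⟨hu0, hBA'⟩).not_gt hut
  exact (hBA x).trans (mul_le_of_le_one_left (quadForm_nonneg hA.posSemidef x) ht)

open scoped MatrixOrder in
lemma le_of_quadForm_le (hA : A.IsHermitian) (hB : B.IsHermitian)
    (h : ∀ x, quadForm B x ≤ quadForm A x) : B ≤ A := by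
  rw [Matrix.le_iff]
  refine posSemidef_of_quadForm (hA.sub hB) fun x => ?_
  rw [quadForm, Matrix.sub_mulVec, dotProduct_sub, Complex.sub_re]
  exact sub_nonneg.2 (h x)

open scoped MatrixOrder in
lemma eq_of_fixedPoint [IsFiniteMeasure H] (hc : 0 ≤ c) (hσ : 0 < σ) (hA : A.PosDef)
    (hB : B.PosDef) (hfA : FixedPoint c σ H A) (hfB : FixedPoint c σ H B) : B = A :=
  le_antisymm
    (le_of_quadForm_le hA.isHermitian hB.isHermitian
      (quadForm_le_of_fixedPoint hc hσ hA hB hfA hfB))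
    (le_of_quadForm_le hB.isHermitian hA.isHermitian
      (quadForm_le_of_fixedPoint hc hσ hB hA hfB hfA))

end FixedPointEquation

section DeterministicLimit

variable {E : Type*} [MeasurableSpace E]

lemma integral_empiricalMeasure [MeasurableSingletonClass E] {F : Type*} [NormedAddCommGroup F]
    [NormedSpace ℝ F] [CompleteSpace F] {n : ℕ} (x : Fin n → E) (f : E → F) :
    ∫ z, f z ∂(empiricalMeasure x) = (n : ℝ)⁻¹ • ∑ k, f (x k) := by
  have hint : ∀ k ∈ Finset.univ, Integrable f (Measure.dirac (x k)) := fun k _ =>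
    integrable_dirac (by simp)
  rw [empiricalMeasure, integral_smul_measure, integral_finsetSum_measure hint]
  simp only [integral_dirac, ENNReal.toReal_inv, ENNReal.toReal_natCast]

instance isFiniteMeasure_empiricalMeasure {n : ℕ} (x : Fin n → E) :
    IsFiniteMeasure (empiricalMeasure x) := by
  rcases n.eq_zero_or_pos with rfl | hn
  · rw [empiricalMeasure, Finset.univ_eq_empty, Finset.sum_empty, smul_zero]
    infer_instance
  · exact Measure.smul_finite _ (ENNReal.inv_ne_top.2 (by exact_mod_cast hn.ne'))

lemma WeaklyConverges.tendsto_integral [TopologicalSpace E] [OpensMeasurableSpace E]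
    {μ : ℕ → Measure E} {H : Measure E} (h : WeaklyConverges μ H) [∀ n, IsFiniteMeasure (μ n)]
    [IsFiniteMeasure H] (f : E →ᵇ ℂ) :
    Tendsto (fun n => ∫ z, f z ∂(μ n)) atTop (𝓝 (∫ z, f z ∂H)) := by
  have hint : ∀ (ρ : Measure E) [IsFiniteMeasure ρ], ∫ z, f z ∂ρ
      = ((∫ z, (f z).re ∂ρ : ℝ) : ℂ) + ((∫ z, (f z).im ∂ρ : ℝ) : ℂ) * Complex.I :=
    fun ρ _ => (integral_re_add_im (f.integrable ρ)).symm
  have hre := h (BoundedContinuousFunction.ofNormedAddCommGroup (fun z => (f z).re)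
    (Complex.continuous_re.comp f.continuous) ‖f‖
    fun z => (Complex.abs_re_le_norm _).trans (f.norm_coe_le_norm z))
  have him := h (BoundedContinuousFunction.ofNormedAddCommGroup (fun z => (f z).im)
    (Complex.continuous_im.comp f.continuous) ‖f‖
    fun z => (Complex.abs_im_le_norm _).trans (f.norm_coe_le_norm z))
  rw [hint H]
  simp only [hint (μ _)]
  exact ((Complex.continuous_ofReal.tendsto _).comp hre).add
    (((Complex.continuous_ofReal.tendsto _).comp him).mul_const _)

variable {K : ℕ → ℕ} {c : ℝ}

lemma tendsto_inv_mul_sum [TopologicalSpace E] [OpensMeasurableSpace E]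
    [MeasurableSingletonClass E] {H : Measure E} [IsFiniteMeasure H]
    (hK : Tendsto (fun N : ℕ => (K N : ℝ) / (N : ℝ)) atTop (𝓝 c))
    {a : (N : ℕ) → Fin (K N) → E} (hw : WeaklyConverges (fun N => empiricalMeasure (a N)) H)
    (f : E →ᵇ ℂ) :
    Tendsto (fun N : ℕ => (N : ℂ)⁻¹ * ∑ k, f (a N k)) atTop (𝓝 (c * ∫ z, f z ∂H)) := by
  refine (((Complex.continuous_ofReal.tendsto c).comp hK).mul
    (hw.tendsto_integral f)).congr fun N => ?_
  rw [integral_empiricalMeasure, Function.comp_apply, Complex.real_smul]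
  push_cast
  rcases (K N).eq_zero_or_pos with h0 | h0
  · have : IsEmpty (Fin (K N)) := by rw [h0]; infer_instance
    simp [h0]
  · have : (K N : ℂ) ≠ 0 := by exact_mod_cast h0.ne'
    field_simp

lemma tendsto_inv_smul_sum_zero {E : Type*} [NormedAddCommGroup E] [NormedSpace ℂ E]
    (hK : Tendsto (fun N : ℕ => (K N : ℝ) / (N : ℝ)) atTop (𝓝 c)) {f : Filter ℕ} (hf : f ≤ atTop)
    {x : (N : ℕ) → Fin (K N) → E} (hx : ∀ ε > 0, ∀ᶠ N in f, ∀ k, ‖x N k‖ ≤ ε) :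
    Tendsto (fun N : ℕ => (N : ℂ)⁻¹ • ∑ k, x N k) f (𝓝 0) := by
  have hc : 0 ≤ c := ge_of_tendsto' hK fun N => by positivity
  rw [Metric.tendsto_nhds]
  intro ε hε
  filter_upwards [hx (ε / (2 * (c + 1))) (by positivity),
    hf (hK.eventually_lt_const (lt_add_one c))] with N hxN hKN
  rw [dist_zero_right, norm_smul, norm_inv, Complex.norm_natCast]
  calc (N : ℝ)⁻¹ * ‖∑ k, x N k‖ ≤ (N : ℝ)⁻¹ * ∑ _ : Fin (K N), ε / (2 * (c + 1)) := by
        gcongr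
        exact norm_sum_le_of_le _ fun k _ => hxN k
    _ = (K N / N : ℝ) * (ε / (2 * (c + 1))) := by
        rw [Finset.sum_const, Finset.card_univ, Fintype.card_fin, nsmul_eq_mul]; ring
    _ ≤ (c + 1) * (ε / (2 * (c + 1))) := by gcongr
    _ = ε / 2 := by field_simp
    _ < ε := half_lt_self hε

variable {L : ℕ} {H : Measure (Fin L → ℂ)}

lemma continuous_sqNorm {ι : Type*} [Fintype ι] : Continuous (sqNorm : (ι → ℂ) → ℝ) := by
  unfold sqNorm; fun_prop

/-- `min 1 (|z|² / (m + 1))`, a bounded continuous majorant of the indicator of `|z|² > m + 1`. -/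
noncomputable def truncSqNorm (L m : ℕ) : (Fin L → ℂ) →ᵇ ℝ :=
  BoundedContinuousFunction.ofNormedAddCommGroup (fun z => min 1 (sqNorm z / (m + 1)))
    (continuous_const.min (continuous_sqNorm.div_const _)) 1 fun z => by
      rw [Real.norm_of_nonneg (le_min zero_le_one (div_nonneg (sqNorm_nonneg z) (by positivity)))]
      exact min_le_left _ _

lemma truncSqNorm_nonneg (m : ℕ) (z : Fin L → ℂ) : 0 ≤ truncSqNorm L m z :=
  le_min zero_le_one (div_nonneg (sqNorm_nonneg z) (by positivity))

lemma one_le_truncSqNorm {m : ℕ} {z : Fin L → ℂ} (hz : (m : ℝ) + 1 < sqNorm z) :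
    1 ≤ truncSqNorm L m z :=
  le_min le_rfl ((one_le_div (by positivity)).2 hz.le)

lemma tendsto_integral_truncSqNorm [IsFiniteMeasure H] :
    Tendsto (fun m => ∫ z, truncSqNorm L m z ∂H) atTop (𝓝 0) := by
  rw [← integral_zero (Fin L → ℂ) ℝ]
  refine tendsto_integral_of_dominated_convergence (fun _ => 1)
    (fun m => (truncSqNorm L m).continuous.aestronglyMeasurable) (integrable_const _)
    (fun m => ae_of_all _ fun z => ?_) (ae_of_all _ fun z => ?_)
  · rw [Real.norm_of_nonneg (truncSqNorm_nonneg m z)]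
    exact min_le_left _ _
  · have hdiv : Tendsto (fun m : ℕ => sqNorm z / ((m : ℝ) + 1)) atTop (𝓝 0) :=
      tendsto_const_nhds.div_atTop (tendsto_natCast_atTop_atTop.atTop_add tendsto_const_nhds)
    have hmin := (tendsto_const_nhds (x := (1 : ℝ))).min hdiv
    rwa [min_eq_right zero_le_one] at hmin

lemma card_le_sum_truncSqNorm {n : ℕ} (a : Fin n → Fin L → ℂ) (m : ℕ) :
    ((Finset.univ.filter fun k => (m : ℝ) + 1 < sqNorm (a k)).card : ℝ)
      ≤ ∑ k, truncSqNorm L m (a k) := by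
  rw [Finset.card_eq_sum_ones, Nat.cast_sum, Nat.cast_one]
  exact (Finset.sum_le_sum fun k hk => one_le_truncSqNorm (Finset.mem_filter.1 hk).2).trans
    (Finset.sum_le_sum_of_subset_of_nonneg (Finset.filter_subset _ _)
      fun k _ _ => truncSqNorm_nonneg m _)

/-- Tightness of the limit law: at most `N / 2` of the gain vectors are large. -/
lemma exists_eventually_card_le [IsFiniteMeasure H]
    (hK : Tendsto (fun N : ℕ => (K N : ℝ) / (N : ℝ)) atTop (𝓝 c))
    {a : (N : ℕ) → Fin (K N) → Fin L → ℂ}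
    (hw : WeaklyConverges (fun N => empiricalMeasure (a N)) H) :
    ∃ m : ℝ, 0 ≤ m ∧ ∀ᶠ N : ℕ in atTop,
      2 * (Finset.univ.filter fun k => m < sqNorm (a N k)).card ≤ N := by
  have hc : 0 ≤ c := ge_of_tendsto' hK fun N => by positivity
  obtain ⟨m, hm⟩ := (tendsto_integral_truncSqNorm (H := H).eventually_lt_const
    (show (0 : ℝ) < (2 * (c + 1))⁻¹ by positivity)).exists
  refine ⟨m + 1, by positivity, ?_⟩
  filter_upwards [(hw (truncSqNorm L m)).eventually_lt_const hm,
    hK.eventually_lt_const (lt_add_one c), eventually_gt_atTop 0] with N hmean hKN hN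
  have hN' : (0 : ℝ) < N := by exact_mod_cast hN
  rw [integral_empiricalMeasure, smul_eq_mul] at hmean
  rw [div_lt_iff₀ hN'] at hKN
  have hsum : ∑ k, truncSqNorm L m (a N k) ≤ K N * (2 * (c + 1))⁻¹ := by
    rcases (K N).eq_zero_or_pos with h0 | h0
    · have : IsEmpty (Fin (K N)) := by rw [h0]; infer_instance
      simp [h0]
    · exact ((inv_mul_lt_iff₀ (by exact_mod_cast h0)).1 hmean).le
  have hcard : (2 * (Finset.univ.filter fun k => (m : ℝ) + 1 < sqNorm (a N k)).card : ℝ) ≤ N :=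
    calc (2 * (Finset.univ.filter fun k => (m : ℝ) + 1 < sqNorm (a N k)).card : ℝ)
        ≤ 2 * ((c + 1) * N * (2 * (c + 1))⁻¹) := by
          gcongr
          exact (card_le_sum_truncSqNorm (a N) m).trans (hsum.trans (by gcongr))
      _ = N := by field_simp
  exact_mod_cast hcard

variable {σ : ℝ} {a : (N : ℕ) → Fin (K N) → Fin L → ℂ} {s : (N : ℕ) → Fin N → Fin (K N) → ℂ}

lemma exists_eventually_le_quadForm_traceMatrix [IsFiniteMeasure H] (hσ : 0 < σ)
    (hK : Tendsto (fun N : ℕ => (K N : ℝ) / (N : ℝ)) atTop (𝓝 c))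
    (hw : WeaklyConverges (fun N => empiricalMeasure (a N)) H) {B : ℝ} (hB : 0 ≤ B)
    (hs : ∀ᶠ N : ℕ in atTop, ∀ k, sqNorm (fun i => s N i k) ≤ B * N) :
    ∃ δ > 0, ∀ᶠ N : ℕ in atTop, ∀ x, δ * sqNorm x ≤ quadForm (traceMatrix σ (a N) (s N)) x := by
  have hc : 0 ≤ c := ge_of_tendsto' hK fun N => by positivity
  obtain ⟨m, hm, hcard⟩ := exists_eventually_card_le hK hw
  refine ⟨(2 * (σ ^ 2 + 2 * (m * B * (c + 1))))⁻¹, by positivity, ?_⟩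
  filter_upwards [hcard, hs, eventually_gt_atTop 0, hK.eventually_lt_const (lt_add_one c)]
    with N hcardN hsN hN hKN x
  have hp : m * B * K N ≤ m * B * (c + 1) * N := by
    rw [mul_assoc (m * B)]
    gcongr
    exact ((div_lt_iff₀ (by exact_mod_cast hN)).1 hKN).le
  rw [inv_mul_eq_div]
  exact sqNorm_div_le_quadForm_traceMatrix hσ hB hm hN hp (a N) (s N) hsN hcardN x

open scoped Matrix.Norms.L2Operator

variable {A M : Matrix (Fin L) (Fin L) ℂ}

lemma gainKernel_sub {z : Fin L → ℂ} (hM : 1 + star z ⬝ᵥ (M *ᵥ z) ≠ 0)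
    (hA : 1 + star z ⬝ᵥ (A *ᵥ z) ≠ 0) :
    gainKernel M z - gainKernel A z = gainKernel M z * (A - M) * gainKernel A z := by
  have hrank : Matrix.vecMulVec z (star z) * (A - M) * Matrix.vecMulVec z (star z)
      = ((1 + star z ⬝ᵥ (A *ᵥ z)) - (1 + star z ⬝ᵥ (M *ᵥ z))) • Matrix.vecMulVec z (star z) := by
    rw [Matrix.vecMulVec_mul, Matrix.vecMulVec_mul_vecMulVec, ← Matrix.dotProduct_mulVec,
      Matrix.vecMulVec_smul, Matrix.sub_mulVec, dotProduct_sub, add_sub_add_left_eq_sub]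
  simp only [gainKernel, Matrix.smul_mul, Matrix.mul_smul, hrank, smul_smul]
  rw [← sub_smul, inv_sub_inv hM hA]
  congr 1
  field_simp

lemma norm_gainKernel_sub_le {δ : ℝ} {z : Fin L → ℂ} (hδ : 0 < δ)
    (hM : δ * sqNorm z ≤ quadForm M z) (hA : δ * sqNorm z ≤ quadForm A z) :
    ‖gainKernel M z - gainKernel A z‖ ≤ δ⁻¹ ^ 2 * ‖M - A‖ := by
  have hne : ∀ {B : Matrix (Fin L) (Fin L) ℂ}, δ * sqNorm z ≤ quadForm B z →
      1 + star z ⬝ᵥ (B *ᵥ z) ≠ 0 := fun h => norm_pos_iff.1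
    (lt_of_lt_of_le (by have := sqNorm_nonneg z; positivity) (one_add_mul_sqNorm_le_norm h))
  rw [gainKernel_sub (hne hM) (hne hA), norm_sub_rev M A]
  calc ‖gainKernel M z * (A - M) * gainKernel A z‖
      ≤ ‖gainKernel M z‖ * ‖A - M‖ * ‖gainKernel A z‖ :=
        (norm_mul_le _ _).trans (by gcongr; exact norm_mul_le _ _)
    _ ≤ δ⁻¹ * ‖A - M‖ * δ⁻¹ := by
        gcongr
        exacts [norm_gainKernel_le hδ hM, norm_gainKernel_le hδ hA]
    _ = δ⁻¹ ^ 2 * ‖A - M‖ := by ring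

lemma sub_mul_sqNorm_le_quadForm {δ : ℝ} {z : Fin L → ℂ} (hA : δ * sqNorm z ≤ quadForm A z) :
    (δ - ‖M - A‖) * sqNorm z ≤ quadForm M z := by
  have hdiff := quadForm_le (A - M) z
  rw [quadForm, Matrix.sub_mulVec, dotProduct_sub, Complex.sub_re, norm_sub_rev] at hdiff
  change quadForm A z - quadForm M z ≤ _ at hdiff
  linarith

lemma norm_mul_gainKernel_sub_le {δ : ℝ} {z : Fin L → ℂ} (hδ : 0 < δ)
    (hA : δ * sqNorm z ≤ quadForm A z) (hM : ‖M - A‖ ≤ δ / 2) :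
    ‖M * gainKernel M z - A * gainKernel A z‖
      ≤ ((δ / 2)⁻¹ + ‖A‖ * (δ / 2)⁻¹ ^ 2) * ‖M - A‖ := by
  have hz := sqNorm_nonneg z
  have hA' : δ / 2 * sqNorm z ≤ quadForm A z := le_trans (by gcongr; linarith) hA
  have hM' : δ / 2 * sqNorm z ≤ quadForm M z :=
    le_trans (by gcongr; linarith) (sub_mul_sqNorm_le_quadForm hA)
  calc ‖M * gainKernel M z - A * gainKernel A z‖
      = ‖(M - A) * gainKernel M z + A * (gainKernel M z - gainKernel A z)‖ := by
        congr 1; noncomm_ring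
    _ ≤ ‖M - A‖ * ‖gainKernel M z‖ + ‖A‖ * ‖gainKernel M z - gainKernel A z‖ :=
        norm_add_le_of_le (norm_mul_le _ _) (norm_mul_le _ _)
    _ ≤ ‖M - A‖ * (δ / 2)⁻¹ + ‖A‖ * ((δ / 2)⁻¹ ^ 2 * ‖M - A‖) := by
        gcongr
        exacts [norm_gainKernel_le (half_pos hδ) hM',
          norm_gainKernel_sub_le (half_pos hδ) hM' hA']
    _ = ((δ / 2)⁻¹ + ‖A‖ * (δ / 2)⁻¹ ^ 2) * ‖M - A‖ := by ring

lemma tendsto_inv_smul_sum_gainKernel [IsFiniteMeasure H] (hA : A.PosDef)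
    (hK : Tendsto (fun N : ℕ => (K N : ℝ) / (N : ℝ)) atTop (𝓝 c))
    (hw : WeaklyConverges (fun N => empiricalMeasure (a N)) H) :
    Tendsto (fun N : ℕ => (N : ℂ)⁻¹ • ∑ k, gainKernel A (a N k)) atTop
      (𝓝 ((c : ℂ) • expectedMatrix H A)) := by
  obtain ⟨δ, hδ, hδA⟩ := exists_le_quadForm hA
  refine tendsto_pi_nhds.2 fun l => tendsto_pi_nhds.2 fun l' => ?_
  have h := tendsto_inv_mul_sum hK hw (BoundedContinuousFunction.ofNormedAddCommGroup
    (fun z => gainKernel A z l l') ((continuous_gainKernel hA.posSemidef).matrix_elem l l') δ⁻¹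
    fun z => (norm_apply_le_l2_opNorm _ l l').trans (norm_gainKernel_le hδ (hδA z)))
  simpa only [Matrix.smul_apply, Matrix.sum_apply, smul_eq_mul, expectedMatrix_apply,
    BoundedContinuousFunction.coe_ofNormedAddCommGroup] using h

lemma tendsto_inv_smul_sum_mul_gainKernel [IsFiniteMeasure H] (hA : A.PosDef)
    (hK : Tendsto (fun N : ℕ => (K N : ℝ) / (N : ℝ)) atTop (𝓝 c))
    (hw : WeaklyConverges (fun N => empiricalMeasure (a N)) H) {f : Filter ℕ} (hf : f ≤ atTop)
    {M : (N : ℕ) → Fin (K N) → Matrix (Fin L) (Fin L) ℂ}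
    (hM : ∀ ε > 0, ∀ᶠ N in f, ∀ k, ‖M N k - A‖ ≤ ε) :
    Tendsto (fun N : ℕ => (N : ℂ)⁻¹ • ∑ k, M N k * gainKernel (M N k) (a N k)) f
      (𝓝 (A * (c : ℂ) • expectedMatrix H A)) := by
  obtain ⟨δ, hδ, hδA⟩ := exists_le_quadForm hA
  have hdiff := tendsto_inv_smul_sum_zero hK hf
    (x := fun N k => M N k * gainKernel (M N k) (a N k) - A * gainKernel A (a N k)) fun ε hε => by
      set C := (δ / 2)⁻¹ + ‖A‖ * (δ / 2)⁻¹ ^ 2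
      have hC : 0 < C := by positivity
      filter_upwards [hM (δ / 2) (half_pos hδ), hM (ε / C) (by positivity)] with N hN hNε k
      calc _ ≤ C * ‖M N k - A‖ := norm_mul_gainKernel_sub_le hδ (hδA _) (hN k)
        _ ≤ C * (ε / C) := by gcongr; exact hNε k
        _ = ε := by field_simp
  have hmain := ((tendsto_inv_smul_sum_gainKernel hA hK hw).mono_left hf).const_mul A
  rw [← zero_add (A * _)]
  refine (hdiff.add hmain).congr fun N => ?_
  rw [Finset.sum_sub_distrib, smul_sub, ← Finset.mul_sum, Matrix.mul_smul, sub_add_cancel]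

lemma tendsto_quadForm {ι : Type*} {f : Filter ι} {M : ι → Matrix (Fin L) (Fin L) ℂ}
    (hM : Tendsto M f (𝓝 A)) (x : Fin L → ℂ) :
    Tendsto (fun n => quadForm (M n) x) f (𝓝 (quadForm A x)) := by
  have hcont : Continuous fun M : Matrix (Fin L) (Fin L) ℂ => quadForm M x :=
    Complex.continuous_re.comp
      (continuous_const.dotProduct (continuous_id.matrix_mulVec continuous_const))
  exact (hcont.tendsto A).comp hM

lemma traceMatrix_isHermitian (hσ : 0 < σ) {N K : ℕ} (a : Fin K → Fin L → ℂ)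
    (s : Fin N → Fin K → ℂ) : (traceMatrix σ a s).IsHermitian :=
  blockTrace_isHermitian (regInv_posDef (totalMatrix_posSemidef a s) hσ).isHermitian

lemma posDef_of_tendsto_traceMatrix [IsFiniteMeasure H] (hσ : 0 < σ)
    (hK : Tendsto (fun N : ℕ => (K N : ℝ) / (N : ℝ)) atTop (𝓝 c))
    (hw : WeaklyConverges (fun N => empiricalMeasure (a N)) H) {B : ℝ} (hB : 0 ≤ B)
    (hs : ∀ᶠ N : ℕ in atTop, ∀ k, sqNorm (fun i => s N i k) ≤ B * N)
    {f : Filter ℕ} [f.NeBot] (hf : f ≤ atTop)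
    (hA : Tendsto (fun N => traceMatrix σ (a N) (s N)) f (𝓝 A)) : A.PosDef := by
  obtain ⟨δ, hδ, hlow⟩ := exists_eventually_le_quadForm_traceMatrix hσ hK hw hB hs
  have hδA : ∀ x, δ * sqNorm x ≤ quadForm A x := fun x =>
    ge_of_tendsto (tendsto_quadForm hA x) (hf (hlow.mono fun N h => h x))
  have hherm : A.IsHermitian :=
    tendsto_nhds_unique (((continuous_star.tendsto A).comp hA).congr fun N =>
      traceMatrix_isHermitian hσ (a N) (s N)) hA
  exact posDef_of_quadForm hherm fun x hx => (mul_pos hδ (sqNorm_pos hx)).trans_le (hδA x)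

lemma eventually_norm_userMatrix_sub_le
    (hclose : ∀ ε > 0, ∀ᶠ N : ℕ in atTop, ∀ k,
      ‖userMatrix σ (a N) (s N) k - traceMatrix σ (a N) (s N)‖ ≤ ε)
    {f : Filter ℕ} (hf : f ≤ atTop) (hA : Tendsto (fun N => traceMatrix σ (a N) (s N)) f (𝓝 A))
    {ε : ℝ} (hε : 0 < ε) : ∀ᶠ N in f, ∀ k, ‖userMatrix σ (a N) (s N) k - A‖ ≤ ε := by
  filter_upwards [hf (hclose (ε / 2) (half_pos hε)), Metric.tendsto_nhds.1 hA _ (half_pos hε)]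
    with N huser htrace k
  rw [dist_eq_norm] at htrace
  calc ‖userMatrix σ (a N) (s N) k - A‖
      ≤ ‖userMatrix σ (a N) (s N) k - traceMatrix σ (a N) (s N)‖
        + ‖traceMatrix σ (a N) (s N) - A‖ := norm_sub_le_norm_sub_add_norm_sub _ _ _
    _ ≤ ε / 2 + ε / 2 := add_le_add (huser k) htrace.le
    _ = ε := add_halves ε

lemma fixedPoint_of_tendsto_traceMatrix [IsFiniteMeasure H] (hσ : 0 < σ)
    (hK : Tendsto (fun N : ℕ => (K N : ℝ) / (N : ℝ)) atTop (𝓝 c))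
    (hw : WeaklyConverges (fun N => empiricalMeasure (a N)) H)
    (hclose : ∀ ε > 0, ∀ᶠ N : ℕ in atTop, ∀ k,
      ‖userMatrix σ (a N) (s N) k - traceMatrix σ (a N) (s N)‖ ≤ ε)
    {f : Filter ℕ} [f.NeBot] (hf : f ≤ atTop) (hA : A.PosDef)
    (hlim : Tendsto (fun N => traceMatrix σ (a N) (s N)) f (𝓝 A)) : FixedPoint c σ H A := by
  have hsum := tendsto_inv_smul_sum_mul_gainKernel hA hK hw hf
    fun ε hε => eventually_norm_userMatrix_sub_le hclose hf hlim hε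
  have heq : (σ : ℂ) ^ 2 • A + A * (c : ℂ) • expectedMatrix H A = 1 :=
    tendsto_nhds_unique ((hlim.const_smul _).add hsum) (tendsto_const_nhds.congr'
      (hf ((eventually_gt_atTop 0).mono fun N hN =>
        (traceMatrix_add_sum_userMatrix_mul_gainKernel hσ hN (a N) (s N)).symm)))
  refine (Matrix.inv_eq_left_inv ?_).symm
  rw [mul_add, Matrix.mul_smul A (σ ^ 2 : ℂ), mul_one, add_comm, heq]

/-- By compactness and uniqueness of the fixed point it suffices to identify the limits along
ultrafilters. -/
theorem exists_tendsto_traceMatrix [IsFiniteMeasure H] (hσ : 0 < σ)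
    (hK : Tendsto (fun N : ℕ => (K N : ℝ) / (N : ℝ)) atTop (𝓝 c))
    (hw : WeaklyConverges (fun N => empiricalMeasure (a N)) H) {B : ℝ} (hB : 0 ≤ B)
    (hs : ∀ᶠ N : ℕ in atTop, ∀ k, sqNorm (fun i => s N i k) ≤ B * N)
    (hclose : ∀ ε > 0, ∀ᶠ N : ℕ in atTop, ∀ k,
      ‖userMatrix σ (a N) (s N) k - traceMatrix σ (a N) (s N)‖ ≤ ε) :
    ∃ A : Matrix (Fin L) (Fin L) ℂ, A.PosDef ∧ FixedPoint c σ H A ∧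
      Tendsto (fun N => traceMatrix σ (a N) (s N)) atTop (𝓝 A) := by
  have hc : 0 ≤ c := ge_of_tendsto' hK fun N => by positivity
  let S : Set (Matrix (Fin L) (Fin L) ℂ) :=
    Set.univ.pi fun _ => Set.univ.pi fun _ => Metric.closedBall 0 (σ ^ 2)⁻¹
  have hS : IsCompact S := isCompact_univ_pi fun _ => isCompact_univ_pi fun _ =>
    isCompact_closedBall _ _
  have hmem : ∀ N, traceMatrix σ (a N) (s N) ∈ S := fun N => Set.mem_univ_pi.2 fun l =>
    Set.mem_univ_pi.2 fun l' => mem_closedBall_zero_iff.2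
      (norm_traceMatrix_apply_le hσ (a N) (s N) l l')
  have hultra : ∀ f : Ultrafilter ℕ, (f : Filter ℕ) ≤ atTop → ∃ A : Matrix (Fin L) (Fin L) ℂ,
      A.PosDef ∧ FixedPoint c σ H A ∧ Tendsto (fun N => traceMatrix σ (a N) (s N)) f (𝓝 A) := by
    intro f hf
    obtain ⟨A, -, hA⟩ := hS.ultrafilter_le_nhds (f.map fun N => traceMatrix σ (a N) (s N))
      (le_principal_iff.2 (mem_map.2 (univ_mem' hmem)))
    have hPD := posDef_of_tendsto_traceMatrix hσ hK hw hB hs hf hA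
    exact ⟨A, hPD, fixedPoint_of_tendsto_traceMatrix hσ hK hw hclose hf hPD hA, hA⟩
  obtain ⟨A, hA, hfA, -⟩ := hultra (Ultrafilter.of atTop) (Ultrafilter.of_le _)
  refine ⟨A, hA, hfA, tendsto_iff_ultrafilter _ _ _ |>.2 fun f hf => ?_⟩
  obtain ⟨A', hA', hfA', hlim⟩ := hultra f hf
  rwa [eq_of_fixedPoint hc hσ hA hA' hfA hfA'] at hlim

end DeterministicLimit

section Independence

variable {Ω α β : Type*} [MeasurableSpace Ω] [MeasurableSpace α] [MeasurableSpace β]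
  {P : Measure Ω} {X : Ω → α} {Y : Ω → β}

lemma lintegral_of_indepFun [IsFiniteMeasure P] (hX : Measurable X) (hY : Measurable Y)
    (h : IndepFun X Y P) {F : α × β → ℝ≥0∞} (hF : Measurable F) :
    ∫⁻ ω, F (X ω, Y ω) ∂P = ∫⁻ ω', ∫⁻ ω, F (X ω, Y ω') ∂P ∂P := by
  rw [← lintegral_map hF (hX.prodMk hY),
    h.map_prod_eq_prod_map_map hX.aemeasurable hY.aemeasurable, lintegral_prod_symm' _ hF,
    lintegral_map hF.lintegral_prod_left' hY]
  exact lintegral_congr fun ω' => lintegral_map (hF.comp (measurable_id.prodMk measurable_const)) hX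

lemma lintegral_le_of_indepFun [IsProbabilityMeasure P] (hX : Measurable X) (hY : Measurable Y)
    (h : IndepFun X Y P) {F : α × β → ℝ≥0∞} (hF : Measurable F) {C : ℝ≥0∞}
    (hC : ∀ ω', ∫⁻ ω, F (X ω, Y ω') ∂P ≤ C) : ∫⁻ ω, F (X ω, Y ω) ∂P ≤ C := by
  rw [lintegral_of_indepFun hX hY h hF]
  exact (lintegral_mono hC).trans (by simp)

lemma measure_le_of_indepFun [IsProbabilityMeasure P] (hX : Measurable X) (hY : Measurable Y)
    (h : IndepFun X Y P) {S : Set (α × β)} (hS : MeasurableSet S) {C : ℝ≥0∞}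
    (hC : ∀ ω', P {ω | (X ω, Y ω') ∈ S} ≤ C) : P {ω | (X ω, Y ω) ∈ S} ≤ C := by
  have hlintegral : ∀ {f : Ω → α × β}, Measurable f →
      ∫⁻ ω, S.indicator (1 : α × β → ℝ≥0∞) (f ω) ∂P = P {ω | f ω ∈ S} := fun {f} hf =>
    lintegral_indicator_one (hf hS)
  rw [← hlintegral (hX.prodMk hY)]
  refine lintegral_le_of_indepFun hX hY h (measurable_one.indicator hS) fun ω' => ?_
  rw [hlintegral (hX.prodMk measurable_const)]
  exact hC ω'

end Independence

section SubGaussian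

open scoped NNReal

variable {Ω : Type*} [MeasurableSpace Ω] {P : Measure Ω} {X : Ω → ℝ} {c : ℝ≥0}

lemma hasSubgaussianMGF_of_lintegral_le (hX : Measurable X)
    (h : ∀ t, ∫⁻ ω, ENNReal.ofReal (Real.exp (t * X ω)) ∂P
      ≤ ENNReal.ofReal (Real.exp (c * t ^ 2 / 2))) :
    HasSubgaussianMGF X c P := by
  have hmeas (t : ℝ) : AEStronglyMeasurable (fun ω => Real.exp (t * X ω)) P := by fun_prop
  have hpos (t : ℝ) : 0 ≤ᵐ[P] fun ω => Real.exp (t * X ω) :=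
    ae_of_all _ fun ω => (Real.exp_pos _).le
  refine ⟨fun t => ⟨hmeas t, ?_⟩, fun t => ?_⟩
  · rw [hasFiniteIntegral_iff_ofReal (hpos t)]
    exact (h t).trans_lt ENNReal.ofReal_lt_top
  · rw [mgf, integral_eq_lintegral_of_nonneg_ae (hpos t) (hmeas t)]
    exact ENNReal.toReal_le_of_le_ofReal (Real.exp_pos _).le (h t)

lemma lintegral_exp_le (h : HasSubgaussianMGF X c P) (t : ℝ) :
    ∫⁻ ω, ENNReal.ofReal (Real.exp (t * X ω)) ∂P
      ≤ ENNReal.ofReal (Real.exp (c * t ^ 2 / 2)) := by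
  rw [← ofReal_integral_eq_lintegral_ofReal (h.integrable_exp_mul t)
    (ae_of_all _ fun ω => (Real.exp_pos _).le)]
  exact ENNReal.ofReal_le_ofReal (h.mgf_le t)

lemma hasSubgaussianMGF_of_indepFun [IsProbabilityMeasure P] {α β : Type*} [MeasurableSpace α]
    [MeasurableSpace β] {Y : Ω → α} {Z : Ω → β} (hY : Measurable Y) (hZ : Measurable Z)
    (h : IndepFun Y Z P) {F : α × β → ℝ} (hF : Measurable F)
    (hsub : ∀ ω', HasSubgaussianMGF (fun ω => F (Y ω, Z ω')) c P) :
    HasSubgaussianMGF (fun ω => F (Y ω, Z ω)) c P :=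
  hasSubgaussianMGF_of_lintegral_le (hF.comp (hY.prodMk hZ)) fun t =>
    lintegral_le_of_indepFun (F := fun p => ENNReal.ofReal (Real.exp (t * F p))) hY hZ h
      (by fun_prop) fun ω' => lintegral_exp_le (hsub ω') t

lemma hasSubgaussianMGF_mono {c' : ℝ≥0} (h : HasSubgaussianMGF X c P) (hc : c ≤ c') :
    HasSubgaussianMGF X c' P :=
  ⟨h.integrable_exp_mul, fun t => (h.mgf_le t).trans (by gcongr)⟩

lemma hasSubgaussianMGF_sum_mul [IsProbabilityMeasure P] {κ : Type*} {Z : κ → Ω → ℝ}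
    (h : ∀ k, HasSubgaussianMGF (Z k) c P) (w : κ → ℝ≥0) (s : Finset κ) :
    HasSubgaussianMGF (fun ω => ∑ k ∈ s, w k * Z k ω) ((∑ k ∈ s, w k) ^ 2 * c) P := by
  classical
  induction s using Finset.induction_on with
  | empty => simp
  | insert k s hk ih =>
    simp only [Finset.sum_insert hk]
    have hmul : HasSubgaussianMGF (fun ω => w k * Z k ω) (w k ^ 2 * c) P := (h k).const_mul (w k)
    convert hmul.add ih using 1
    rw [NNReal.sqrt_mul, NNReal.sqrt_mul, NNReal.sqrt_sq, NNReal.sqrt_sq, ← add_mul, mul_pow,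
      NNReal.sq_sqrt]

lemma hasSubgaussianMGF_of_abs_le [IsProbabilityMeasure P] {b : ℝ≥0} (hX : Measurable X)
    (hb : ∀ ω, |X ω| ≤ b) (hmean : ∫ ω, X ω ∂P = 0) : HasSubgaussianMGF X (b ^ 2) P := by
  convert hasSubgaussianMGF_of_mem_Icc_of_integral_eq_zero (μ := P) (a := -b) (b := b)
    hX.aemeasurable (ae_of_all _ fun ω => abs_le.1 (hb ω)) hmean using 2
  ext
  rw [NNReal.coe_div, coe_nnnorm, Real.norm_of_nonneg (by simp), NNReal.coe_ofNat]
  ring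

end SubGaussian

section Decoupling

variable {ι : Type*} [Fintype ι] [DecidableEq ι]

lemma four_mul_card_filter_mem_notMem {i j : ι} (hij : i ≠ j) :
    4 * (Finset.univ.filter fun I : Finset ι => i ∈ I ∧ j ∉ I).card = 2 ^ Fintype.card ι := by
  have hIcc : (Finset.univ.filter fun I : Finset ι => i ∈ I ∧ j ∉ I)
      = Finset.Icc {i} (Finset.univ.erase j) := by
    ext I
    simp [Finset.subset_erase]
  rw [hIcc, Finset.card_Icc_finset (by simpa using hij), Finset.card_erase_of_mem (by simp),
    Finset.card_univ, Finset.card_singleton]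
  obtain ⟨n, hn⟩ := Nat.exists_eq_add_of_lt (Fintype.one_lt_card_iff.2 ⟨i, j, hij⟩)
  rw [hn, show 1 + n + 1 - 1 - 1 = n by lia]
  ring

/- A uniformly random subset `I` of `ι` separates `i ≠ j`, in the sense that `i ∈ I` and `j ∉ I`,
with probability `1 / 4`. -/
lemma sum_offDiag_eq_sum_finset (q : ι → ι → ℝ) :
    ∑ i, ∑ j ∈ Finset.univ.erase i, q i j =
      ∑ I : Finset ι, (2 ^ Fintype.card ι)⁻¹ * (4 * ∑ i ∈ I, ∑ j ∈ Iᶜ, q i j) := by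
  have hterm : ∀ i j, ∑ I : Finset ι, (if i ∈ I ∧ j ∉ I then q i j else 0)
      = if i = j then 0 else 2 ^ Fintype.card ι / 4 * q i j := by
    intro i j
    split_ifs with hij
    · simp [hij]
    · rw [← Finset.sum_filter, Finset.sum_const, nsmul_eq_mul, ← Nat.cast_ofNat (n := 2),
        ← Nat.cast_pow, ← four_mul_card_filter_mem_notMem hij]
      push_cast
      ring
  have hsplit : ∀ I : Finset ι, ∑ i ∈ I, ∑ j ∈ Iᶜ, q i j
      = ∑ i, ∑ j, if i ∈ I ∧ j ∉ I then q i j else 0 := by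
    intro I
    simp only [ite_and, Finset.sum_ite_irrel, Finset.sum_const_zero, Finset.sum_ite_mem,
      ← Finset.mem_compl, Finset.univ_inter]
  rw [← Finset.mul_sum, ← Finset.mul_sum, Finset.sum_congr rfl fun I _ => hsplit I,
    Finset.sum_comm, Finset.mul_sum, Finset.mul_sum]
  refine Finset.sum_congr rfl fun i _ => ?_
  rw [Finset.sum_comm, Finset.sum_congr rfl fun j _ => hterm i j, ← Finset.add_sum_erase _ _
    (Finset.mem_univ i), if_pos rfl, zero_add, Finset.mul_sum, Finset.mul_sum]
  refine Finset.sum_congr rfl fun j hj => ?_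
  rw [if_neg (Finset.ne_of_mem_erase hj).symm]
  field_simp

end Decoupling

section HansonWright

open scoped NNReal Matrix.Norms.L2Operator

variable {Ω ι : Type*} [MeasurableSpace Ω] {P : Measure Ω}

/-- A family of independent centered complex random variables, bounded by `b`, with common
variance `τ`. -/
structure IsBoundedCentered (u : ι → Ω → ℂ) (b : ℝ≥0) (τ : ℝ) (P : Measure Ω) : Prop where
  measurable : ∀ i, Measurable (u i)
  indep : iIndepFun u P
  bound : ∀ i ω, ‖u i ω‖ ≤ b
  mean : ∀ i, ∫ ω, u i ω ∂P = 0
  var : ∀ i, ∫ ω, ‖u i ω‖ ^ 2 ∂P = τ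

variable {u : ι → Ω → ℂ} {b : ℝ≥0} {τ : ℝ}

lemma IsBoundedCentered.isProbabilityMeasure (h : IsBoundedCentered u b τ P) :
    IsProbabilityMeasure P :=
  h.indep.isProbabilityMeasure

lemma IsBoundedCentered.hasSubgaussianMGF_re_star_mul (h : IsBoundedCentered u b τ P) (i : ι)
    (w : ℂ) : HasSubgaussianMGF (fun ω => (star (u i ω) * w).re) ((b * ‖w‖₊) ^ 2) P := by
  have := h.isProbabilityMeasure
  have hu := h.measurable i
  refine hasSubgaussianMGF_of_abs_le (by fun_prop) (fun ω => ?_) ?_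
  · calc |(star (u i ω) * w).re| ≤ ‖star (u i ω) * w‖ := Complex.abs_re_le_norm _
      _ = ‖u i ω‖ * ‖w‖ := by rw [norm_mul, norm_star]
      _ ≤ ↑(b * ‖w‖₊) := by
          rw [NNReal.coe_mul, coe_nnnorm]
          gcongr
          exact h.bound i ω
  · have hint : Integrable (fun ω => star (u i ω) * w) P :=
      Integrable.of_bound (by fun_prop) (b * ‖w‖) (ae_of_all _ fun ω => by
        rw [norm_mul, norm_star]
        gcongr
        exact h.bound i ω)
    have hzero : ∫ ω, star (u i ω) * w ∂P = 0 := by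
      simp only [RCLike.star_def, integral_mul_const, integral_conj, h.mean i, map_zero, zero_mul]
    exact (integral_re hint).trans (by rw [hzero, map_zero])

lemma IsBoundedCentered.hasSubgaussianMGF_sum_re_star_mul (h : IsBoundedCentered u b τ P)
    (s : Finset ι) (w : ι → ℂ) :
    HasSubgaussianMGF (fun ω => ∑ i ∈ s, (star (u i ω) * w i).re) (∑ i ∈ s, (b * ‖w i‖₊) ^ 2) P :=
  HasSubgaussianMGF.sum_of_iIndepFun
    (h.indep.comp (fun i z => (star z * w i).re) fun i => by fun_prop)
    fun i _ => h.hasSubgaussianMGF_re_star_mul i (w i)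

variable [Fintype ι] [DecidableEq ι]

lemma IsBoundedCentered.hasSubgaussianMGF_sum_re_star_mul_mulVec (h : IsBoundedCentered u b τ P)
    (D : Matrix ι ι ℂ) (I : Finset ι) {y : ι → ℂ} (hy : ∀ j, ‖y j‖ ≤ b) :
    HasSubgaussianMGF (fun ω => ∑ i ∈ I, (star (u i ω) * (D *ᵥ y) i).re)
      (b ^ 4 * ‖D‖₊ ^ 2 * Fintype.card ι) P := by
  refine hasSubgaussianMGF_mono (h.hasSubgaussianMGF_sum_re_star_mul I (D *ᵥ y)) ?_
  have hsq : sqNorm y ≤ b ^ 2 * Fintype.card ι := by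
    calc sqNorm y ≤ ∑ _j : ι, (b : ℝ) ^ 2 := Finset.sum_le_sum fun j _ => by
          gcongr
          exact hy j
      _ = b ^ 2 * Fintype.card ι := by simp [mul_comm]
  rw [← NNReal.coe_le_coe]
  push_cast
  calc ∑ i ∈ I, (b * ‖(D *ᵥ y) i‖) ^ 2 ≤ ∑ i, (b * ‖(D *ᵥ y) i‖) ^ 2 :=
        Finset.sum_le_sum_of_subset_of_nonneg (Finset.subset_univ I) fun i _ _ => by positivity
    _ = b ^ 2 * sqNorm (D *ᵥ y) := by simp only [sqNorm, mul_pow, Finset.mul_sum]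
    _ ≤ b ^ 2 * (‖D‖ ^ 2 * (b ^ 2 * Fintype.card ι)) := by
        gcongr
        exact (sqNorm_mulVec_le D y).trans (by gcongr)
    _ = b ^ 4 * ‖D‖ ^ 2 * Fintype.card ι := by ring

lemma IsBoundedCentered.hasSubgaussianMGF_decoupled (h : IsBoundedCentered u b τ P)
    (D : Matrix ι ι ℂ) (I : Finset ι) :
    HasSubgaussianMGF (fun ω => ∑ i ∈ I, ∑ j ∈ Iᶜ, (star (u i ω) * D i j * u j ω).re)
      (b ^ 4 * ‖D‖₊ ^ 2 * Fintype.card ι) P := by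
  have := h.isProbabilityMeasure
  have hind := h.indep.indepFun_finset I Iᶜ disjoint_compl_right h.measurable
  have hu := h.measurable
  let F : (I → ℂ) × ((Iᶜ : Finset ι) → ℂ) → ℝ := fun p =>
    ∑ i : I, ∑ j : (Iᶜ : Finset ι), (star (p.1 i) * D i j * p.2 j).re
  have hF : Measurable F := by fun_prop
  have hFu : (fun ω => ∑ i ∈ I, ∑ j ∈ Iᶜ, (star (u i ω) * D i j * u j ω).re)
      = fun ω => F (fun i => u i ω, fun j => u j ω) := by
    funext ω
    rw [← Finset.sum_coe_sort I]
    exact Finset.sum_congr rfl fun i _ =>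
      (Finset.sum_coe_sort Iᶜ fun j => (star (u i ω) * D i j * u j ω).re).symm
  rw [hFu]
  refine hasSubgaussianMGF_of_indepFun (by fun_prop) (by fun_prop) hind hF fun ω' => ?_
  let y : ι → ℂ := fun j => if j ∈ Iᶜ then u j ω' else 0
  have hFy : (fun ω => F (fun i => u i ω, fun j => u j ω'))
      = fun ω => ∑ i ∈ I, (star (u i ω) * (D *ᵥ y) i).re := by
    funext ω
    rw [← Finset.sum_coe_sort I]
    refine Finset.sum_congr rfl fun i _ => ?_
    rw [Finset.sum_coe_sort Iᶜ fun j => (star (u i ω) * D i j * u j ω').re, ← Complex.re_sum]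
    simp only [Matrix.mulVec, dotProduct, y, mul_ite, mul_zero, Finset.sum_ite_mem,
      Finset.univ_inter, Finset.mul_sum, mul_assoc]
  rw [hFy]
  refine h.hasSubgaussianMGF_sum_re_star_mul_mulVec D I fun j => ?_
  simp only [y]
  split_ifs
  exacts [h.bound j ω', by simp]

lemma IsBoundedCentered.hasSubgaussianMGF_offDiag (h : IsBoundedCentered u b τ P)
    (D : Matrix ι ι ℂ) :
    HasSubgaussianMGF
      (fun ω => ∑ i, ∑ j ∈ Finset.univ.erase i, (star (u i ω) * D i j * u j ω).re)
      (16 * (b ^ 4 * ‖D‖₊ ^ 2 * Fintype.card ι)) P := by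
  have := h.isProbabilityMeasure
  convert hasSubgaussianMGF_sum_mul (fun I => h.hasSubgaussianMGF_decoupled D I)
    (fun _ => 4 * (2 ^ Fintype.card ι)⁻¹) Finset.univ using 1
  · funext ω
    rw [sum_offDiag_eq_sum_finset]
    refine Finset.sum_congr rfl fun I _ => ?_
    push_cast
    ring
  · rw [Finset.sum_const, Finset.card_univ, Fintype.card_finset, nsmul_eq_mul]
    push_cast
    field_simp
    ring

lemma IsBoundedCentered.hasSubgaussianMGF_diag (h : IsBoundedCentered u b τ P)
    (D : Matrix ι ι ℂ) :
    HasSubgaussianMGF (fun ω => ∑ i, (D i i).re * (‖u i ω‖ ^ 2 - τ))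
      (b ^ 4 * ‖D‖₊ ^ 2 * Fintype.card ι) P := by
  have := h.isProbabilityMeasure
  have hu := h.measurable
  have hsq : ∀ i ω, ‖u i ω‖ ^ 2 ≤ (b : ℝ) ^ 2 := fun i ω => by gcongr; exact h.bound i ω
  have hint : ∀ i, Integrable (fun ω => ‖u i ω‖ ^ 2) P := fun i =>
    Integrable.of_bound (by fun_prop) (b ^ 2) (ae_of_all _ fun ω => by simpa using hsq i ω)
  have hterm : ∀ i ∈ Finset.univ, HasSubgaussianMGF (fun ω => (D i i).re * (‖u i ω‖ ^ 2 - τ))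
      ((‖D‖₊ * b ^ 2) ^ 2) P := fun i _ => by
    refine hasSubgaussianMGF_of_abs_le (by fun_prop) (fun ω => ?_) ?_
    · have hτ0 : 0 ≤ τ := h.var i ▸ integral_nonneg fun ω => by positivity
      have hτ : τ ≤ b ^ 2 := h.var i ▸
        (integral_mono (hint i) (integrable_const _) (hsq i)).trans (by simp)
      rw [abs_mul, NNReal.coe_mul, coe_nnnorm, NNReal.coe_pow]
      gcongr
      · exact (Complex.abs_re_le_norm _).trans (norm_apply_le_l2_opNorm D i i)
      · exact abs_le.2 ⟨by linarith [sq_nonneg ‖u i ω‖], by linarith [hsq i ω]⟩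
    · rw [integral_const_mul, integral_sub (hint i) (integrable_const _), h.var i]
      simp
  have hind : iIndepFun (fun i ω => (D i i).re * (‖u i ω‖ ^ 2 - τ)) P :=
    h.indep.comp (fun i z => (D i i).re * (‖z‖ ^ 2 - τ)) fun i => by fun_prop
  convert HasSubgaussianMGF.sum_of_iIndepFun hind hterm using 1
  simp only [Finset.sum_const, Finset.card_univ, nsmul_eq_mul]
  ring

lemma re_quadratic_sub_trace (D : Matrix ι ι ℂ) (τ : ℝ) (x : ι → ℂ) :
    (star x ⬝ᵥ (D *ᵥ x) - τ * D.trace).re = ∑ i, (D i i).re * (‖x i‖ ^ 2 - τ)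
      + ∑ i, ∑ j ∈ Finset.univ.erase i, (star (x i) * D i j * x j).re := by
  have hdiag : ∀ i, (star (x i) * D i i * x i).re = (D i i).re * ‖x i‖ ^ 2 := fun i => by
    rw [mul_right_comm, RCLike.star_def, Complex.conj_mul', ← Complex.ofReal_pow,
      Complex.re_ofReal_mul, mul_comm]
  have hform : (star x ⬝ᵥ (D *ᵥ x)).re = ∑ i, ∑ j, (star (x i) * D i j * x j).re := by
    simp only [dotProduct, Matrix.mulVec, Finset.mul_sum, Pi.star_apply, Complex.re_sum, mul_assoc]
  rw [Complex.sub_re, hform, Complex.re_ofReal_mul, Matrix.trace, Complex.re_sum, Finset.mul_sum,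
    ← Finset.sum_sub_distrib, ← Finset.sum_add_distrib]
  refine Finset.sum_congr rfl fun i _ => ?_
  rw [← Finset.add_sum_erase _ _ (Finset.mem_univ i), hdiag, Matrix.diag_apply]
  ring

lemma IsBoundedCentered.hasSubgaussianMGF_re_quadratic (h : IsBoundedCentered u b τ P)
    (D : Matrix ι ι ℂ) :
    HasSubgaussianMGF
      (fun ω => (star (fun i => u i ω) ⬝ᵥ (D *ᵥ fun i => u i ω) - τ * D.trace).re)
      (25 * (b ^ 4 * ‖D‖₊ ^ 2 * Fintype.card ι)) P := by
  rw [funext fun ω => re_quadratic_sub_trace D τ fun i => u i ω]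
  convert (h.hasSubgaussianMGF_diag D).add (h.hasSubgaussianMGF_offDiag D) using 1
  rw [show (16 : ℝ≥0) = 4 ^ 2 by norm_num, NNReal.sqrt_mul (4 ^ 2), NNReal.sqrt_sq,
    show ∀ x : ℝ≥0, x + 4 * x = 5 * x from fun x => by ring, mul_pow, NNReal.sq_sqrt]
  norm_num

theorem IsBoundedCentered.measure_norm_quadratic_ge_le (h : IsBoundedCentered u b τ P)
    {D : Matrix ι ι ℂ} {d : ℝ≥0} (hD : ‖D‖ ≤ d) {ε : ℝ} (hε : 0 ≤ ε) :
    P {ω | 2 * ε ≤ ‖star (fun i => u i ω) ⬝ᵥ (D *ᵥ fun i => u i ω) - τ * D.trace‖}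
      ≤ 4 * ENNReal.ofReal (Real.exp (-ε ^ 2 / (50 * (b ^ 4 * d ^ 2 * Fintype.card ι)))) := by
  have := h.isProbabilityMeasure
  set z : Ω → ℂ := fun ω => star (fun i => u i ω) ⬝ᵥ (D *ᵥ fun i => u i ω) - τ * D.trace with hz
  set E := ENNReal.ofReal (Real.exp (-ε ^ 2 / (50 * (b ^ 4 * d ^ 2 * Fintype.card ι))))
  have hrot : ∀ c : ℂ, ‖c‖ = 1 → P {ω | ε ≤ (c * z ω).re} ≤ E := by
    intro c hc
    have hform : ∀ ω, (star (fun i => u i ω) ⬝ᵥ ((c • D) *ᵥ fun i => u i ω)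
        - τ * (c • D).trace) = c * z ω := fun ω => by
      rw [hz, Matrix.smul_mulVec, dotProduct_smul, Matrix.trace_smul, smul_eq_mul, smul_eq_mul]
      ring
    have hcD : ‖c • D‖₊ ≤ d := by
      rw [← NNReal.coe_le_coe, coe_nnnorm, norm_smul, hc, one_mul]
      exact hD
    have hsub := (hasSubgaussianMGF_mono (c' := 25 * (b ^ 4 * d ^ 2 * Fintype.card ι))
      (h.hasSubgaussianMGF_re_quadratic (c • D)) (by gcongr)).measure_ge_le hε
    simp only [hform] at hsub
    rw [← ofReal_measureReal]
    refine ENNReal.ofReal_le_ofReal (hsub.trans_eq ?_)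
    push_cast
    ring_nf
  have hcover : {ω | 2 * ε ≤ ‖z ω‖} ⊆ ({ω | ε ≤ (1 * z ω).re} ∪ {ω | ε ≤ (-1 * z ω).re})
      ∪ ({ω | ε ≤ (Complex.I * z ω).re} ∪ {ω | ε ≤ (-Complex.I * z ω).re}) := by
    intro ω hω
    by_contra! hcon
    simp only [Set.mem_union, Set.mem_ofPred_eq, not_or, not_le, one_mul, neg_mul, Complex.neg_re,
      Complex.I_mul_re, neg_neg] at hcon hω
    linarith [Complex.norm_le_abs_re_add_abs_im (z ω), abs_lt.2 ⟨by linarith, hcon.1.1⟩,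
      abs_lt.2 ⟨by linarith, hcon.2.2⟩]
  calc P {ω | 2 * ε ≤ ‖z ω‖} ≤ (E + E) + (E + E) :=
        (measure_mono hcover).trans <| (measure_union_le _ _).trans <| add_le_add
          ((measure_union_le _ _).trans (add_le_add (hrot 1 (by simp)) (hrot (-1) (by simp))))
          ((measure_union_le _ _).trans
            (add_le_add (hrot Complex.I (by simp)) (hrot (-Complex.I) (by simp))))
    _ = 4 * E := by ring

end HansonWright

section Truncation

open scoped NNReal

variable {Ω : Type*} [MeasurableSpace Ω] {P : Measure Ω} {ν : Measure ℂ}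

/-- The part of `|z|²` beyond level `M`: it is `|z|²` if `M < |z|`, and `0` otherwise. -/
noncomputable def tailSq (M : ℝ) (z : ℂ) : ℝ := if M < ‖z‖ then ‖z‖ ^ 2 else 0

/-- The part of `|z|²` in the window `(M, r]`: it is `|z|²` if `M < |z| ≤ r`, and `0` otherwise. -/
noncomputable def windowSq (M r : ℝ) (z : ℂ) : ℝ := if M < ‖z‖ ∧ ‖z‖ ≤ r then ‖z‖ ^ 2 else 0

lemma tailSq_nonneg (M : ℝ) (z : ℂ) : 0 ≤ tailSq M z := by
  unfold tailSq; split_ifs <;> positivity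

lemma tailSq_le (M : ℝ) (z : ℂ) : tailSq M z ≤ ‖z‖ ^ 2 := by
  unfold tailSq; split_ifs; exacts [le_rfl, by positivity]

lemma tailSq_zero (z : ℂ) : tailSq 0 z = ‖z‖ ^ 2 := by
  unfold tailSq; split_ifs with h; exacts [rfl, by simp_all]

lemma windowSq_nonneg (M r : ℝ) (z : ℂ) : 0 ≤ windowSq M r z := by
  unfold windowSq; split_ifs <;> positivity

lemma windowSq_of_norm_le (M : ℝ) {r : ℝ} {z : ℂ} (h : ‖z‖ ≤ r) : windowSq M r z = tailSq M z := by
  simp only [windowSq, tailSq, h, and_true]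

lemma windowSq_le_tailSq (M r : ℝ) (z : ℂ) : windowSq M r z ≤ tailSq M z := by
  by_cases h : ‖z‖ ≤ r
  · exact (windowSq_of_norm_le M h).le
  · simpa only [windowSq, h, and_false, if_false] using tailSq_nonneg M z

lemma windowSq_le_sq (M r : ℝ) (z : ℂ) : windowSq M r z ≤ r ^ 2 := by
  unfold windowSq; split_ifs with h; exacts [by gcongr; exact h.2, by positivity]

lemma measurable_tailSq (M : ℝ) : Measurable (tailSq M) :=
  Measurable.ite (measurableSet_lt measurable_const measurable_norm)
    (measurable_norm.pow_const 2) measurable_const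

lemma measurable_windowSq (M r : ℝ) : Measurable (windowSq M r) :=
  Measurable.ite ((measurableSet_lt measurable_const measurable_norm).inter
    (measurableSet_le measurable_norm measurable_const))
    (measurable_norm.pow_const 2) measurable_const

lemma IsStandardized.integrable_sq (hν : IsStandardized ν) :
    Integrable (fun z : ℂ => ‖z‖ ^ 2) ν := hν.memLp_two.integrable_norm_pow two_ne_zero

lemma IsStandardized.integrable_tailSq (hν : IsStandardized ν) (M : ℝ) :
    Integrable (tailSq M) ν :=
  hν.integrable_sq.mono' (measurable_tailSq M).aestronglyMeasurable (ae_of_all _ fun z => by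
    rw [Real.norm_of_nonneg (tailSq_nonneg M z)]; exact tailSq_le M z)

lemma IsStandardized.exists_integral_tailSq_le (hν : IsStandardized ν) {ε : ℝ} (hε : 0 < ε) :
    ∃ M : ℝ≥0, 1 ≤ M ∧ ∫ z, tailSq M z ∂ν ≤ ε := by
  have hlim : Tendsto (fun m : ℕ => ∫ z, tailSq m z ∂ν) atTop (𝓝 (∫ _, (0 : ℝ) ∂ν)) := by
    refine tendsto_integral_of_dominated_convergence (fun z => ‖z‖ ^ 2)
      (fun m => (measurable_tailSq m).aestronglyMeasurable) hν.integrable_sq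
      (fun m => ae_of_all _ fun z => by
        rw [Real.norm_of_nonneg (tailSq_nonneg m z)]; exact tailSq_le m z)
      (ae_of_all _ fun z => tendsto_const_nhds.congr' ?_)
    filter_upwards [tendsto_natCast_atTop_atTop.eventually_ge_atTop ‖z‖] with m hm
    rw [tailSq, if_neg (not_lt.2 hm)]
  rw [integral_zero] at hlim
  obtain ⟨m, hm, h1⟩ := ((hlim.eventually_lt_const hε).and (eventually_ge_atTop 1)).exists
  exact ⟨m, by exact_mod_cast h1, by simpa using hm.le⟩

lemma IsIID.integral_comp {ι : Type*} {u : ι → Ω → ℂ} (h : IsIID u ν P) (i : ι) {E : Type*}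
    [NormedAddCommGroup E] [NormedSpace ℝ E] {f : ℂ → E} (hf : AEStronglyMeasurable f ν) :
    ∫ ω, f (u i ω) ∂P = ∫ z, f z ∂ν := by
  rw [← h.law i] at hf ⊢
  exact (integral_map (h.measurable i).aemeasurable hf).symm

lemma IsIID.measure_lt_norm {ι : Type*} {u : ι → Ω → ℂ} (h : IsIID u ν P) (i : ι) (r : ℝ) :
    P {ω | r < ‖u i ω‖} = ν {z | r < ‖z‖} := by
  rw [← h.law i, Measure.map_apply (h.measurable i)
    (measurableSet_lt measurable_const measurable_norm)]
  rfl

lemma IsIID.column {N k : ℕ} {s : Fin N → Fin k → Ω → ℂ}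
    (hs : IsIID (fun p : Fin N × Fin k => s p.1 p.2) ν P) (j : Fin k) :
    IsIID (fun i => s i j) ν P :=
  ⟨fun i => hs.measurable (i, j), hs.indep.precomp (g := fun i : Fin N => (i, j))
    fun _ _ h => (Prod.ext_iff.1 h).1, fun i => hs.law (i, j)⟩

lemma FromDoubleArray.rowwiseIID {K : ℕ → ℕ} {s : (N : ℕ) → Fin N → Fin (K N) → Ω → ℂ}
    (hs : FromDoubleArray s ν P) : RowwiseIID s ν P := by
  obtain ⟨x, hx, hsx⟩ := hs
  intro N
  simp only [hsx]
  have hinj : Function.Injective fun p : Fin N × Fin (K N) => ((p.1 : ℕ), (p.2 : ℕ)) :=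
    Fin.val_injective.prodMap Fin.val_injective
  exact ⟨fun p => hx.measurable (p.1, p.2), hx.indep.precomp hinj, fun p => hx.law (p.1, p.2)⟩

end Truncation

section Chernoff

variable {Ω : Type*} [MeasurableSpace Ω] {P : Measure Ω} {ν : Measure ℂ}

lemma exp_le_one_add_add_sq_mul_exp {x : ℝ} (hx : 0 ≤ x) :
    Real.exp x ≤ 1 + x + x ^ 2 * Real.exp x := by
  have h : Real.exp x ≤ 1 + x * Real.exp x := by
    have := mul_le_mul_of_nonneg_right (Real.one_sub_le_exp_neg x) (Real.exp_pos x).le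
    rw [← Real.exp_add, neg_add_cancel, Real.exp_zero] at this
    linarith
  nlinarith

lemma exp_mul_windowSq_le (M r : ℝ) {t : ℝ} (ht : 0 ≤ t) (z : ℂ) :
    Real.exp (t * windowSq M r z)
      ≤ 1 + (t * tailSq M z + t ^ 2 * Real.exp (t * r ^ 2) * ‖z‖ ^ 4) := by
  have hw := windowSq_nonneg M r z
  have hquad : (t * windowSq M r z) ^ 2 * Real.exp (t * windowSq M r z)
      ≤ t ^ 2 * Real.exp (t * r ^ 2) * ‖z‖ ^ 4 := by
    calc _ = t ^ 2 * Real.exp (t * windowSq M r z) * windowSq M r z ^ 2 := by ring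
      _ ≤ t ^ 2 * Real.exp (t * r ^ 2) * (‖z‖ ^ 2) ^ 2 := by
        gcongr
        · exact windowSq_le_sq M r z
        · exact (windowSq_le_tailSq M r z).trans (tailSq_le M z)
      _ = _ := by ring
  linarith [exp_le_one_add_add_sq_mul_exp (mul_nonneg ht hw),
    mul_le_mul_of_nonneg_left (windowSq_le_tailSq M r z) ht]

lemma integrable_exp_windowSq [IsFiniteMeasure ν] (M r : ℝ) {t : ℝ} (ht : 0 ≤ t) :
    Integrable (fun z => Real.exp (t * windowSq M r z)) ν :=
  Integrable.of_bound (Real.measurable_exp.comp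
    ((measurable_windowSq M r).const_mul t)).aestronglyMeasurable (Real.exp (t * r ^ 2))
    (ae_of_all _ fun z => by
      rw [Real.norm_of_nonneg (Real.exp_pos _).le, Real.exp_le_exp]
      exact mul_le_mul_of_nonneg_left (windowSq_le_sq M r z) ht)

lemma integral_exp_windowSq_le (hν : IsStandardized ν)
    (h4 : Integrable (fun z : ℂ => ‖z‖ ^ 4) ν) (M r : ℝ) {t : ℝ} (ht : 0 ≤ t) :
    ∫ z, Real.exp (t * windowSq M r z) ∂ν ≤ Real.exp (t * ∫ z, tailSq M z ∂ν
      + t ^ 2 * Real.exp (t * r ^ 2) * ∫ z, ‖z‖ ^ 4 ∂ν) := by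
  have := hν.isProbabilityMeasure
  have htail := (hν.integrable_tailSq M).const_mul t
  have hfour := h4.const_mul (t ^ 2 * Real.exp (t * r ^ 2))
  have hsum : Integrable
      (fun z => t * tailSq M z + t ^ 2 * Real.exp (t * r ^ 2) * ‖z‖ ^ 4) ν := htail.add hfour
  calc ∫ z, Real.exp (t * windowSq M r z) ∂ν
      ≤ ∫ z, 1 + (t * tailSq M z + t ^ 2 * Real.exp (t * r ^ 2) * ‖z‖ ^ 4) ∂ν :=
        integral_mono (integrable_exp_windowSq M r ht) ((integrable_const 1).add hsum)
          (exp_mul_windowSq_le M r ht)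
    _ = t * ∫ z, tailSq M z ∂ν + t ^ 2 * Real.exp (t * r ^ 2) * ∫ z, ‖z‖ ^ 4 ∂ν + 1 := by
        rw [integral_add (integrable_const 1) hsum, integral_add htail hfour,
          integral_const_mul, integral_const_mul]
        simp [add_comm]
    _ ≤ _ := Real.add_one_le_exp _

lemma IsIID.measure_le_sum_windowSq_le {ι : Type*} [Fintype ι] {u : ι → Ω → ℂ}
    (hu : IsIID u ν P) (hν : IsStandardized ν) (h4 : Integrable (fun z : ℂ => ‖z‖ ^ 4) ν)
    (M r x : ℝ) {t : ℝ} (ht : 0 ≤ t) :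
    P {ω | x ≤ ∑ i, windowSq M r (u i ω)} ≤ ENNReal.ofReal (Real.exp (-t * x
      + Fintype.card ι * (t * ∫ z, tailSq M z ∂ν
        + t ^ 2 * Real.exp (t * r ^ 2) * ∫ z, ‖z‖ ^ 4 ∂ν))) := by
  have := hν.isProbabilityMeasure
  have := hu.indep.isProbabilityMeasure
  have hmeas : ∀ i, Measurable fun ω => windowSq M r (u i ω) := fun i =>
    (measurable_windowSq M r).comp (hu.measurable i)
  have hind : iIndepFun (fun i ω => windowSq M r (u i ω)) P :=
    hu.indep.comp (fun _ => windowSq M r) fun _ => measurable_windowSq M r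
  have hmgf : mgf (∑ i, fun ω => windowSq M r (u i ω)) P t ≤ Real.exp (Fintype.card ι *
      (t * ∫ z, tailSq M z ∂ν + t ^ 2 * Real.exp (t * r ^ 2) * ∫ z, ‖z‖ ^ 4 ∂ν)) := by
    rw [hind.mgf_sum hmeas, Real.exp_nat_mul, ← Finset.card_univ]
    refine (Finset.prod_le_prod (fun i _ => mgf_nonneg) fun i _ => ?_).trans_eq
      (Finset.prod_const _)
    exact (hu.integral_comp i (integrable_exp_windowSq M r ht).aestronglyMeasurable).trans_le
      (integral_exp_windowSq_le hν h4 M r ht)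
  have hint : Integrable (fun ω => Real.exp (t * (∑ i, fun ω => windowSq M r (u i ω)) ω)) P := by
    refine hind.integrable_exp_mul_sum hmeas fun i _ => ?_
    exact (hu.law i ▸ integrable_exp_windowSq (ν := ν) M r ht).comp_measurable (hu.measurable i)
  have h := measure_ge_le_exp_mul_mgf (μ := P) x ht hint
  simp only [Finset.sum_apply] at h
  rw [← ofReal_measureReal, Real.exp_add]
  exact ENNReal.ofReal_le_ofReal (h.trans (by gcongr))

/-- The choice `t = (6 / ε) log n / n`, `r² = ε n / 12` makes `exp (t r²) = √n`, so that the
quadratic term of the exponent is of order `(log n)² / √n`. -/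
lemma eventually_chernoff_exponent_le {ε : ℝ} (hε : 0 < ε) (m : ℝ) :
    ∀ᶠ n : ℕ in atTop, ∀ τ ≤ ε / 2, ∀ t, t = 6 / ε * Real.log n / n →
      -t * (ε * n) + n * (t * τ + t ^ 2 * Real.exp (t * (√(ε / 12) * √n) ^ 2) * m)
        ≤ 1 - 3 * Real.log n := by
  have hlim : Tendsto (fun n : ℕ => (6 / ε) ^ 2 * m *
      (Real.log n ^ (2 : ℝ) / (n : ℝ) ^ (1 / 2 : ℝ))) atTop (𝓝 ((6 / ε) ^ 2 * m * 0)) :=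
    (((isLittleO_log_rpow_rpow_atTop 2 (by norm_num : (0 : ℝ) < 1 / 2)).tendsto_div_nhds_zero).comp
      tendsto_natCast_atTop_atTop).const_mul _
  rw [mul_zero] at hlim
  filter_upwards [hlim.eventually_lt_const zero_lt_one, eventually_ge_atTop 1]
    with n hn hn1 τ hτ t ht
  have hn0 : (0 : ℝ) < n := by exact_mod_cast hn1
  have := Real.log_natCast_nonneg n
  have hexp : Real.exp (t * (√(ε / 12) * √n) ^ 2) = √n := by
    have : t * (√(ε / 12) * √n) ^ 2 = Real.log n * (1 / 2) := by
      rw [mul_pow, Real.sq_sqrt (by positivity), Real.sq_sqrt hn0.le, ht]; field_simp; ring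
    rw [this, Real.sqrt_eq_rpow, Real.rpow_def_of_pos hn0]
  have hlin : -t * (ε * n) + n * (t * τ) ≤ -3 * Real.log n := by
    have ht0 : 0 ≤ t * n := by rw [ht]; positivity
    calc -t * (ε * n) + n * (t * τ) = t * n * (τ - ε) := by ring
      _ ≤ t * n * (ε / 2 - ε) := by gcongr
      _ = -3 * Real.log n := by rw [ht]; field_simp; ring
  have hquad : n * (t ^ 2 * √n * m)
      = (6 / ε) ^ 2 * m * (Real.log n ^ (2 : ℝ) / (n : ℝ) ^ (1 / 2 : ℝ)) := by
    rw [ht, ← Real.sqrt_eq_rpow, Real.rpow_two]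
    have : 0 < √(n : ℝ) := Real.sqrt_pos.2 hn0
    field_simp
    rw [Real.sq_sqrt hn0.le, mul_comm (n : ℝ)]
  rw [hexp, mul_add]
  linarith

lemma eventually_measure_le_sum_windowSq_le (hν : IsStandardized ν)
    (h4 : Integrable (fun z : ℂ => ‖z‖ ^ 4) ν) {ε M : ℝ} (hε : 0 < ε)
    (hM : ∫ z, tailSq M z ∂ν ≤ ε / 2) :
    ∀ᶠ n : ℕ in atTop, ∀ u : Fin n → Ω → ℂ, IsIID u ν P →
      P {ω | ε * n ≤ ∑ i, windowSq M (√(ε / 12) * √n) (u i ω)}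
        ≤ ENNReal.ofReal (Real.exp 1 / (n : ℝ) ^ 3) := by
  filter_upwards [eventually_chernoff_exponent_le hε (∫ z, ‖z‖ ^ 4 ∂ν), eventually_ge_atTop 1]
    with n hn hn1 u hu
  have hn0 : (0 : ℝ) < n := by exact_mod_cast hn1
  have ht : 0 ≤ 6 / ε * Real.log n / n := by
    have := Real.log_natCast_nonneg n
    positivity
  have hcube : Real.exp 1 / (n : ℝ) ^ 3 = Real.exp (1 - 3 * Real.log n) := by
    rw [Real.exp_sub, mul_comm (3 : ℝ), ← Real.rpow_def_of_pos hn0]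
    norm_cast
  rw [hcube]
  refine (hu.measure_le_sum_windowSq_le hν h4 M _ _ ht).trans (ENNReal.ofReal_le_ofReal ?_)
  rw [Fintype.card_fin, Real.exp_le_exp]
  exact hn _ hM _ rfl

end Chernoff

section BorelCantelli

variable {Ω : Type*} [MeasurableSpace Ω] {P : Measure Ω} {K : ℕ → ℕ} {c : ℝ}

lemma ae_eventually_notMem_of_eventually_le {S : ℕ → Set Ω} {f : ℕ → ℝ≥0∞}
    (hf : ∑' n, f n ≠ ∞) (h : ∀ᶠ n in atTop, P (S n) ≤ f n) :
    ∀ᵐ ω ∂P, ∀ᶠ n in atTop, ω ∉ S n := by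
  obtain ⟨n₀, hn₀⟩ := eventually_atTop.1 h
  have hsum : ∑' n, P (S (n + n₀)) ≠ ∞ :=
    ne_top_of_le_ne_top hf <| (ENNReal.tsum_le_tsum fun n => hn₀ (n + n₀) le_add_self).trans
      (ENNReal.tsum_comp_le_tsum_of_injective (add_left_injective n₀) f)
  filter_upwards [ae_eventually_notMem hsum] with ω hω
  rw [← map_add_atTop_eq_nat n₀]
  exact hω

lemma eventually_natCast_le_mul (hK : Tendsto (fun N : ℕ => (K N : ℝ) / (N : ℝ)) atTop (𝓝 c)) :
    ∀ᶠ N : ℕ in atTop, (K N : ℝ) ≤ (c + 1) * N := by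
  filter_upwards [hK.eventually_lt_const (lt_add_one c), eventually_gt_atTop 0] with N h hN
  exact ((div_lt_iff₀ (by exact_mod_cast hN)).1 h).le

lemma ae_eventually_forall_notMem
    (hK : Tendsto (fun N : ℕ => (K N : ℝ) / (N : ℝ)) atTop (𝓝 c))
    {S : (N : ℕ) → Fin (K N) → Set Ω} {f : ℕ → ℝ≥0∞} (hf : ∑' N : ℕ, N * f N ≠ ∞)
    (h : ∀ᶠ N in atTop, ∀ k, P (S N k) ≤ f N) :
    ∀ᵐ ω ∂P, ∀ᶠ N in atTop, ∀ k, ω ∉ S N k := by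
  have hsum : ∑' N : ℕ, ENNReal.ofReal (c + 1) * (N * f N) ≠ ∞ := by
    rw [ENNReal.tsum_mul_left]
    exact ENNReal.mul_ne_top ENNReal.ofReal_ne_top hf
  have hunion : ∀ᶠ N in atTop, P (⋃ k, S N k) ≤ ENNReal.ofReal (c + 1) * (N * f N) := by
    filter_upwards [h, eventually_natCast_le_mul hK] with N hN hKN
    calc P (⋃ k, S N k) ≤ ∑ k, P (S N k) := measure_iUnion_fintype_le P _
      _ ≤ ∑ _k : Fin (K N), f N := Finset.sum_le_sum fun k _ => hN k
      _ = ENNReal.ofReal (K N) * f N := by simp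
      _ ≤ ENNReal.ofReal ((c + 1) * N) * f N := by gcongr
      _ = _ := by rw [ENNReal.ofReal_mul' N.cast_nonneg, ENNReal.ofReal_natCast, mul_assoc]
  filter_upwards [ae_eventually_notMem_of_eventually_le hsum hunion] with ω hω
  simpa only [Set.mem_iUnion, not_exists] using hω

end BorelCantelli

section EntriesSmall

variable {Ω : Type*} [MeasurableSpace Ω] {P : Measure Ω} {ν : Measure ℂ} {K : ℕ → ℕ} {c : ℝ}

/-- The entries of the arrays are uniformly `o(√N)`, almost surely: the form in which the moment
conditions (a) and (b) enter the proof. -/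
def EntriesSmall (s : (N : ℕ) → Fin N → Fin (K N) → Ω → ℂ) (P : Measure Ω) : Prop :=
  ∀ η > 0, ∀ᵐ ω ∂P, ∀ᶠ N : ℕ in atTop, ∀ i k, ‖s N i k ω‖ ≤ η * √(N : ℝ)

lemma tsum_mul_measure_lt_le {ι : Type*} [Countable ι] {w : ι → ℝ≥0∞} {g : ι → ℝ} {f : ℂ → ℝ}
    {F : ℂ → ℝ≥0∞} (hf : Measurable f)
    (h : ∀ z, ∑' i, (if g i < f z then w i else 0) ≤ F z) :
    ∑' i, w i * ν {z | g i < f z} ≤ ∫⁻ z, F z ∂ν := by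
  have hm : ∀ i, MeasurableSet {z | g i < f z} := fun i => measurableSet_lt measurable_const hf
  calc ∑' i, w i * ν {z | g i < f z}
      = ∑' i, ∫⁻ z, {z | g i < f z}.indicator (fun _ => w i) z ∂ν := by
        simp only [lintegral_indicator_const (hm _)]
    _ = ∫⁻ z, ∑' i, {z | g i < f z}.indicator (fun _ => w i) z ∂ν :=
        (lintegral_tsum fun i => (measurable_const.indicator (hm i)).aemeasurable).symm
    _ ≤ _ := lintegral_mono h

lemma tsum_ite_natCast_lt_le {y : ℝ} (hy : 0 ≤ y) :
    ∑' N : ℕ, (if (N : ℝ) < y then (N : ℝ≥0∞) ^ 2 else 0) ≤ ENNReal.ofReal (y ^ 3) := by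
  have hsupp : ∀ N ∉ Finset.Icc 1 ⌊y⌋₊, (if (N : ℝ) < y then (N : ℝ≥0∞) ^ 2 else 0) = 0 := by
    intro N hN
    rcases N.eq_zero_or_pos with rfl | hpos
    · simp
    · rw [if_neg fun h => hN (Finset.mem_Icc.2 ⟨hpos, Nat.le_floor h.le⟩)]
  rw [tsum_eq_sum hsupp]
  calc ∑ N ∈ Finset.Icc 1 ⌊y⌋₊, (if (N : ℝ) < y then (N : ℝ≥0∞) ^ 2 else 0)
      ≤ ∑ _N ∈ Finset.Icc 1 ⌊y⌋₊, ENNReal.ofReal y ^ 2 := by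
        refine Finset.sum_le_sum fun N _ => ?_
        split_ifs with h
        · rw [← ENNReal.ofReal_natCast]
          gcongr
        · exact zero_le
    _ = ENNReal.ofReal ⌊y⌋₊ * ENNReal.ofReal y ^ 2 := by simp
    _ ≤ ENNReal.ofReal y * ENNReal.ofReal y ^ 2 := by gcongr; exact Nat.floor_le hy
    _ = ENNReal.ofReal (y ^ 3) := by rw [ENNReal.ofReal_pow hy]; ring

lemma tsum_ite_max_add_one_lt_le {y : ℝ} (hy : 0 ≤ y) :
    ∑' p : ℕ × ℕ, (if (max p.1 p.2 + 1 : ℝ) < y then 1 else 0) ≤ ENNReal.ofReal (y ^ 2) := by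
  have hsupp : ∀ p ∉ Finset.range ⌊y⌋₊ ×ˢ Finset.range ⌊y⌋₊,
      (if (max p.1 p.2 + 1 : ℝ) < y then (1 : ℝ≥0∞) else 0) = 0 := by
    refine fun p hp => if_neg fun h => hp ?_
    have hmax : max p.1 p.2 + 1 ≤ ⌊y⌋₊ := Nat.le_floor (by exact_mod_cast h.le)
    rw [Finset.mem_product, Finset.mem_range, Finset.mem_range]
    exact ⟨(Nat.lt_succ_of_le (le_max_left _ _)).trans_le hmax,
      (Nat.lt_succ_of_le (le_max_right _ _)).trans_le hmax⟩
  rw [tsum_eq_sum hsupp]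
  calc ∑ p ∈ Finset.range ⌊y⌋₊ ×ˢ Finset.range ⌊y⌋₊,
        (if (max p.1 p.2 + 1 : ℝ) < y then (1 : ℝ≥0∞) else 0)
      ≤ ∑ _p ∈ Finset.range ⌊y⌋₊ ×ˢ Finset.range ⌊y⌋₊, 1 :=
        Finset.sum_le_sum fun p _ => by split_ifs <;> simp
    _ = ENNReal.ofReal ⌊y⌋₊ ^ 2 := by simp [sq]
    _ ≤ ENNReal.ofReal y ^ 2 := by gcongr; exact Nat.floor_le hy
    _ = ENNReal.ofReal (y ^ 2) := (ENNReal.ofReal_pow hy 2).symm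

lemma mul_sqrt_lt_iff {η x r : ℝ} (hη : 0 < η) (hx : 0 ≤ x) (hr : 0 ≤ r) :
    η * √r < x ↔ r < (x / η) ^ 2 := by
  rw [mul_comm, ← lt_div_iff₀ hη, Real.sqrt_lt hr (by positivity)]

lemma IsIID.measure_mul_sqrt_lt_norm {ι : Type*} {u : ι → Ω → ℂ} (h : IsIID u ν P) (i : ι)
    {η r : ℝ} (hη : 0 < η) (hr : 0 ≤ r) :
    P {ω | η * √r < ‖u i ω‖} = ν {z | r < (‖z‖ / η) ^ 2} := by
  rw [h.measure_lt_norm]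
  simp only [mul_sqrt_lt_iff hη (norm_nonneg _) hr]

lemma lintegral_ofReal_norm_div_pow_ne_top {n : ℕ} (h : Integrable (fun z : ℂ => ‖z‖ ^ n) ν)
    (η : ℝ) : ∫⁻ z, ENNReal.ofReal ((‖z‖ / η) ^ n) ∂ν ≠ ∞ := by
  simp only [div_pow]
  exact (h.div_const (η ^ n)).lintegral_lt_top.ne

theorem entriesSmall_of_rowwiseIID
    (hK : Tendsto (fun N : ℕ => (K N : ℝ) / (N : ℝ)) atTop (𝓝 c))
    {s : (N : ℕ) → Fin N → Fin (K N) → Ω → ℂ} (hs : RowwiseIID s ν P)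
    (h6 : Integrable (fun z : ℂ => ‖z‖ ^ 6) ν) : EntriesSmall s P := by
  intro η hη
  have hsum : ∑' N : ℕ, N * (N * ν {z | (N : ℝ) < (‖z‖ / η) ^ 2}) ≠ ∞ := by
    simp only [← mul_assoc, ← sq]
    refine ne_top_of_le_ne_top (lintegral_ofReal_norm_div_pow_ne_top h6 η)
      (tsum_mul_measure_lt_le (by fun_prop) fun z => ?_)
    exact (tsum_ite_natCast_lt_le (by positivity)).trans_eq (by rw [← pow_mul])
  have hcolumn : ∀ (N : ℕ) (k : Fin (K N)), P (⋃ i, {ω | η * √(N : ℝ) < ‖s N i k ω‖})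
      ≤ N * ν {z | (N : ℝ) < (‖z‖ / η) ^ 2} := by
    intro N k
    refine (measure_iUnion_fintype_le P _).trans_eq ?_
    simp only [fun i => (hs N).measure_mul_sqrt_lt_norm (i, k) hη N.cast_nonneg]
    simp
  filter_upwards [ae_eventually_forall_notMem hK hsum (.of_forall hcolumn)] with ω hω
  filter_upwards [hω] with N hN i k
  simpa using fun h => hN k (Set.mem_iUnion.2 ⟨i, h⟩)

theorem entriesSmall_of_fromDoubleArray
    (hK : Tendsto (fun N : ℕ => (K N : ℝ) / (N : ℝ)) atTop (𝓝 c))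
    {s : (N : ℕ) → Fin N → Fin (K N) → Ω → ℂ} (hs : FromDoubleArray s ν P)
    (h4 : Integrable (fun z : ℂ => ‖z‖ ^ 4) ν) : EntriesSmall s P := by
  obtain ⟨x, hx, hsx⟩ := hs
  have hc : 0 ≤ c := ge_of_tendsto' hK fun N => by positivity
  intro η hη
  set δ := η / √(c + 1)
  have hδ : 0 < δ := by positivity
  have hsum : ∑' p : ℕ × ℕ, P {ω | δ * √(max p.1 p.2 + 1 : ℝ) < ‖x p.1 p.2 ω‖} ≠ ∞ := by
    simp only [fun p : ℕ × ℕ => hx.measure_mul_sqrt_lt_norm p hδ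
      (by positivity : (0 : ℝ) ≤ max p.1 p.2 + 1)]
    refine ne_top_of_le_ne_top (lintegral_ofReal_norm_div_pow_ne_top h4 δ) ?_
    simpa only [one_mul] using tsum_mul_measure_lt_le (w := fun _ => 1) (by fun_prop) fun z =>
      (tsum_ite_max_add_one_lt_le (by positivity)).trans_eq (by rw [← pow_mul])
  filter_upwards [ae_finite_setOfPred_mem hsum] with ω hω
  obtain ⟨B, hB⟩ := (hω.image fun p => ‖x p.1 p.2 ω‖).bddAbove
  have hlim : Tendsto (fun N : ℕ => η * √(N : ℝ)) atTop atTop :=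
    (Real.tendsto_sqrt_atTop.comp tendsto_natCast_atTop_atTop).const_mul_atTop hη
  filter_upwards [hlim.eventually_ge_atTop B, eventually_natCast_le_mul hK] with N hBN hKN i k
  rw [hsx]
  by_cases hmem : δ * √(max (i : ℕ) (k : ℕ) + 1 : ℝ) < ‖x i k ω‖
  · exact (hB ⟨((i : ℕ), (k : ℕ)), hmem, rfl⟩).trans hBN
  have hmax : (max (i : ℕ) (k : ℕ) + 1 : ℝ) ≤ (c + 1) * N := by
    have hi : ((i : ℕ) + 1 : ℝ) ≤ N := by exact_mod_cast i.2
    have hk : ((k : ℕ) + 1 : ℝ) ≤ K N := by exact_mod_cast k.2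
    have hN : (N : ℝ) ≤ (c + 1) * N := le_mul_of_one_le_left N.cast_nonneg (by linarith)
    rw [Nat.cast_max, ← max_add_add_right]
    exact max_le (hi.trans hN) (hk.trans hKN)
  calc ‖x i k ω‖ ≤ δ * √(max (i : ℕ) (k : ℕ) + 1 : ℝ) := not_lt.1 hmem
    _ ≤ δ * √((c + 1) * N) := by gcongr
    _ = η * √(N : ℝ) := by rw [Real.sqrt_mul (by positivity)]; simp only [δ]; field_simp

end EntriesSmall

section Columns

variable {Ω : Type*} [MeasurableSpace Ω] {P : Measure Ω} {ν : Measure ℂ} {K : ℕ → ℕ} {c : ℝ}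
  {s : (N : ℕ) → Fin N → Fin (K N) → Ω → ℂ}

theorem ae_eventually_sum_tailSq_le (hν : IsStandardized ν)
    (h4 : Integrable (fun z : ℂ => ‖z‖ ^ 4) ν)
    (hK : Tendsto (fun N : ℕ => (K N : ℝ) / (N : ℝ)) atTop (𝓝 c))
    (hs : RowwiseIID s ν P) (hsmall : EntriesSmall s P)
    {ε M : ℝ} (hε : 0 < ε) (hM : ∫ z, tailSq M z ∂ν ≤ ε / 2) :
    ∀ᵐ ω ∂P, ∀ᶠ N : ℕ in atTop, ∀ k, ∑ i, tailSq M (s N i k ω) ≤ ε * N := by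
  have hsum : ∑' N : ℕ, N * ENNReal.ofReal (Real.exp 1 / (N : ℝ) ^ 3) ≠ ∞ := by
    have hsummable : Summable fun N : ℕ => Real.exp 1 * (1 / (N : ℝ) ^ 2) :=
      (Real.summable_one_div_nat_pow.2 one_lt_two).mul_left _
    convert hsummable.tsum_ofReal_ne_top using 3 with N
    rw [← ENNReal.ofReal_natCast, ← ENNReal.ofReal_mul N.cast_nonneg]
    congr 1
    rcases N.eq_zero_or_pos with rfl | hN
    · simp
    · field_simp
  have hwindow : ∀ᵐ ω ∂P, ∀ᶠ N : ℕ in atTop, ∀ k,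
      ω ∉ {ω | ε * N ≤ ∑ i, windowSq M (√(ε / 12) * √N) (s N i k ω)} := by
    refine ae_eventually_forall_notMem hK hsum ?_
    filter_upwards [eventually_measure_le_sum_windowSq_le (P := P) hν h4 hε hM] with N hN k
    exact hN _ ((hs N).column k)
  filter_upwards [hwindow, hsmall √(ε / 12) (by positivity)] with ω hω hω'
  filter_upwards [hω, hω'] with N hN hN' k
  simp only [← windowSq_of_norm_le M (hN' _ k)]
  exact (not_le.1 (hN k)).le

lemma ae_eventually_sqNorm_column_le (hν : IsStandardized ν)
    (h4 : Integrable (fun z : ℂ => ‖z‖ ^ 4) ν)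
    (hK : Tendsto (fun N : ℕ => (K N : ℝ) / (N : ℝ)) atTop (𝓝 c))
    (hs : RowwiseIID s ν P) (hsmall : EntriesSmall s P) :
    ∀ᵐ ω ∂P, ∀ᶠ N : ℕ in atTop, ∀ k, sqNorm (fun i => s N i k ω) ≤ 2 * N := by
  simpa only [tailSq_zero, sqNorm] using ae_eventually_sum_tailSq_le (M := 0) hν h4 hK hs hsmall
    two_pos (by simp [tailSq_zero, hν.second_moment])

end Columns

section CenteredTruncation

open scoped NNReal

variable {Ω : Type*} [MeasurableSpace Ω] {P : Measure Ω} {ν : Measure ℂ} {M : ℝ}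

/-- Truncation at level `M`. -/
noncomputable def cut (M : ℝ) (z : ℂ) : ℂ := if ‖z‖ ≤ M then z else 0

/-- Truncation at level `M`, centered with respect to `ν`. -/
noncomputable def centeredCut (M : ℝ) (ν : Measure ℂ) (z : ℂ) : ℂ := cut M z - ∫ w, cut M w ∂ν

/-- The variance under `ν` of the truncation at level `M`. -/
noncomputable def cutVar (M : ℝ) (ν : Measure ℂ) : ℝ := ∫ z, ‖centeredCut M ν z‖ ^ 2 ∂ν

lemma measurable_cut (M : ℝ) : Measurable (cut M) :=
  Measurable.ite (measurableSet_le measurable_norm measurable_const) measurable_id measurable_const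

lemma measurable_centeredCut (M : ℝ) (ν : Measure ℂ) : Measurable (centeredCut M ν) :=
  (measurable_cut M).sub_const _

lemma norm_cut_le (hM : 0 ≤ M) (z : ℂ) : ‖cut M z‖ ≤ M := by
  unfold cut
  split_ifs with h
  exacts [h, by simpa using hM]

lemma norm_cut_sq (M : ℝ) (z : ℂ) : ‖cut M z‖ ^ 2 = ‖z‖ ^ 2 - tailSq M z := by
  unfold cut tailSq
  by_cases h : ‖z‖ ≤ M
  · simp [h, not_lt.2 h]
  · simp [h, not_le.1 h]

lemma norm_sub_cut_sq (M : ℝ) (z : ℂ) : ‖z - cut M z‖ ^ 2 = tailSq M z := by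
  unfold cut tailSq
  by_cases h : ‖z‖ ≤ M
  · simp [h, not_lt.2 h]
  · simp [h, not_le.1 h]

lemma norm_sub_cut_le (hM : 1 ≤ M) (z : ℂ) : ‖z - cut M z‖ ≤ tailSq M z := by
  unfold cut tailSq
  by_cases h : ‖z‖ ≤ M
  · simp [h, not_lt.2 h]
  · simp only [h, if_false, not_le.1 h, if_true, sub_zero]
    exact le_self_pow₀ (hM.trans (not_le.1 h).le) two_ne_zero

lemma integrable_cut [IsFiniteMeasure ν] (hM : 0 ≤ M) : Integrable (cut M) ν :=
  Integrable.of_bound (measurable_cut M).aestronglyMeasurable M (ae_of_all _ (norm_cut_le hM))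

lemma norm_centeredCut_le [IsProbabilityMeasure ν] (hM : 0 ≤ M) (z : ℂ) :
    ‖centeredCut M ν z‖ ≤ 2 * M := by
  have hmean : ‖∫ w, cut M w ∂ν‖ ≤ M := by
    simpa using norm_integral_le_of_norm_le_const (μ := ν) (ae_of_all _ (norm_cut_le hM))
  rw [centeredCut]
  linarith [norm_sub_le (cut M z) (∫ w, cut M w ∂ν), norm_cut_le hM z]

lemma integral_centeredCut [IsProbabilityMeasure ν] (hM : 0 ≤ M) :
    ∫ z, centeredCut M ν z ∂ν = 0 := by
  simp only [centeredCut]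
  rw [integral_sub (integrable_cut hM) (integrable_const _)]
  simp

lemma integral_norm_sub_integral_sq {α E : Type*} [MeasurableSpace α] {μ : Measure α}
    [IsProbabilityMeasure μ] [NormedAddCommGroup E] [InnerProductSpace ℝ E] [CompleteSpace E]
    {f : α → E} (hf : Integrable f μ) (hf2 : Integrable (fun x => ‖f x‖ ^ 2) μ) :
    ∫ x, ‖f x - ∫ y, f y ∂μ‖ ^ 2 ∂μ = ∫ x, ‖f x‖ ^ 2 ∂μ - ‖∫ y, f y ∂μ‖ ^ 2 := by
  set m := ∫ y, f y ∂μ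
  have hinner : Integrable (fun x => 2 * inner ℝ m (f x)) μ := (hf.const_inner m).const_mul 2
  have hsub : Integrable (fun x => ‖f x‖ ^ 2 - 2 * inner ℝ m (f x)) μ := hf2.sub hinner
  simp only [norm_sub_sq_real, real_inner_comm m]
  rw [integral_add hsub (integrable_const _), integral_sub hf2 hinner,
    integral_const_mul, integral_inner hf, real_inner_self_eq_norm_sq]
  simp only [integral_const, probReal_univ, one_smul]
  ring

lemma IsStandardized.norm_integral_cut_le (hν : IsStandardized ν) (hM : 1 ≤ M) :
    ‖∫ z, cut M z ∂ν‖ ≤ ∫ z, tailSq M z ∂ν := by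
  have := hν.isProbabilityMeasure
  have hsub : ∫ z, (z - cut M z) ∂ν = -∫ z, cut M z ∂ν := by
    rw [integral_sub (hν.memLp_two.integrable one_le_two) (integrable_cut (zero_le_one.trans hM)),
      hν.mean_zero, zero_sub]
  rw [← norm_neg, ← hsub]
  exact norm_integral_le_of_norm_le (hν.integrable_tailSq M) (ae_of_all _ (norm_sub_cut_le hM))

lemma IsStandardized.cutVar_eq (hν : IsStandardized ν) (hM : 0 ≤ M) :
    cutVar M ν = 1 - ∫ z, tailSq M z ∂ν - ‖∫ z, cut M z ∂ν‖ ^ 2 := by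
  have := hν.isProbabilityMeasure
  have hsq : Integrable (fun z => ‖cut M z‖ ^ 2) ν := by
    simp only [norm_cut_sq]
    exact hν.integrable_sq.sub (hν.integrable_tailSq M)
  simp only [cutVar, centeredCut]
  rw [integral_norm_sub_integral_sq (integrable_cut hM) hsq]
  simp only [norm_cut_sq]
  rw [integral_sub hν.integrable_sq (hν.integrable_tailSq M), hν.second_moment]

lemma IsStandardized.abs_cutVar_sub_one_le (hν : IsStandardized ν) (hM : 1 ≤ M) :
    |cutVar M ν - 1| ≤ ∫ z, tailSq M z ∂ν + (∫ z, tailSq M z ∂ν) ^ 2 := by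
  have htail : 0 ≤ ∫ z, tailSq M z ∂ν := integral_nonneg (tailSq_nonneg M)
  have hmean := pow_le_pow_left₀ (norm_nonneg _) (hν.norm_integral_cut_le hM) 2
  rw [hν.cutVar_eq (zero_le_one.trans hM), abs_le]
  constructor <;> linarith [sq_nonneg ‖∫ z, cut M z ∂ν‖, sq_nonneg (∫ z, tailSq M z ∂ν)]

lemma IsStandardized.norm_sub_centeredCut_sq_le (hν : IsStandardized ν) (hM : 1 ≤ M) (z : ℂ) :
    ‖z - centeredCut M ν z‖ ^ 2 ≤ 2 * (tailSq M z + (∫ w, tailSq M w ∂ν) ^ 2) := by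
  calc ‖z - centeredCut M ν z‖ ^ 2 = ‖(z - cut M z) + ∫ w, cut M w ∂ν‖ ^ 2 := by
        rw [centeredCut, sub_sub_eq_add_sub, add_sub_right_comm]
    _ ≤ (‖z - cut M z‖ + ‖∫ w, cut M w ∂ν‖) ^ 2 := by
        gcongr
        exact norm_add_le _ _
    _ ≤ 2 * (‖z - cut M z‖ ^ 2 + ‖∫ w, cut M w ∂ν‖ ^ 2) := add_sq_le
    _ ≤ 2 * (tailSq M z + (∫ w, tailSq M w ∂ν) ^ 2) := by
        rw [norm_sub_cut_sq]
        gcongr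
        exact hν.norm_integral_cut_le hM

lemma IsStandardized.sqNorm_sub_centeredCut_le {ι : Type*} [Fintype ι] (hν : IsStandardized ν)
    (hM : 1 ≤ M) (x : ι → ℂ) :
    sqNorm (x - fun i => centeredCut M ν (x i))
      ≤ 2 * (∑ i, tailSq M (x i) + Fintype.card ι * (∫ z, tailSq M z ∂ν) ^ 2) := by
  calc _ ≤ ∑ i, 2 * (tailSq M (x i) + (∫ z, tailSq M z ∂ν) ^ 2) :=
        Finset.sum_le_sum fun i _ => hν.norm_sub_centeredCut_sq_le hM (x i)
    _ = _ := by
        rw [← Finset.mul_sum, Finset.sum_add_distrib, Finset.sum_const, nsmul_eq_mul,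
          Finset.card_univ]

lemma IsStandardized.sqrt_sqNorm_sub_centeredCut_le {ι : Type*} [Fintype ι]
    (hν : IsStandardized ν) {δ : ℝ} (hM : 1 ≤ M) (hδ : 0 ≤ δ)
    (htail : (∫ z, tailSq M z ∂ν) ^ 2 ≤ δ ^ 2) {x : ι → ℂ}
    (hxtail : ∑ i, tailSq M (x i) ≤ δ ^ 2 * Fintype.card ι) :
    √(sqNorm (x - fun i => centeredCut M ν (x i))) ≤ 2 * δ * √(Fintype.card ι) := by
  rw [← Real.sqrt_sq (by positivity : 0 ≤ 2 * δ), ← Real.sqrt_mul (sq_nonneg _)]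
  refine Real.sqrt_le_sqrt ?_
  calc sqNorm (x - fun i => centeredCut M ν (x i))
      ≤ 2 * (∑ i, tailSq M (x i) + Fintype.card ι * (∫ z, tailSq M z ∂ν) ^ 2) :=
        hν.sqNorm_sub_centeredCut_le hM x
    _ ≤ 2 * (δ ^ 2 * Fintype.card ι + Fintype.card ι * δ ^ 2) := by gcongr
    _ = (2 * δ) ^ 2 * Fintype.card ι := by ring

lemma IsIID.isBoundedCentered {ι : Type*} {u : ι → Ω → ℂ} (hu : IsIID u ν P)
    [IsProbabilityMeasure ν] (M : ℝ≥0) :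
    IsBoundedCentered (fun i ω => centeredCut M ν (u i ω)) (2 * M) (cutVar M ν) P where
  measurable i := (measurable_centeredCut M ν).comp (hu.measurable i)
  indep := hu.indep.comp (fun _ => centeredCut M ν) fun _ => measurable_centeredCut M ν
  bound i ω := by simpa using norm_centeredCut_le M.coe_nonneg (u i ω)
  mean i := by
    rw [hu.integral_comp i (measurable_centeredCut M ν).aestronglyMeasurable,
      integral_centeredCut M.coe_nonneg]
  var i := hu.integral_comp i
    ((measurable_centeredCut M ν).norm.pow_const 2).aestronglyMeasurable

end CenteredTruncation

section Comparison

open scoped Matrix.Norms.L2Operator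

variable {ι : Type*} [Fintype ι] [DecidableEq ι]

lemma norm_quadratic_sub_le (D : Matrix ι ι ℂ) (x u : ι → ℂ) :
    ‖star x ⬝ᵥ (D *ᵥ x) - star u ⬝ᵥ (D *ᵥ u)‖
      ≤ ‖D‖ * (√(sqNorm (x - u)) * (2 * √(sqNorm x) + √(sqNorm (x - u)))) := by
  set v := x - u
  have hsplit : star x ⬝ᵥ (D *ᵥ x) - star u ⬝ᵥ (D *ᵥ u)
      = star x ⬝ᵥ (D *ᵥ v) + star v ⬝ᵥ (D *ᵥ x) + -(star v ⬝ᵥ (D *ᵥ v)) := by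
    rw [show u = x - v from (sub_sub_cancel x u).symm]
    simp only [star_sub, Matrix.mulVec_sub, sub_dotProduct, dotProduct_sub]
    ring
  rw [hsplit]
  calc _ ≤ ‖star x ⬝ᵥ (D *ᵥ v)‖ + ‖star v ⬝ᵥ (D *ᵥ x)‖ + ‖star v ⬝ᵥ (D *ᵥ v)‖ :=
        norm_add₃_le.trans_eq (by rw [norm_neg])
    _ ≤ ‖D‖ * (√(sqNorm x) * √(sqNorm v)) + ‖D‖ * (√(sqNorm v) * √(sqNorm x))
          + ‖D‖ * (√(sqNorm v) * √(sqNorm v)) := by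
        gcongr <;> exact norm_star_dotProduct_mulVec_le D _ _
    _ = _ := by ring

/-- The threshold `δ² / 2` on the truncated second moment makes the truncation error `2 δ √n` in
Euclidean norm and `δ²` in variance. -/
lemma IsStandardized.norm_quadratic_sub_trace_le {ν : Measure ℂ} (hν : IsStandardized ν) {M δ : ℝ}
    (hM : 1 ≤ M) (hδ : 0 ≤ δ) (hδ' : δ ≤ 1 / 2) (htail : ∫ z, tailSq M z ∂ν ≤ δ ^ 2 / 2)
    (D : Matrix ι ι ℂ) {x : ι → ℂ} (hx : sqNorm x ≤ 2 * Fintype.card ι)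
    (hxtail : ∑ i, tailSq M (x i) ≤ δ ^ 2 * Fintype.card ι) :
    ‖star x ⬝ᵥ (D *ᵥ x) - D.trace‖
      ≤ ‖star (fun i => centeredCut M ν (x i)) ⬝ᵥ (D *ᵥ fun i => centeredCut M ν (x i))
          - cutVar M ν * D.trace‖ + 9 * δ * ‖D‖ * Fintype.card ι := by
  set u : ι → ℂ := fun i => centeredCut M ν (x i)
  set n : ℝ := (Fintype.card ι : ℝ)
  have htail0 : 0 ≤ ∫ z, tailSq M z ∂ν := integral_nonneg (tailSq_nonneg M)
  have hδsq : δ ^ 2 ≤ δ / 2 := by nlinarith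
  have htail_sq : (∫ z, tailSq M z ∂ν) ^ 2 ≤ δ ^ 2 := by
    nlinarith [pow_le_of_le_one htail0 (by linarith : ∫ z, tailSq M z ∂ν ≤ 1) two_ne_zero]
  have hdist : √(sqNorm (x - u)) ≤ 2 * δ * √n :=
    hν.sqrt_sqNorm_sub_centeredCut_le hM hδ htail_sq hxtail
  have hnorm : √(sqNorm x) ≤ 3 / 2 * √n := by
    rw [← Real.sqrt_sq (by norm_num : (0 : ℝ) ≤ 3 / 2), ← Real.sqrt_mul (sq_nonneg _)]
    exact Real.sqrt_le_sqrt (hx.trans (by gcongr; norm_num))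
  have hform : ‖star x ⬝ᵥ (D *ᵥ x) - star u ⬝ᵥ (D *ᵥ u)‖ ≤ 8 * δ * ‖D‖ * n := by
    calc _ ≤ ‖D‖ * (2 * δ * √n * (2 * (3 / 2 * √n) + 2 * δ * √n)) :=
          (norm_quadratic_sub_le D x u).trans (by gcongr)
      _ = ‖D‖ * (2 * δ * (3 + 2 * δ)) * √n ^ 2 := by ring
      _ ≤ ‖D‖ * (2 * δ * 4) * n := by
          rw [Real.sq_sqrt (by positivity)]
          gcongr
          linarith
      _ = _ := by ring
  have htrace : ‖(cutVar M ν - 1 : ℝ) * D.trace‖ ≤ δ * ‖D‖ * n := by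
    rw [norm_mul, Complex.norm_real, Real.norm_eq_abs]
    calc _ ≤ δ * (n * ‖D‖) := by
          gcongr
          · linarith [hν.abs_cutVar_sub_one_le hM]
          · exact norm_trace_le D
      _ = _ := by ring
  have hsplit : star x ⬝ᵥ (D *ᵥ x) - D.trace
      = (star u ⬝ᵥ (D *ᵥ u) - cutVar M ν * D.trace)
        + (star x ⬝ᵥ (D *ᵥ x) - star u ⬝ᵥ (D *ᵥ u)) + (cutVar M ν - 1 : ℝ) * D.trace := by
    push_cast
    ring
  rw [hsplit]
  exact norm_add₃_le.trans (by linarith)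

end Comparison

section Independence

variable {Ω : Type*} [MeasurableSpace Ω] {P : Measure Ω}

lemma indepFun_prodMk_of_indepFun_prodMk {α β δ : Type*} [MeasurableSpace α] [MeasurableSpace β]
    [MeasurableSpace δ] [IsFiniteMeasure P] {X : Ω → α} {Y : Ω → β} {Z : Ω → δ}
    (hX : Measurable X) (hY : Measurable Y) (hZ : Measurable Z) (hXY : IndepFun X Y P)
    (hXYZ : IndepFun (fun ω => (X ω, Y ω)) Z P) : IndepFun X (fun ω => (Y ω, Z ω)) P := by
  have hYZ : IndepFun Y Z P := hXYZ.comp measurable_snd measurable_id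
  rw [indepFun_iff_map_prod_eq_prod_map_map hX.aemeasurable (hY.prodMk hZ).aemeasurable,
    hYZ.map_prod_eq_prod_map_map hY.aemeasurable hZ.aemeasurable, ← Measure.prodAssoc_prod,
    ← hXY.map_prod_eq_prod_map_map hX.aemeasurable hY.aemeasurable,
    ← hXYZ.map_prod_eq_prod_map_map (hX.prodMk hY).aemeasurable hZ.aemeasurable,
    Measure.map_map MeasurableEquiv.prodAssoc.measurable ((hX.prodMk hY).prodMk hZ)]
  rfl

lemma IsIID.indepFun_column_update {N K : ℕ} {ν : Measure ℂ} {s : Fin N → Fin K → Ω → ℂ}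
    (hs : IsIID (fun p : Fin N × Fin K => s p.1 p.2) ν P) (k : Fin K) :
    IndepFun (fun ω i => s i k ω) (fun ω i => Function.update (fun j => s i j ω) k 0) P := by
  let S : Finset (Fin N × Fin K) := Finset.univ.filter fun p => p.2 = k
  let φ : (S → ℂ) → Fin N → ℂ := fun x i => x ⟨(i, k), by simp [S]⟩
  let ψ : ((Sᶜ : Finset (Fin N × Fin K)) → ℂ) → Fin N → Fin K → ℂ := fun x i j =>
    if h : j = k then 0 else x ⟨(i, j), by simpa [S] using h⟩
  have hφ : Measurable φ := by fun_prop
  have hψ : Measurable ψ := measurable_pi_lambda _ fun i => measurable_pi_lambda _ fun j => by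
    by_cases h : j = k <;> simp only [ψ, h, dif_pos, dif_neg, not_false_eq_true] <;> fun_prop
  convert (hs.indep.indepFun_finset S Sᶜ disjoint_compl_right hs.measurable).comp hφ hψ using 1
  · rfl
  · funext ω i j
    simp only [Function.update_apply, Function.comp_apply, ψ, dite_eq_ite]

end Independence

section Concentration

open scoped NNReal Matrix.Norms.L2Operator

variable {Ω : Type*} [MeasurableSpace Ω] {P : Measure Ω}

lemma IsBoundedCentered.measure_norm_quadratic_ge_le_of_indepFun {ι β : Type*} [Fintype ι]
    [DecidableEq ι] [MeasurableSpace β] {u : ι → Ω → ℂ} {b : ℝ≥0} {τ : ℝ}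
    (h : IsBoundedCentered u b τ P) {Y : Ω → β} (hY : Measurable Y)
    (hind : IndepFun (fun ω i => u i ω) Y P) {D : β → Matrix ι ι ℂ}
    (hD : ∀ i j, Measurable fun y => D y i j) {d : ℝ≥0} (hd : ∀ y, ‖D y‖ ≤ d) {ε : ℝ}
    (hε : 0 ≤ ε) :
    P {ω | 2 * ε ≤ ‖star (fun i => u i ω) ⬝ᵥ (D (Y ω) *ᵥ fun i => u i ω) - τ * (D (Y ω)).trace‖}
      ≤ 4 * ENNReal.ofReal (Real.exp (-ε ^ 2 / (50 * (b ^ 4 * d ^ 2 * Fintype.card ι)))) := by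
  have := h.isProbabilityMeasure
  have hu := h.measurable
  have hS : MeasurableSet {p : (ι → ℂ) × β |
      2 * ε ≤ ‖star p.1 ⬝ᵥ (D p.2 *ᵥ p.1) - τ * (D p.2).trace‖} := by
    refine measurableSet_le measurable_const ?_
    simp only [dotProduct, Matrix.mulVec, Matrix.trace, Matrix.diag_apply, Pi.star_apply]
    fun_prop
  exact measure_le_of_indepFun (by fun_prop) hY hind hS fun ω' =>
    h.measure_norm_quadratic_ge_le (hd (Y ω')) hε

variable {L N K : ℕ} {σ : ℝ}

lemma measurable_block_regInv_interference (hσ : 0 < σ) (k : Fin K) (l l' : Fin L) (i j : Fin N) :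
    Measurable fun p : (Fin N → Fin K → ℂ) × (Fin K → Fin L → ℂ) =>
      block (regInv σ (interference p.2 p.1 k)) l l' i j := by
  have hC : Continuous fun p : (Fin N → Fin K → ℂ) × (Fin K → Fin L → ℂ) =>
      interference p.2 p.1 k + ((σ : ℂ) ^ 2) • (1 : Matrix (Fin L × Fin N) (Fin L × Fin N) ℂ) := by
    refine (continuous_matrix fun x y => ?_).add continuous_const
    simp only [interference, Matrix.smul_apply, Matrix.sub_apply, Matrix.sum_apply,
      Matrix.vecMulVec_apply, stack, Pi.star_apply]
    fun_prop
  have hinv : Continuous fun p : (Fin N → Fin K → ℂ) × (Fin K → Fin L → ℂ) =>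
      regInv σ (interference p.2 p.1 k) := by
    simp only [regInv, Matrix.inv_def, Ring.inverse_eq_inv']
    exact (hC.matrix_det.inv₀ fun p => (posDef_add_sq_smul_one
      (interference_posSemidef p.2 p.1 k) hσ).det_pos.ne').smul hC.matrix_adjugate
  exact (hinv.matrix_elem (l, i) (l', j)).measurable

lemma interference_update (a : Fin K → Fin L → ℂ) (s : Fin N → Fin K → ℂ) (k : Fin K) :
    interference a (fun i => Function.update (s i) k 0) k = interference a s k := by
  rw [interference_eq_sum_erase, interference_eq_sum_erase]
  congr 1
  refine Finset.sum_congr rfl fun j hj => ?_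
  simp only [userVector, Function.update_of_ne (Finset.ne_of_mem_erase hj)]

/-- The interference does not see the column of the `k`-th user, so the quadratic form has an
independent kernel. -/
lemma IsIID.measure_norm_centeredCut_quadratic_ge_le {ν : Measure ℂ} [IsProbabilityMeasure ν]
    {s : Fin N → Fin K → Ω → ℂ} (hs : IsIID (fun p : Fin N × Fin K => s p.1 p.2) ν P)
    {a : Ω → Fin K → Fin L → ℂ} (ha : Measurable a)
    (hind : IndepFun a (fun ω i j => s i j ω) P) (hσ : 0 < σ) (M : ℝ≥0) (k : Fin K)
    (l l' : Fin L) {ε : ℝ} (hε : 0 ≤ ε) :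
    P {ω | ε * N ≤ ‖star (fun i => centeredCut M ν (s i k ω)) ⬝ᵥ
          (block (regInv σ (interference (a ω) (fun i j => s i j ω) k)) l l' *ᵥ
            fun i => centeredCut M ν (s i k ω))
          - cutVar M ν * (block (regInv σ (interference (a ω) (fun i j => s i j ω) k)) l l').trace‖}
      ≤ 4 * ENNReal.ofReal (Real.exp (-(ε ^ 2 * σ ^ 4 / (3200 * M ^ 4) * N))) := by
  have := hs.indep.isProbabilityMeasure
  have hsm : ∀ i j, Measurable (s i j) := fun i j => hs.measurable (i, j)
  let rest : Ω → Fin N → Fin K → ℂ := fun ω i => Function.update (fun j => s i j ω) k 0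
  have hrest : Measurable rest := by
    refine measurable_pi_lambda _ fun i => measurable_pi_lambda _ fun j => ?_
    simp only [rest, Function.update_apply]
    split_ifs <;> fun_prop
  have hupdate : Measurable fun x : Fin N → Fin K → ℂ =>
      (fun i => x i k, fun i => Function.update (x i) k 0) := by
    fun_prop
  have hcol : IndepFun (fun ω i => s i k ω) (fun ω => (rest ω, a ω)) P :=
    indepFun_prodMk_of_indepFun_prodMk (by fun_prop) hrest ha (hs.indepFun_column_update k)
      (hind.symm.comp hupdate measurable_id)
  have hcut : Measurable fun (x : Fin N → ℂ) i => centeredCut M ν (x i) :=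
    measurable_pi_lambda _ fun i => (measurable_centeredCut M ν).comp (measurable_pi_apply i)
  have hnorm : ∀ p : (Fin N → Fin K → ℂ) × (Fin K → Fin L → ℂ),
      ‖block (regInv σ (interference p.2 p.1 k)) l l'‖ ≤ ((σ ^ 2)⁻¹).toNNReal := fun p => by
    rw [Real.coe_toNNReal _ (by positivity)]
    exact (norm_block_le _ l l').trans (norm_regInv_le (interference_posSemidef p.2 p.1 k) hσ)
  have hbound := ((hs.column k).isBoundedCentered M).measure_norm_quadratic_ge_le_of_indepFun
    (hrest.prodMk ha) (hcol.comp hcut measurable_id)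
    (measurable_block_regInv_interference hσ k l l') hnorm (by positivity : 0 ≤ ε * N / 2)
  simp only [rest, interference_update, mul_div_cancel₀ (ε * N) two_ne_zero] at hbound
  refine hbound.trans_eq ?_
  congr 3
  rw [Real.coe_toNNReal _ (by positivity), Fintype.card_fin]
  push_cast
  field_simp
  ring

end Concentration

section Assembly

open scoped NNReal Matrix.Norms.L2Operator

variable {Ω : Type*} [MeasurableSpace Ω] {P : Measure Ω} {L : ℕ} {K : ℕ → ℕ} {c σ : ℝ}
  {ν : Measure ℂ} {s : (N : ℕ) → Fin N → Fin (K N) → Ω → ℂ}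
  {a : (N : ℕ) → Ω → Fin (K N) → Fin L → ℂ}

lemma tsum_natCast_mul_exp_neg_ne_top {κ : ℝ} (hκ : 0 < κ) :
    ∑' N : ℕ, (N : ℝ≥0∞) * (4 * ENNReal.ofReal (Real.exp (-(κ * N)))) ≠ ∞ := by
  have h := ((Real.summable_pow_mul_exp_neg_nat_mul 1 hκ).mul_left 4).tsum_ofReal_ne_top
  convert h using 3 with N
  rw [ENNReal.ofReal_mul zero_le_four, ENNReal.ofReal_mul (by positivity), pow_one,
    ENNReal.ofReal_natCast, ENNReal.ofReal_ofNat, neg_mul, mul_left_comm]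

lemma ae_eventually_norm_centeredCut_quadratic_le [IsProbabilityMeasure ν] (hσ : 0 < σ)
    (hK : Tendsto (fun N : ℕ => (K N : ℝ) / (N : ℝ)) atTop (𝓝 c)) (hs : RowwiseIID s ν P)
    (ha : ∀ N, Measurable (a N))
    (hind : ∀ N, IndepFun (a N) (fun ω i k => s N i k ω) P) {M : ℝ≥0} (hM : 0 < M) (l l' : Fin L)
    {ε : ℝ} (hε : 0 < ε) :
    ∀ᵐ ω ∂P, ∀ᶠ N : ℕ in atTop, ∀ k,
      ‖star (fun i => centeredCut M ν (s N i k ω)) ⬝ᵥ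
          (block (regInv σ (interference (a N ω) (fun i j => s N i j ω) k)) l l' *ᵥ
            fun i => centeredCut M ν (s N i k ω))
        - cutVar M ν * (block (regInv σ
            (interference (a N ω) (fun i j => s N i j ω) k)) l l').trace‖ ≤ ε * N := by
  have hκ : 0 < ε ^ 2 * σ ^ 4 / (3200 * (M : ℝ) ^ 4) := by positivity
  filter_upwards [ae_eventually_forall_notMem hK (tsum_natCast_mul_exp_neg_ne_top hκ)
    (.of_forall fun N k => (hs N).measure_norm_centeredCut_quadratic_ge_le (ha N) (hind N) hσ M k
      l l' hε.le)] with ω hω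
  filter_upwards [hω] with N hN k
  exact (not_le.1 (hN k)).le

lemma norm_userMatrix_sub_blockTrace_apply_le {N K : ℕ} (a : Fin K → Fin L → ℂ)
    (s : Fin N → Fin K → ℂ) (k : Fin K) (l l' : Fin L) {ε : ℝ} (hN : 0 < N)
    (h : ‖star (fun i => s i k) ⬝ᵥ
        (block (regInv σ (interference a s k)) l l' *ᵥ fun i => s i k)
      - (block (regInv σ (interference a s k)) l l').trace‖ ≤ ε * N) :
    ‖(userMatrix σ a s k - blockTrace (regInv σ (interference a s k))) l l'‖ ≤ ε := by
  have hN' : (0 : ℝ) < N := by exact_mod_cast hN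
  have hform : (userMatrix σ a s k - blockTrace (regInv σ (interference a s k))) l l'
      = (N : ℂ)⁻¹ * (star (fun i => s i k) ⬝ᵥ
        (block (regInv σ (interference a s k)) l l' *ᵥ fun i => s i k)
      - (block (regInv σ (interference a s k)) l l').trace) := by
    rw [mul_sub]; rfl
  rw [hform, norm_mul, norm_inv, Complex.norm_natCast, inv_mul_le_iff₀ hN', mul_comm]
  exact h

lemma ae_eventually_norm_userMatrix_sub_blockTrace_apply_le (hν : IsStandardized ν)
    (h4 : Integrable (fun z : ℂ => ‖z‖ ^ 4) ν) (hσ : 0 < σ)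
    (hK : Tendsto (fun N : ℕ => (K N : ℝ) / (N : ℝ)) atTop (𝓝 c)) (hs : RowwiseIID s ν P)
    (hsmall : EntriesSmall s P) (ha : ∀ N, Measurable (a N))
    (hind : ∀ N, IndepFun (a N) (fun ω i k => s N i k ω) P) (l l' : Fin L) {ε : ℝ} (hε : 0 < ε) :
    ∀ᵐ ω ∂P, ∀ᶠ N : ℕ in atTop, ∀ k,
      ‖(userMatrix σ (a N ω) (fun i j => s N i j ω) k
        - blockTrace (regInv σ (interference (a N ω) (fun i j => s N i j ω) k))) l l'‖ ≤ ε := by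
  have := hν.isProbabilityMeasure
  obtain ⟨δ, hδ, hδ', hδε⟩ : ∃ δ : ℝ, 0 < δ ∧ δ ≤ 1 / 2 ∧ 9 * δ * (σ ^ 2)⁻¹ ≤ ε / 2 := by
    refine ⟨min (1 / 2) (ε * σ ^ 2 / 18), by positivity, min_le_left _ _, ?_⟩
    calc 9 * min (1 / 2) (ε * σ ^ 2 / 18) * (σ ^ 2)⁻¹ ≤ 9 * (ε * σ ^ 2 / 18) * (σ ^ 2)⁻¹ := by
          gcongr; exact min_le_right _ _
      _ = ε / 2 := by field_simp; norm_num
  obtain ⟨M, hM, htail⟩ := hν.exists_integral_tailSq_le (by positivity : 0 < δ ^ 2 / 2)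
  filter_upwards [ae_eventually_norm_centeredCut_quadratic_le hσ hK hs ha hind
      (zero_lt_one.trans_le hM) l l' (half_pos hε),
    ae_eventually_sum_tailSq_le hν h4 hK hs hsmall (by positivity) htail,
    ae_eventually_sqNorm_column_le hν h4 hK hs hsmall] with ω hquad hsum hcol
  filter_upwards [hquad, hsum, hcol, eventually_gt_atTop 0] with N hquadN hsumN hcolN hN k
  refine norm_userMatrix_sub_blockTrace_apply_le _ _ k l l' hN ?_
  set D := block (regInv σ (interference (a N ω) (fun i j => s N i j ω) k)) l l'
  have hD : ‖D‖ ≤ (σ ^ 2)⁻¹ :=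
    (norm_block_le _ l l').trans (norm_regInv_le (interference_posSemidef _ _ k) hσ)
  have hcompare := hν.norm_quadratic_sub_trace_le hM hδ.le hδ' htail D
    (x := fun i => s N i k ω) (by simpa using hcolN k) (by simpa using hsumN k)
  rw [Fintype.card_fin] at hcompare
  have herror : 9 * δ * ‖D‖ * N ≤ ε / 2 * N := by
    gcongr
    exact le_trans (by gcongr) hδε
  exact hcompare.trans ((add_le_add (hquadN k) herror).trans_eq (by ring))

theorem ae_eventually_norm_userMatrix_sub_traceMatrix_le (hν : IsStandardized ν)
    (h4 : Integrable (fun z : ℂ => ‖z‖ ^ 4) ν) (hσ : 0 < σ)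
    (hK : Tendsto (fun N : ℕ => (K N : ℝ) / (N : ℝ)) atTop (𝓝 c)) (hs : RowwiseIID s ν P)
    (hsmall : EntriesSmall s P) (ha : ∀ N, Measurable (a N))
    (hind : ∀ N, IndepFun (a N) (fun ω i k => s N i k ω) P) :
    ∀ᵐ ω ∂P, ∀ ε > 0, ∀ᶠ N : ℕ in atTop, ∀ k,
      ‖userMatrix σ (a N ω) (fun i j => s N i j ω) k
        - traceMatrix σ (a N ω) (fun i j => s N i j ω)‖ ≤ ε := by
  have hform : ∀ᵐ ω ∂P, ∀ (m : ℕ) (l l' : Fin L), ∀ᶠ N : ℕ in atTop, ∀ k,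
      ‖(userMatrix σ (a N ω) (fun i j => s N i j ω) k - blockTrace (regInv σ
        (interference (a N ω) (fun i j => s N i j ω) k))) l l'‖ ≤ 1 / (m + 1) := by
    simp only [ae_all_iff]
    exact fun m l l' => ae_eventually_norm_userMatrix_sub_blockTrace_apply_le hν h4 hσ hK hs hsmall
      ha hind l l' (by positivity)
  filter_upwards [hform] with ω hω ε hε
  obtain ⟨m, hm⟩ := exists_nat_one_div_lt (by positivity : 0 < ε / (2 * (L + 1)))
  have hremoval : ∀ᶠ N : ℕ in atTop, (σ ^ 2)⁻¹ / (N : ℝ) ≤ ε / (2 * (L + 1)) :=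
    (tendsto_const_div_atTop_nhds_zero_nat (σ ^ 2)⁻¹).eventually_le_const (by positivity)
  filter_upwards [eventually_all.2 fun l => eventually_all.2 fun l' => hω m l l', hremoval]
    with N hN hNσ k
  have hentry := l2_opNorm_le_of_norm_apply_le (by positivity) fun l l' => calc
      ‖(userMatrix σ (a N ω) (fun i j => s N i j ω) k
        - traceMatrix σ (a N ω) (fun i j => s N i j ω)) l l'‖
      ≤ ε / (2 * (L + 1)) + ε / (2 * (L + 1)) := by
        rw [← sub_add_sub_cancel _ (blockTrace (regInv σ
          (interference (a N ω) (fun i j => s N i j ω) k))), Matrix.add_apply]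
        exact norm_add_le_of_le ((hN l l' k).trans hm.le)
          ((norm_blockTrace_sub_traceMatrix_le hσ _ _ k l l').trans hNσ)
    _ = ε / (L + 1) := by field_simp; norm_num
  refine hentry.trans ?_
  rw [Fintype.card_fin, mul_div_left_comm]
  exact mul_le_of_le_one_right hε.le (div_le_one_of_le₀ (by linarith) (by positivity))

lemma tendsto_iSup_norm_userForm_sub {A : Matrix (Fin L) (Fin L) ℂ}
    {a : (N : ℕ) → Fin (K N) → Fin L → ℂ} {s : (N : ℕ) → Fin N → Fin (K N) → ℂ}
    (hclose : ∀ ε > 0, ∀ᶠ N : ℕ in atTop, ∀ k,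
      ‖userMatrix σ (a N) (s N) k - traceMatrix σ (a N) (s N)‖ ≤ ε)
    (hA : Tendsto (fun N => traceMatrix σ (a N) (s N)) atTop (𝓝 A)) (l l' : Fin L) :
    Tendsto (fun N : ℕ => ⨆ k, ‖userForm σ (a N) (s N) k l l' - A l l'‖) atTop (𝓝 0) := by
  refine Metric.tendsto_nhds.2 fun ε hε => ?_
  filter_upwards [eventually_norm_userMatrix_sub_le hclose le_rfl hA (half_pos hε)] with N hN
  rw [Real.dist_0_eq_abs, abs_of_nonneg (Real.iSup_nonneg fun k => norm_nonneg _)]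
  refine (Real.iSup_le (fun k => ?_) (half_pos hε).le).trans_lt (half_lt_self hε)
  exact (norm_apply_le_l2_opNorm _ l l').trans (hN k)

lemma integrable_norm_pow_four_of_six [IsFiniteMeasure ν]
    (h6 : Integrable (fun z : ℂ => ‖z‖ ^ 6) ν) : Integrable (fun z : ℂ => ‖z‖ ^ 4) ν := by
  refine (h6.add (integrable_const 1)).mono' (by fun_prop) (ae_of_all _ fun z => ?_)
  rw [Real.norm_of_nonneg (by positivity), Pi.add_apply]
  nlinarith [sq_nonneg (‖z‖ ^ 2 - 1), sq_nonneg ‖z‖, sq_nonneg (‖z‖ ^ 2),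
    mul_nonneg (sq_nonneg ‖z‖) (sq_nonneg (‖z‖ ^ 2 - 1))]

lemma measurable_gain : Measurable fun p : ℝ × (Fin L → ℂ) => gain p.1 p.2 := by
  unfold gain
  fun_prop

end Assembly

end CDMA

open CDMA in
theorem theorem7p1_general {Ω : Type*} [MeasurableSpace Ω] {P : Measure Ω} [IsProbabilityMeasure P]
    {L : ℕ} {K : ℕ → ℕ} {c σ : ℝ} {s : (N : ℕ) → Fin N → Fin (K N) → Ω → ℂ}
    {a : (N : ℕ) → Ω → Fin (K N) → Fin L → ℂ} {ν : Measure ℂ} (hν : IsStandardized ν)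
    (h4 : Integrable (fun z : ℂ => ‖z‖ ^ 4) ν) (hσ : 0 < σ)
    (hK : Tendsto (fun N : ℕ => (K N : ℝ) / (N : ℝ)) atTop (𝓝 c)) (hs : RowwiseIID s ν P)
    (hsmall : EntriesSmall s P) (ha : ∀ N, Measurable (a N))
    (hind : ∀ N, IndepFun (a N) (fun ω i k => s N i k ω) P)
    {H : Measure (Fin L → ℂ)} [IsFiniteMeasure H]
    (hH : ∀ᵐ ω ∂P, WeaklyConverges (fun N => empiricalMeasure (a N ω)) H) :
    ∃ A : Matrix (Fin L) (Fin L) ℂ, A.PosDef ∧ FixedPoint c σ H A ∧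
      (∀ B : Matrix (Fin L) (Fin L) ℂ, B.PosDef → FixedPoint c σ H B → B = A) ∧
      ∀ l l' : Fin L, ∀ᵐ ω ∂P, Tendsto (fun N : ℕ => ⨆ k,
        ‖userForm σ (a N ω) (fun i j => s N i j ω) k l l' - A l l'‖) atTop (𝓝 0) := by
  have hc : 0 ≤ c := ge_of_tendsto' hK fun N => by positivity
  have hclose := ae_eventually_norm_userMatrix_sub_traceMatrix_le hν h4 hσ hK hs hsmall ha hind
  have hlim : ∀ᵐ ω ∂P, ∃ A : Matrix (Fin L) (Fin L) ℂ, A.PosDef ∧ FixedPoint c σ H A ∧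
      Tendsto (fun N => traceMatrix σ (a N ω) (fun i j => s N i j ω)) atTop (𝓝 A) := by
    filter_upwards [hH, ae_eventually_sqNorm_column_le hν h4 hK hs hsmall, hclose]
      with ω hw hcol hcloseω
    exact exists_tendsto_traceMatrix hσ hK hw zero_le_two hcol hcloseω
  obtain ⟨-, A, hA, hfA, -⟩ := hlim.exists
  have huniq : ∀ B : Matrix (Fin L) (Fin L) ℂ, B.PosDef → FixedPoint c σ H B → B = A :=
    fun B hB hfB => eq_of_fixedPoint hc hσ hA hB hfA hfB
  refine ⟨A, hA, hfA, huniq, fun l l' => ?_⟩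
  filter_upwards [hlim, hclose] with ω ⟨B, hB, hfB, hBlim⟩ hcloseω
  exact tendsto_iSup_norm_userForm_sub hcloseω (huniq B hB hfB ▸ hBlim) l l'

theorem theorem7p1 {Ω : Type*} [MeasurableSpace Ω] (P : Measure Ω) [IsProbabilityMeasure P]
    (L : ℕ) (K : ℕ → ℕ) (c σ : ℝ) (hc : 0 < c) (hσ : 0 < σ)
    (hK : Tendsto (fun N : ℕ => (K N : ℝ) / (N : ℝ)) atTop (𝓝 c))
    -- the signature sequences: `s N i k` is the `i`-th entry of the sequence of user `k`
    (s : (N : ℕ) → Fin N → Fin (K N) → Ω → ℂ)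
    (ν : Measure ℂ) (hν : CDMA.IsStandardized ν)
    (hs : (CDMA.FromDoubleArray s ν P ∧ Integrable (fun z : ℂ => ‖z‖ ^ 4) ν) ∨
      (CDMA.RowwiseIID s ν P ∧ Integrable (fun z : ℂ => ‖z‖ ^ 6) ν))
    -- the transmit powers and the fading gains
    (T : (N : ℕ) → Fin (K N) → Ω → ℝ) (γ : (N : ℕ) → Fin (K N) → Fin L → Ω → ℂ)
    (hT : ∀ N k, Measurable (T N k)) (hT_nonneg : ∀ N k ω, 0 ≤ T N k ω)
    (hγ : ∀ N k l, Measurable (γ N k l))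
    (hindep : ∀ N : ℕ,
      IndepFun (fun ω (k : Fin (K N)) => (T N k ω, fun l : Fin L => γ N k l ω))
        (fun ω (i : Fin N) (k : Fin (K N)) => s N i k ω) P)
    (H : Measure (Fin L → ℂ)) [IsProbabilityMeasure H]
    (hH : ∀ᵐ ω ∂P, CDMA.WeaklyConverges
      (fun N : ℕ => CDMA.empiricalMeasure
        (fun k : Fin (K N) => CDMA.gain (T N k ω) (fun l => γ N k l ω))) H) :
    ∃ A : Matrix (Fin L) (Fin L) ℂ,
      A.PosDef ∧ CDMA.FixedPoint c σ H A ∧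
      (∀ B : Matrix (Fin L) (Fin L) ℂ, B.PosDef → CDMA.FixedPoint c σ H B → B = A) ∧
      ∀ l l' : Fin L, ∀ᵐ ω ∂P,
        Tendsto (fun N : ℕ => ⨆ k : Fin (K N),
          ‖CDMA.userForm σ (fun j => CDMA.gain (T N j ω) (fun m => γ N j m ω))
            (fun i j => s N i j ω) k l l' - A l l'‖) atTop (𝓝 0) := by
  have := hν.isProbabilityMeasure
  obtain ⟨hrow, h4, hsmall⟩ : CDMA.RowwiseIID s ν P ∧ Integrable (fun z : ℂ => ‖z‖ ^ 4) ν ∧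
      CDMA.EntriesSmall s P := by
    rcases hs with ⟨hdouble, h4⟩ | ⟨hrow, h6⟩
    · exact ⟨hdouble.rowwiseIID, h4, CDMA.entriesSmall_of_fromDoubleArray hK hdouble h4⟩
    · exact ⟨hrow, CDMA.integrable_norm_pow_four_of_six h6,
        CDMA.entriesSmall_of_rowwiseIID hK hrow h6⟩
  have hpairs : ∀ N, Measurable fun ω (k : Fin (K N)) => (T N k ω, fun l => γ N k l ω) := by
    fun_prop
  have hgain : ∀ N, Measurable fun (x : Fin (K N) → ℝ × (Fin L → ℂ)) k =>
      CDMA.gain (x k).1 (x k).2 :=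
    fun N => measurable_pi_lambda _ fun k => CDMA.measurable_gain.comp (measurable_pi_apply k)
  exact theorem7p1_general hν h4 hσ hK hrow hsmall (fun N => (hgain N).comp (hpairs N))
    (fun N => (hindep N).comp (hgain N) measurable_id) hH
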